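/- Let $\Bbbk$ be an algebraically closed field and let $A$ be a basic finite-dimensional $\Bbbk$-algebra with a fixed finite set $\{e_\lambda\}_{\lambda\in\Lambda}$ of orthogonal primitive idempotents such that $\sum_{\lambda}e_\lambda=1$. Assume that the associated category of $A$ is directed, i.e. there is a partial order $\leqslant$ on $\Lambda$ such that $e_\mu Ae_\lambda\neq 0$ implies $\lambda\leqslant\mu$. Put $A_0=\bigoplus_{\lambda}e_\lambda Ae_\lambda$, a subalgebra of $A$, and $J=\bigoplus_{\lambda\neq\mu}e_\mu Ae_\lambda$, a two-sided ideal of $A$ with $A=A_0\oplus J$. Let $\check A=\bigoplus_{i\geqslant 0}J^i/J^{i+1}$ (where $J^0=A$) be the associated graded algebra, so that $\check A_0=A/J\cong A_0$ and $\check A_1=J/J^2$ is an $A_0$-bimodule; $\check A$ is considered with the idempotents that are the images of the $e_\lambda$ in $\check A_0$. Terminology, for an algebra $B$ with such idempotents $e_\lambda$ and a linear order $\preccurlyeq$ on $\Lambda$: let $P_\lambda=Be_\lambda$ and $S_\lambda=P_\lambda/\operatorname{rad}P_\lambda$. $B$ is standardly stratified for $\preccurlyeq$ if there are quotients $\Delta_\lambda=P_\lambda/K_\lambda$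 such that, for all $\lambda$, $[\Delta_\lambda:S_\mu]=0$ whenever $\mu\not\preccurlyeq\lambda$, and $K_\lambda$ has a finite filtration with factors isomorphic to modules $\Delta_\mu$ with $\mu\succ\lambda$. $B$ is properly stratified for $\preccurlyeq$ if the left module ${}_BB$ has both a finite filtration with factors isomorphic to standard modules and one with factors isomorphic to proper standard modules; here the standard module of $\lambda$ is the largest quotient of $P_\lambda$ all of whose composition factors $S_\mu$ satisfy $\mu\preccurlyeq\lambda$, and the proper standard module of $\lambda$ is the largest quotient of $P_\lambda$ all of whose composition factors $S_\mu$ satisfy $\mu\prec\lambda$ except for one copy of $S_\lambda$. For an $A_0$-bimodule $X$, $A_0[X]=A_0\oplus X\oplus(X\otimes_{A_0}X)\oplus\cdots$ denotes its tensor algebra. Then the following are equivalent: 1. $A$ is standardly stratified (resp. properly stratified) for all linear orders on $\Lambda$; 2. $\check A$ is standardly stratified (resp. properly stratified) for all linear orders on $\Lambda$; 3. $\check A$ is the tensor algebra $A_0[\check A_1]$, i.e. there is an isomorphism of $\Bbbk$-algebras $A_0[\check A_1]\to\check A$ which is the canonical map $A_0\to A/J=\check A_0$ on $A_0$ and the inclusion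 on $\check A_1$, and $\check A_1$ is projective as a left $A_0$-module (resp. both as a left and as a right $A_0$-module). -/

import Mathlib

open scoped DirectSum

universe u v w

/-! ### Idempotents, projective and simple modules -/

section Idempotents

variable {A : Type v} [Ring A] {Λ : Type w}

/-- A primitive idempotent: a nonzero idempotent that is not the sum of two nonzero
orthogonal idempotents. -/
def IsPrimitiveIdem (e : A) : Prop :=
  IsIdempotentElem e ∧ e ≠ 0 ∧
    ∀ f g : A, IsIdempotentElem f → IsIdempotentElem g → f * g = 0 → g * f = 0 →
      e = f + g → f = 0 ∨ g = 0

/-- The left module `P_l = A e_l`. -/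
abbrev ProjMod (e : Λ → A) (l : Λ) : Submodule A A := Submodule.span A {e l}

/-- The top `S_l = P_l / rad P_l`. -/
abbrev TopMod (e : Λ → A) (l : Λ) : Type v :=
  ↥(ProjMod e l) ⧸ Module.jacobson A ↥(ProjMod e l)

/-- The algebra is basic: the modules `P_l` are pairwise non-isomorphic. -/
def IsBasicFor (e : Λ → A) : Prop :=
  Pairwise fun l m => IsEmpty (↥(ProjMod e l) ≃ₗ[A] ↥(ProjMod e m))

/-- The associated category (objects `l : Λ`, morphisms from `l` to `m` being `e_m A e_l`)
is directed. -/
def IsDirectedCat (e : Λ → A) : Prop :=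
  ∃ r : PartialOrder Λ, ∀ l m : Λ, (∃ a : A, e m * a * e l ≠ 0) → r.le l m

end Idempotents

/-! ### Stratification -/

section Stratification

variable {A : Type v} [Ring A] {Λ : Type w}

/-- The subquotient `N₂ / N₁` of a module, for `N₁ ≤ N₂`. -/
abbrev SubQuot {M : Type*} [AddCommGroup M] [Module A M] (N₁ N₂ : Submodule A M) : Type _ :=
  ↥N₂ ⧸ N₁.submoduleOf N₂

/-- `[M : S] = n`: the module `M` has a composition series in which exactly `n` factors are
isomorphic to `S` (by Jordan–Hölder the number does not depend on the series). -/
def HasCompMult (A : Type v) [Ring A] (M : Type*) [AddCommGroup M] [Module A M]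
    (S : Type*) [AddCommGroup S] [Module A S] (n : ℕ) : Prop :=
  ∃ s : CompositionSeries (Submodule A M), s.head = ⊥ ∧ s.last = ⊤ ∧
    Nat.card {i : Fin s.length //
      Nonempty (SubQuot (s.toFun i.castSucc) (s.toFun i.succ) ≃ₗ[A] S)} = n

/-- The module `M` has a finite filtration `0 = F_0 ≤ F_1 ≤ ⋯ ≤ F_n = M` each of whose factors
is isomorphic to some `D m` with `m ∈ I`. -/
def HasFiltrationBy (M : Type*) [AddCommGroup M] [Module A M] (D : Λ → Type*)
    [∀ m, AddCommGroup (D m)] [∀ m, Module A (D m)] (I : Set Λ) : Prop :=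
  ∃ (n : ℕ) (F : Fin (n + 1) → Submodule A M), Monotone F ∧ F 0 = ⊥ ∧ F (Fin.last n) = ⊤ ∧
    ∀ i : Fin n, ∃ m ∈ I, Nonempty (SubQuot (F i.castSucc) (F i.succ) ≃ₗ[A] D m)

variable [Preorder Λ]

/-- `A` is standardly stratified for the given order on `Λ`: there are quotients
`Δ_l = P_l / K_l` such that `[Δ_l : S_m] = 0` unless `m ≤ l`, and such that `K_l` has a filtration
with factors `Δ_m`, `m > l`. -/
def IsStandardlyStratified (e : Λ → A) : Prop :=
  ∃ K : ∀ l : Λ, Submodule A ↥(ProjMod e l),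
    (∀ l m : Λ, ¬ m ≤ l → HasCompMult A (↥(ProjMod e l) ⧸ K l) (TopMod e m) 0) ∧
    ∀ l : Λ, HasFiltrationBy (A := A) ↥(K l) (fun m => ↥(ProjMod e m) ⧸ K m) {m | l < m}

/-- The kernel of `P_l → Δ_l`, where the standard module `Δ_l` is the largest quotient of `P_l`
all of whose composition factors `S_m` satisfy `m ≤ l`. -/
def standardKer (e : Λ → A) (l : Λ) : Submodule A ↥(ProjMod e l) :=
  sInf {K | ∀ m : Λ, ¬ m ≤ l → HasCompMult A (↥(ProjMod e l) ⧸ K) (TopMod e m) 0}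

/-- The standard module. -/
abbrev StandardMod (e : Λ → A) (l : Λ) : Type v := ↥(ProjMod e l) ⧸ standardKer e l

/-- The kernel of `P_l → Δ̄_l`, where the proper standard module `Δ̄_l` is the largest quotient of
`P_l` all of whose composition factors `S_m` satisfy `m < l`, except for one copy of `S_l`. -/
def properStandardKer (e : Λ → A) (l : Λ) : Submodule A ↥(ProjMod e l) :=
  sInf {K | HasCompMult A (↥(ProjMod e l) ⧸ K) (TopMod e l) 1 ∧
    ∀ m : Λ, m ≠ l → ¬ m < l → HasCompMult A (↥(ProjMod e l) ⧸ K) (TopMod e m) 0}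

/-- The proper standard module. -/
abbrev ProperStandardMod (e : Λ → A) (l : Λ) : Type v :=
  ↥(ProjMod e l) ⧸ properStandardKer e l

/-- `A` is properly stratified for the given order on `Λ`: the left module `A` lies in
`F(Δ) ∩ F(Δ̄)`. -/
def IsProperlyStratified (e : Λ → A) : Prop :=
  HasFiltrationBy (A := A) A (StandardMod e) Set.univ ∧
    HasFiltrationBy (A := A) A (ProperStandardMod e) Set.univ

end Stratification

/-! ### The graded algebra of a two-sided ideal -/

section Graded

variable {A : Type v} [Ring A] (I : Ideal A)

/-- The piece `I ^ i / I ^ (i + 1)`, with `I ^ 0 = A`. -/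
def GrPiece (i : ℕ) : Type v := ↥(I ^ i) ⧸ (I ^ (i + 1)).submoduleOf (I ^ i)

namespace GrPiece

instance (i : ℕ) : AddCommGroup (GrPiece I i) :=
  inferInstanceAs (AddCommGroup (↥(I ^ i) ⧸ (I ^ (i + 1)).submoduleOf (I ^ i)))

/-- The left `A`-module structure. -/
instance (i : ℕ) : Module A (GrPiece I i) :=
  inferInstanceAs (Module A (↥(I ^ i) ⧸ (I ^ (i + 1)).submoduleOf (I ^ i)))

/-- The vector space structure. -/
instance {k : Type u} [CommRing k] [Algebra k A] (i : ℕ) : Module k (GrPiece I i) :=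
  inferInstanceAs (Module k (↥(I ^ i) ⧸ (I ^ (i + 1)).submoduleOf (I ^ i)))

/-- The class in `I ^ i / I ^ (i + 1)` of an element of `I ^ i`. -/
def mk (i : ℕ) (x : A) (hx : x ∈ I ^ i) : GrPiece I i :=
  Submodule.Quotient.mk (p := (I ^ (i + 1)).submoduleOf (I ^ i)) ⟨x, hx⟩

variable {I}

theorem ind {i : ℕ} {p : GrPiece I i → Prop} (h : ∀ x hx, p (mk I i x hx)) (x : GrPiece I i) :
    p x := by
  induction x using Submodule.Quotient.induction_on with
  | _ z => exact h z.1 z.2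

theorem mk_eq_mk {i : ℕ} {x y : A} {hx : x ∈ I ^ i} {hy : y ∈ I ^ i} :
    mk I i x hx = mk I i y hy ↔ x - y ∈ I ^ (i + 1) := by
  unfold mk
  exact Submodule.Quotient.eq _

theorem mk_add {i : ℕ} {x y : A} (hx : x ∈ I ^ i) (hy : y ∈ I ^ i) :
    mk I i (x + y) (add_mem hx hy) = mk I i x hx + mk I i y hy := rfl

theorem mk_zero {i : ℕ} : mk I i 0 (zero_mem _) = 0 := rfl

theorem mk_smul {i : ℕ} {x : A} (a : A) (hx : x ∈ I ^ i) :
    a • mk I i x hx = mk I i (a * x) (Ideal.mul_mem_left _ a hx) := rfl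

theorem mk_smul' {k : Type u} [CommRing k] [Algebra k A] {i : ℕ} {x : A} (c : k)
    (hx : x ∈ I ^ i) :
    c • mk I i x hx = mk I i (c • x) (Submodule.smul_of_tower_mem _ c hx) := rfl

instance {k : Type u} [CommRing k] [Algebra k A] (i : ℕ) : IsScalarTower k A (GrPiece I i) where
  smul_assoc c a x := by
    induction x using ind with
    | _ x hx => simp only [mk_smul, mk_smul', smul_mul_assoc]

theorem mk_smul_subalgebra {k : Type u} [CommRing k] [Algebra k A] (S : Subalgebra k A) {i : ℕ}
    {x : A} (a : ↥S) (hx : x ∈ I ^ i) :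
    a • mk I i x hx = mk I i (a * x) (Ideal.mul_mem_left _ _ hx) := rfl

theorem sigma_ext {i j : ℕ} (h : i = j) {x y : A} (hx : x ∈ I ^ i) (hy : y ∈ I ^ j) (hxy : x = y) :
    (GradedMonoid.mk i (mk I i x hx) : GradedMonoid (GrPiece I)) =
      GradedMonoid.mk j (mk I j y hy) := by
  subst h hxy
  rfl

theorem mem_pow_zero (x : A) : x ∈ I ^ 0 := by
  rw [Submodule.pow_zero, Ideal.one_eq_top]
  exact Submodule.mem_top

variable [I.IsTwoSided]

theorem mul_mem {i j : ℕ} {x y : A} (hx : x ∈ I ^ i) (hy : y ∈ I ^ j) : x * y ∈ I ^ (i + j) :=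
  (Ideal.IsTwoSided.pow_add (I := I) i j).symm ▸ Ideal.mul_mem_mul hx hy

/-- The multiplication `I ^ i / I ^ (i + 1) × I ^ j / I ^ (j + 1) → I ^ (i + j) / I ^ (i + j + 1)`. -/
def mul {i j : ℕ} (x : GrPiece I i) (y : GrPiece I j) : GrPiece I (i + j) :=
  Quotient.liftOn₂ (s₁ := Submodule.quotientRel ((I ^ (i + 1)).submoduleOf (I ^ i)))
    (s₂ := Submodule.quotientRel ((I ^ (j + 1)).submoduleOf (I ^ j))) x y
    (fun a b => mk I (i + j) (a.1 * b.1) (mul_mem a.2 b.2)) (by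
      intro a b a' b' h h'
      have h1 : a.1 - a'.1 ∈ I ^ (i + 1) :=
        (Submodule.quotientRel_def ((I ^ (i + 1)).submoduleOf (I ^ i))).1 h
      have h2 : b.1 - b'.1 ∈ I ^ (j + 1) :=
        (Submodule.quotientRel_def ((I ^ (j + 1)).submoduleOf (I ^ j))).1 h'
      rw [mk_eq_mk]
      have e1 : a.1 * b.1 - a'.1 * b'.1 = (a.1 - a'.1) * b.1 + a'.1 * (b.1 - b'.1) := by
        noncomm_ring
      rw [e1]
      refine add_mem ?_ ?_
      · have := mul_mem h1 b.2
        rwa [add_right_comm] at this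
      · exact (add_assoc i j 1).symm ▸ mul_mem a'.2 h2)

theorem mul_mk {i j : ℕ} {x y : A} (hx : x ∈ I ^ i) (hy : y ∈ I ^ j) :
    mul (mk I i x hx) (mk I j y hy) = mk I (i + j) (x * y) (mul_mem hx hy) := rfl

/-- The right `A`-module structure, `x · a`. -/
instance (i : ℕ) : Module Aᵐᵒᵖ (GrPiece I i) where
  smul a x := Quotient.liftOn (s := Submodule.quotientRel ((I ^ (i + 1)).submoduleOf (I ^ i))) x
    (fun z => mk I i (z.1 * a.unop) (Ideal.mul_mem_right _ _ z.2)) (by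
      intro z z' h
      have h1 : z.1 - z'.1 ∈ I ^ (i + 1) :=
        (Submodule.quotientRel_def ((I ^ (i + 1)).submoduleOf (I ^ i))).1 h
      rw [mk_eq_mk, ← sub_mul]
      exact Ideal.mul_mem_right _ _ h1)
  one_smul x := by
    induction x using ind with
    | _ x hx => exact mk_eq_mk.2 (by simp)
  mul_smul a b x := by
    induction x using ind with
    | _ x hx => exact mk_eq_mk.2 (by simp [mul_assoc])
  smul_zero a := mk_eq_mk.2 (by simp)
  smul_add a x y := by
    induction x using ind with
    | _ x hx =>
      induction y using ind with
      | _ y hy => exact mk_eq_mk.2 (by simp [add_mul])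
  add_smul a b x := by
    induction x using ind with
    | _ x hx => exact mk_eq_mk.2 (by simp [mul_add])
  zero_smul x := by
    induction x using ind with
    | _ x hx => exact mk_eq_mk.2 (by simp)

theorem mk_op_smul {i : ℕ} {x : A} (a : Aᵐᵒᵖ) (hx : x ∈ I ^ i) :
    a • mk I i x hx = mk I i (x * a.unop) (Ideal.mul_mem_right _ _ hx) := rfl

instance : GradedMonoid.GMul (GrPiece I) where
  mul := mul

instance : GradedMonoid.GOne (GrPiece I) where
  one := mk I 0 1 (mem_pow_zero _)

instance : GradedMonoid.GMonoid (GrPiece I) where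
  one_mul a := by
    obtain ⟨i, a⟩ := a
    induction a using ind with
    | _ x hx => exact sigma_ext (by simp) _ _ (by simp)
  mul_one a := by
    obtain ⟨i, a⟩ := a
    induction a using ind with
    | _ x hx => exact sigma_ext (by simp) _ _ (by simp)
  mul_assoc a b c := by
    obtain ⟨i, a⟩ := a
    obtain ⟨j, b⟩ := b
    obtain ⟨l, c⟩ := c
    induction a using ind with
    | _ x hx =>
      induction b using ind with
      | _ y hy =>
        induction c using ind with
        | _ z hz => exact sigma_ext (add_assoc _ _ _) _ _ (by simp [_root_.mul_assoc])

instance : DirectSum.GRing (GrPiece I) where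
  mul_zero {i j} a := by
    induction a using ind with
    | _ x hx => exact mk_eq_mk.2 (by simp)
  zero_mul {i j} b := by
    induction b using ind with
    | _ x hx => exact mk_eq_mk.2 (by simp)
  mul_add {i j} a b c := by
    induction a using ind with
    | _ x hx =>
      induction b using ind with
      | _ y hy =>
        induction c using ind with
        | _ z hz => exact mk_eq_mk.2 (by simp [_root_.mul_add])
  add_mul {i j} a b c := by
    induction a using ind with
    | _ x hx =>
      induction b using ind with
      | _ y hy =>
        induction c using ind with
        | _ z hz => exact mk_eq_mk.2 (by simp [_root_.add_mul])
  natCast n := mk I 0 (n : A) (mem_pow_zero _)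
  natCast_zero := mk_eq_mk.2 (by simp)
  natCast_succ n := mk_eq_mk.2 (by simp)
  intCast n := mk I 0 (n : A) (mem_pow_zero _)
  intCast_ofNat n := mk_eq_mk.2 (by simp)
  intCast_negSucc_ofNat n := mk_eq_mk.2 (by simp)

instance {k : Type u} [CommRing k] [Algebra k A] : DirectSum.GAlgebra k (GrPiece I) where
  toFun :=
    { toFun := fun c => mk I 0 (algebraMap k A c) (mem_pow_zero _)
      map_zero' := mk_eq_mk.2 (by simp)
      map_add' := fun c d => mk_eq_mk.2 (by simp) }
  map_one := mk_eq_mk.2 (by simp)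
  map_mul c d := sigma_ext (by simp) _ _ (by simp)
  commutes c x := by
    obtain ⟨i, x⟩ := x
    induction x using ind with
    | _ x hx => exact sigma_ext ((Nat.zero_add i).trans (Nat.add_zero i).symm) _ _ (Algebra.commutes c x)
  smul_def c x := by
    obtain ⟨i, x⟩ := x
    induction x using ind with
    | _ x hx => exact sigma_ext (Nat.zero_add i).symm _ _ (Algebra.smul_def c x)

instance (i : ℕ) : SMulCommClass A Aᵐᵒᵖ (GrPiece I i) where
  smul_comm a b x := by
    induction x using ind with
    | _ x hx => simp only [mk_smul, mk_op_smul, _root_.mul_assoc]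

/-- The right module structure over a subalgebra, by restriction. -/
instance {k : Type u} [CommRing k] [Algebra k A] (S : Subalgebra k A) (i : ℕ) :
    Module (↥S)ᵐᵒᵖ (GrPiece I i) :=
  Module.compHom _ S.val.toRingHom.op

theorem mk_op_smul_subalgebra {k : Type u} [CommRing k] [Algebra k A] (S : Subalgebra k A) {i : ℕ}
    {x : A} (a : (↥S)ᵐᵒᵖ) (hx : x ∈ I ^ i) :
    a • mk I i x hx = mk I i (x * a.unop) (Ideal.mul_mem_right _ _ hx) := rfl

instance {k : Type u} [CommRing k] [Algebra k A] (S : Subalgebra k A) (i : ℕ) :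
    SMulCommClass ↥S (↥S)ᵐᵒᵖ (GrPiece I i) where
  smul_comm a b x := by
    induction x using ind with
    | _ x hx => simp only [mk_smul_subalgebra, mk_op_smul_subalgebra, _root_.mul_assoc]

instance {k : Type u} [CommRing k] [Algebra k A] (S : Subalgebra k A) (i : ℕ) :
    IsScalarTower k (↥S)ᵐᵒᵖ (GrPiece I i) where
  smul_assoc c a x := by
    induction x using ind with
    | _ x hx => simp [mk_smul', mk_op_smul_subalgebra]

end GrPiece

variable [I.IsTwoSided]

/-- The associated graded algebra `⨁ I ^ i / I ^ (i + 1)`. -/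
abbrev AssocGr : Type v := ⨁ i, GrPiece I i

/-- The algebra homomorphism `A → A / I ⊆ ⨁ I ^ i / I ^ (i + 1)`. -/
def AssocGr.ofAlg (k : Type u) [CommRing k] [Algebra k A] : A →ₐ[k] AssocGr I where
  toFun a := DirectSum.of (GrPiece I) 0 (GrPiece.mk I 0 a (GrPiece.mem_pow_zero a))
  map_one' := rfl
  map_zero' := by
    rw [← map_zero (DirectSum.of (GrPiece I) 0)]
    rfl
  map_add' a b := by
    rw [← map_add]
    rfl
  map_mul' a b := by
    rw [DirectSum.of_mul_of]
    rfl
  commutes' c := rfl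

end Graded

/-! ### The tensor algebra of a bimodule -/

section BimoduleTensorAlgebra

variable (k : Type u) [CommRing k] (S : Type*) [Ring S] [Algebra k S]
  (X : Type*) [AddCommGroup X] [Module k X] [Module S X] [Module Sᵐᵒᵖ X]

/-- The relations, on top of `k`-linearity, that make `a ↦ (a, 0)` a ring homomorphism on `S` and
`x ↦ (0, x)` a homomorphism of `S`-bimodules on `X`. -/
inductive BimoduleTensorAlgebra.Rel :
    TensorAlgebra k (S × X) → TensorAlgebra k (S × X) → Prop
  | one : Rel (TensorAlgebra.ι k ((1 : S), (0 : X))) 1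
  | mul (a b : S) : Rel (TensorAlgebra.ι k (a * b, (0 : X)))
      (TensorAlgebra.ι k (a, (0 : X)) * TensorAlgebra.ι k (b, (0 : X)))
  | left (a : S) (x : X) : Rel (TensorAlgebra.ι k ((0 : S), a • x))
      (TensorAlgebra.ι k (a, (0 : X)) * TensorAlgebra.ι k ((0 : S), x))
  | right (a : S) (x : X) : Rel (TensorAlgebra.ι k ((0 : S), MulOpposite.op a • x))
      (TensorAlgebra.ι k ((0 : S), x) * TensorAlgebra.ι k (a, (0 : X)))

/-- The tensor algebra `S[X] = S ⊕ X ⊕ (X ⊗_S X) ⊕ ⋯` of an `S`-bimodule `X` over the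
(noncommutative) `k`-algebra `S`: the `k`-algebra generated by `S` and `X` subject only to the
relations of `S` and the bimodule structure of `X`. -/
def BimoduleTensorAlgebra [IsScalarTower k S X] [IsScalarTower k Sᵐᵒᵖ X]
    [SMulCommClass S Sᵐᵒᵖ X] : Type _ :=
  RingQuot (BimoduleTensorAlgebra.Rel k S X)

namespace BimoduleTensorAlgebra

variable [IsScalarTower k S X] [IsScalarTower k Sᵐᵒᵖ X] [SMulCommClass S Sᵐᵒᵖ X]

instance : Ring (BimoduleTensorAlgebra k S X) :=
  inferInstanceAs (Ring (RingQuot (BimoduleTensorAlgebra.Rel k S X)))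

instance : Algebra k (BimoduleTensorAlgebra k S X) :=
  inferInstanceAs (Algebra k (RingQuot (BimoduleTensorAlgebra.Rel k S X)))

/-- The structure map `S → S[X]`. -/
def ofScalar (a : S) : BimoduleTensorAlgebra k S X :=
  RingQuot.mkAlgHom k (BimoduleTensorAlgebra.Rel k S X) (TensorAlgebra.ι k (a, (0 : X)))

/-- The structure map `X → S[X]`. -/
def ofVector (x : X) : BimoduleTensorAlgebra k S X :=
  RingQuot.mkAlgHom k (BimoduleTensorAlgebra.Rel k S X) (TensorAlgebra.ι k ((0 : S), x))

end BimoduleTensorAlgebra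

end BimoduleTensorAlgebra

/-! ### The graded algebra attached to a family of idempotents -/

section Main

variable (k : Type u) [CommRing k] {A : Type v} [Ring A] [Algebra k A] {Λ : Type w}

/-- The two-sided ideal `J` generated by the spaces `e_m A e_l` with `l ≠ m`. If the associated
category is directed, it is their sum (see `mem_offDiagIdeal_iff`). -/
def offDiagIdeal (e : Λ → A) : Ideal A :=
  (TwoSidedIdeal.span {x | ∃ l m : Λ, l ≠ m ∧ ∃ a : A, x = e m * a * e l}).asIdeal

instance (e : Λ → A) : (offDiagIdeal e).IsTwoSided :=
  inferInstanceAs (TwoSidedIdeal.asIdeal _).IsTwoSided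

/-- The subalgebra `A_0 = ⨁ e_l A e_l`, i.e. the elements commuting with all `e_l`
(see `mem_diagSubalgebra_iff`). -/
def diagSubalgebra (e : Λ → A) : Subalgebra k A := Subalgebra.centralizer k (Set.range e)

theorem mem_diagSubalgebra_iff [Fintype Λ] {e : Λ → A} (he : CompleteOrthogonalIdempotents e)
    (a : A) : a ∈ diagSubalgebra k e ↔ a = ∑ l, e l * a * e l := by
  classical
  simp only [diagSubalgebra, Subalgebra.mem_centralizer_iff, Set.forall_mem_range]
  constructor
  · intro h
    have h1 : ∀ l, e l * a * e l = e l * a := fun l => by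
      rw [mul_assoc, ← h l, ← mul_assoc, (he.idem l).eq]
    simp only [h1]
    rw [← Finset.sum_mul, he.complete, one_mul]
  · intro h l
    rw [h, Finset.mul_sum, Finset.sum_mul]
    refine Finset.sum_congr rfl fun m _ => ?_
    by_cases hlm : l = m
    · subst hlm
      simp only [← mul_assoc, (he.idem l).eq]
      rw [mul_assoc _ (e l) (e l), (he.idem l).eq]
    · rw [← mul_assoc, ← mul_assoc, he.ortho hlm, mul_assoc _ (e m) (e l), he.ortho (Ne.symm hlm)]
      simp

theorem mem_offDiagIdeal_iff [Fintype Λ] {e : Λ → A} (he : CompleteOrthogonalIdempotents e)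
    (hd : IsDirectedCat e) (a : A) :
    a ∈ offDiagIdeal e ↔
      a ∈ AddSubgroup.closure {x | ∃ l m : Λ, l ≠ m ∧ ∃ b : A, x = e m * b * e l} := by
  classical
  set s : Set A := {x | ∃ l m : Λ, l ≠ m ∧ ∃ b : A, x = e m * b * e l} with hs
  obtain ⟨r, hr⟩ := hd
  have hz : ∀ l m : Λ, l ≠ m → ∀ b c : A, e m * b * e l * c * e m = 0 := by
    intro l m hlm b c
    by_contra h
    have h1 : e m * b * e l ≠ 0 := fun h0 => h (by simp [h0])
    have h2 : e l * c * e m ≠ 0 := fun h0 => h (by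
      have : e m * b * e l * c * e m = e m * b * (e l * c * e m) := by simp only [mul_assoc]
      rw [this, h0, mul_zero])
    exact hlm (r.le_antisymm _ _ (hr l m ⟨b, h1⟩) (hr m l ⟨c, h2⟩))
  have hright : ∀ x ∈ AddSubgroup.closure s, ∀ c : A, x * c ∈ AddSubgroup.closure s := by
    intro x hx c
    induction hx using AddSubgroup.closure_induction with
    | mem x hx =>
      obtain ⟨l, m, hlm, b, rfl⟩ := hx
      have : e m * b * e l * c = ∑ p, e m * b * e l * c * e p := by
        rw [← Finset.mul_sum, he.complete, mul_one]
      rw [this]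
      refine sum_mem fun p _ => ?_
      by_cases hp : p = m
      · rw [hp, hz l m hlm]
        exact zero_mem _
      · exact AddSubgroup.subset_closure ⟨p, m, hp, b * e l * c, by simp only [mul_assoc]⟩
    | zero => simp
    | add x y _ _ h1 h2 => rw [add_mul]; exact add_mem h1 h2
    | neg x _ h1 => rw [neg_mul]; exact neg_mem h1
  have hleft : ∀ x ∈ AddSubgroup.closure s, ∀ c : A, c * x ∈ AddSubgroup.closure s := by
    intro x hx c
    induction hx using AddSubgroup.closure_induction with
    | mem x hx =>
      obtain ⟨l, m, hlm, b, rfl⟩ := hx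
      have : c * (e m * b * e l) = ∑ p, e p * (c * (e m * b * e l)) := by
        rw [← Finset.sum_mul, he.complete, one_mul]
      rw [this]
      refine sum_mem fun p _ => ?_
      by_cases hp : l = p
      · have h0 := hz m l (Ne.symm hlm) c b
        simp only [mul_assoc] at h0
        rw [← hp]
        simp only [mul_assoc]
        rw [h0]
        exact zero_mem _
      · exact AddSubgroup.subset_closure ⟨l, p, hp, c * e m * b, by simp only [mul_assoc]⟩
    | zero => simp
    | add x y _ _ h1 h2 => rw [mul_add]; exact add_mem h1 h2
    | neg x _ h1 => rw [mul_neg]; exact neg_mem h1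
  let T : TwoSidedIdeal A := TwoSidedIdeal.mk' (AddSubgroup.closure s : Set A) (zero_mem _)
    (fun h1 h2 => add_mem h1 h2) (fun h => neg_mem h) (fun h => hleft _ h _) (fun h => hright _ h _)
  have hT : ∀ x, x ∈ T ↔ x ∈ AddSubgroup.closure s := fun x => by simp [T]
  unfold offDiagIdeal
  rw [TwoSidedIdeal.mem_asIdeal]
  constructor
  · intro h
    exact (hT a).1 (TwoSidedIdeal.span_le.2
      (fun x hx => (hT x).2 (AddSubgroup.subset_closure hx)) h)
  · intro h
    induction h using AddSubgroup.closure_induction with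
    | mem x hx => exact TwoSidedIdeal.subset_span hx
    | zero => exact zero_mem _
    | add x y _ _ h1 h2 => exact add_mem h1 h2
    | neg x _ h1 => exact neg_mem h1

/-- The idempotents of the graded algebra of `J` given by the `e_l`. -/
def grIdem (e : Λ → A) (l : Λ) : AssocGr (offDiagIdeal e) :=
  AssocGr.ofAlg (offDiagIdeal e) k (e l)

/-- The graded algebra `⨁ J ^ i / J ^ (i + 1)` is the tensor algebra `A_0[J / J ^ 2]`: there is
an isomorphism of `k`-algebras from `A_0[J / J ^ 2]` that extends `A_0 → A / J` and the inclusion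
of `J / J ^ 2`. -/
def GrIsTensorAlgebra (e : Λ → A) : Prop :=
  ∃ φ : BimoduleTensorAlgebra k ↥(diagSubalgebra k e) (GrPiece (offDiagIdeal e) 1) ≃ₐ[k]
      AssocGr (offDiagIdeal e),
    (∀ a : ↥(diagSubalgebra k e), φ (BimoduleTensorAlgebra.ofScalar k _ _ a) =
      AssocGr.ofAlg (offDiagIdeal e) k (a : A)) ∧
    ∀ x : GrPiece (offDiagIdeal e) 1, φ (BimoduleTensorAlgebra.ofVector k _ _ x) =
      DirectSum.of (GrPiece (offDiagIdeal e)) 1 x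

end Main

/-! Write J for the off-diagonal ideal, P_l = A e_l, and call l → m an arrow if e_m A e_l ≠ 0. Each
of the two equivalences passes through a condition on bases that can be tested equally well in A and
in gr A.

Standard case. The pivot is projectivity of J as a left module. Given l, order Λ so that l is least
and the other vertices run against the arrows. Then Δ_m = P_m for m ≠ l, so the trace of these P_m
in A is a direct sum of modules P_m, and J e_l is a direct summand of that trace
(`projective_of_forall_hasFiltrationBy`). Conversely, let J e_l = ⨁ A g_q with A g_q ≅ P_(t q). For
an upper set U not containing l, the trace of U in P_l lies in J e_l and is the direct sum of the
traces in the P_(t q). Induction along the arrows then filters all traces by standard modules, for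
any order (`hasFiltrationBy_idemTrace`).

As J is nilpotent, it is projective exactly if it has generators a_q, with e_(t q) a_q = a_q, that
are independent in every degree: a sum ∑ x_q a_q in J^(i+2) with x_q in J^i forces x_q e_(t q) into
J^(i+1) (`HasGradedBasis`). Only leading terms matter here, and the powers of the off-diagonal ideal
of gr A are its degree filtration, so the condition is the same for A and gr A. It also says that gr
A is the tensor algebra of J / J^2 and that J / J^2 is projective over A_0: independence lets one
peel off the last factor of a tensor, and conversely partial derivatives of the tensor algebra
recover independence.

Proper case. The additional condition is a basis of J / J^2 as a right module (`HasRightBasis`). For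
z ≠ m use an order z < m < all others. Lifts of a basis of e_z Δ̄_m generate e_z (J / J^2) e_m over
e_m A e_m, and counting the factors Δ̄_m in A shows that they generate it freely
(`exists_corner_basis`). Conversely, since gr A is a tensor algebra, the right basis of J / J^2
makes J projective on the right too (`hasGradedBasis_op`). Hence Δ_l is free as a right module over
the local ring e_l A e_l, and a composition series of that ring induces a filtration of Δ_l by
copies of Δ̄_l (`hasFiltrationBy_quot`).

Primitivity is replaced by `SplitDirected`, because that property visibly passes to gr A, to the
opposite algebra and to A_0, and the arguments are applied to all of these. -/

set_option linter.unusedSectionVars false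

/-! ### Split directed families of idempotents -/

/-- A complete family of orthogonal nonzero idempotents with directed category, each of whose
corner rings is the sum of the scalars and of nilpotent elements. -/
structure SplitDirected (k : Type u) [Field k] {B : Type v} [Ring B] [Algebra k B]
    {Λ : Type w} [Fintype Λ] (e : Λ → B) : Prop where
  orth : CompleteOrthogonalIdempotents e
  ne_zero : ∀ l, e l ≠ 0
  split : ∀ l b, ∃ c : k, IsNilpotent (e l * b * e l - c • e l)
  dir : IsDirectedCat e

theorem mem_ringJacobson_of_forall_isNilpotent {B : Type v} [Ring B] {x : B}
    (h : ∀ b, IsNilpotent (b * x)) : x ∈ Ring.jacobson B := by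
  rw [← Ideal.jacobson_bot, Ideal.mem_jacobson_iff]
  intro y
  obtain ⟨z, hz⟩ := (h y).isUnit_one_add.exists_left_inv
  refine ⟨z, ?_⟩
  rw [Ideal.mem_bot, mul_assoc, sub_eq_zero, ← hz]
  noncomm_ring

namespace SplitDirected

variable {k : Type u} [Field k] {B : Type v} [Ring B] [Algebra k B]
  {Λ : Type w} [Fintype Λ] {e : Λ → B}

section
variable (he : SplitDirected k e)
include he

theorem idem (l : Λ) : e l * e l = e l := (he.orth.idem l).eq

theorem idem_assoc (l : Λ) (x : B) : e l * (e l * x) = e l * x := by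
  rw [← mul_assoc, he.idem]

theorem mul_idem_assoc (l : Λ) (x : B) : x * e l * e l = x * e l := by
  rw [mul_assoc, he.idem]

theorem mul_of_ne {l m : Λ} (h : l ≠ m) : e l * e m = 0 := he.orth.ortho h

theorem sum_mul (x : B) : ∑ l, e l * x = x := by
  rw [← Finset.sum_mul, he.orth.complete, one_mul]

theorem mul_sum (x : B) : ∑ l, x * e l = x := by
  rw [← Finset.mul_sum, he.orth.complete, mul_one]

/-- Nonzero factors would give both l ≤ m and m ≤ l. Besides height functions, this is the main form
in which directedness is used. -/
theorem loop_eq_zero {l m : Λ} (hlm : l ≠ m) (b c : B) : e m * b * e l * c * e m = 0 := by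
  obtain ⟨r, hr⟩ := he.dir
  by_contra h
  have h1 : e m * b * e l ≠ 0 := fun h0 => h (by simp [h0])
  have h2 : e l * c * e m ≠ 0 := fun h0 => h (by
    have : e m * b * e l * c * e m = e m * b * (e l * c * e m) := by simp only [mul_assoc]
    rw [this, h0, mul_zero])
  exact hlm (r.le_antisymm _ _ (hr l m ⟨b, h1⟩) (hr m l ⟨c, h2⟩))

theorem loop_mul_eq_zero {l m : Λ} (hlm : l ≠ m) (b c d : B) :
    e m * b * e l * c * e m * d = 0 := by
  rw [he.loop_eq_zero hlm, zero_mul]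

/-- A nilpotent element of a corner ring lies in the radical. -/
theorem mem_jacobson_of_isNilpotent {l : Λ} {y : B} (hy : e l * y * e l = y)
    (hn : IsNilpotent y) : y ∈ Ring.jacobson B := by
  have hl : e l * y = y := by rw [← hy]; simp only [mul_assoc, he.idem_assoc]
  have hr : y * e l = y := by rw [← hy, he.mul_idem_assoc]
  refine mem_ringJacobson_of_forall_isNilpotent fun b => ?_
  obtain ⟨c, hc⟩ := he.split l (b * y)
  have hw : e l * (b * y) * e l = e l * b * y := by simp only [mul_assoc, hr]
  rw [hw] at hc
  -- Since y = y e_l, the powers of b y are governed by the corner element e_l b y, to which the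
  -- splitting applies.
  have hpow : ∀ n : ℕ, (b * y) ^ (n + 1) = b * y * (e l * b * y) ^ n := by
    intro n
    induction n with
    | zero => simp
    | succ n ih =>
      rw [pow_succ, ih, pow_succ]
      suffices H : ∀ n : ℕ, y * (e l * b * y) ^ n * (b * y) = y * (e l * b * y) ^ n * (e l * b * y) by
        have := congrArg (b * ·) (H n)
        simpa only [mul_assoc] using this
      intro n
      cases n with
      | zero =>
        have : y * b * y = y * e l * b * y := by rw [hr]
        simpa [mul_assoc] using this
      | succ n =>
        have : y * b * y = y * e l * b * y := by rw [hr]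
        have h2 : y * (e l * b * y) ^ n * (e l * b) * (y * b * y) =
          y * (e l * b * y) ^ n * (e l * b) * (y * e l * b * y) := by rw [this]
        simpa only [pow_succ, mul_assoc] using h2
  by_cases hc0 : c = 0
  · rw [hc0, zero_smul, sub_zero] at hc
    obtain ⟨n, hn'⟩ := hc
    exact ⟨n + 1, by rw [hpow, hn', mul_zero]⟩
  -- If c ≠ 0, there is v with v y = e_l. Telescoping gives v^n y^n e_l = e_l for all n, contrary to
  -- the nilpotency of y.
  · exfalso
    set w := e l * b * y with hwdef
    have hnil : IsNilpotent (c⁻¹ • (w - c • e l)) := hc.smul _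
    obtain ⟨z, hz⟩ := hnil.isUnit_one_add.exists_left_inv
    have hwl : w * e l = w := by rw [hwdef, mul_assoc _ y, hr]
    have h1 : z * (c⁻¹ • w) = e l := by
      have h0 : (1 + c⁻¹ • (w - c • e l)) * e l = c⁻¹ • w := by
        rw [add_mul, one_mul, smul_mul_assoc, sub_mul, hwl, smul_mul_assoc, he.idem, smul_sub,
          smul_smul, inv_mul_cancel₀ hc0, one_smul]
        abel
      rw [← h0, ← mul_assoc, hz, one_mul]
    set v := e l * (c⁻¹ • z) * e l * b * e l with hv
    have hvy : v * y = e l := by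
      have : v * y = e l * (z * (c⁻¹ • w)) := by
        rw [hv, hwdef]
        simp only [mul_assoc, hl, mul_smul_comm, smul_mul_assoc]
      rw [this, h1, he.idem]
    have hvp : ∀ n : ℕ, v ^ n * y ^ n * e l = e l := by
      intro n
      induction n with
      | zero => simp
      | succ n ih =>
        have : v ^ (n + 1) * y ^ (n + 1) * e l = v ^ n * (v * y) * (y ^ n * e l) := by
          rw [pow_succ, pow_succ']; simp only [mul_assoc]
        rw [this, hvy]
        cases n with
        | zero => simp [he.idem]
        | succ n =>
          have : v ^ (n + 1) * e l * (y ^ (n + 1) * e l) = v ^ (n + 1) * y ^ (n + 1) * e l := by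
            rw [pow_succ' y]
            have : e l * (y * y ^ n * e l) = y * y ^ n * e l := by
              rw [mul_assoc, ← mul_assoc (e l), hl]
            rw [mul_assoc, this]
            simp only [mul_assoc]
          rw [this, ih]
    obtain ⟨n, hn⟩ := hn
    exact he.ne_zero l (by rw [← hvp n, hn, mul_zero, zero_mul])

theorem exists_scalar_sub_mem_jacobson (l : Λ) (b : B) :
    ∃ c : k, e l * b * e l - c • e l ∈ Ring.jacobson B := by
  obtain ⟨c, hc⟩ := he.split l b
  refine ⟨c, he.mem_jacobson_of_isNilpotent (l := l) ?_ hc⟩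
  simp only [mul_sub, sub_mul, mul_smul_comm, smul_mul_assoc, mul_assoc, he.idem, he.idem_assoc]

omit [Field k] [Algebra k B] [Fintype Λ] he in
theorem mem_offDiagIdeal {l m : Λ} (h : l ≠ m) (b : B) : e m * b * e l ∈ offDiagIdeal e :=
  TwoSidedIdeal.mem_asIdeal.2 (TwoSidedIdeal.subset_span ⟨l, m, h, b, rfl⟩)

omit [Field k] [Algebra k B] [Fintype Λ] he in
theorem offDiagIdeal_le_of_forall {I : Ideal B} [I.IsTwoSided]
    (h : ∀ l m : Λ, l ≠ m → ∀ b, e m * b * e l ∈ I) : offDiagIdeal e ≤ I := by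
  intro x hx
  have hle : TwoSidedIdeal.span {x | ∃ l m : Λ, l ≠ m ∧ ∃ a : B, x = e m * a * e l} ≤
      I.toTwoSided := by
    rw [TwoSidedIdeal.span_le]
    rintro _ ⟨l, m, hlm, a, rfl⟩
    exact Ideal.mem_toTwoSided.2 (h l m hlm a)
  exact Ideal.mem_toTwoSided.1 (hle (TwoSidedIdeal.mem_asIdeal.1 hx))

/-- The square of c e_m b e_l contains the loop e_m b e_l c e_m, so it vanishes. -/
theorem offDiagIdeal_le_jacobson : offDiagIdeal e ≤ Ring.jacobson B := by
  refine offDiagIdeal_le_of_forall fun l m h b => ?_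
  refine mem_ringJacobson_of_forall_isNilpotent fun c => ⟨2, ?_⟩
  have := congrArg (c * ·) (he.loop_mul_eq_zero h b c (b * e l))
  simpa only [pow_two, mul_assoc, mul_zero] using this

/-- Diagonal entries of elements of `J` vanish. -/
theorem diag_eq_zero_of_mem {x : B} (hx : x ∈ offDiagIdeal e) (l : Λ) : e l * x * e l = 0 := by
  rw [mem_offDiagIdeal_iff he.orth he.dir] at hx
  induction hx using AddSubgroup.closure_induction with
  | mem x hx =>
    obtain ⟨p, q, hpq, b, rfl⟩ := hx
    by_cases h : l = p
    · subst h
      rw [← mul_assoc, ← mul_assoc, he.mul_of_ne hpq]; simp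
    · rw [mul_assoc, mul_assoc _ _ (e l), he.mul_of_ne (Ne.symm h)]; simp
  | zero => simp
  | add x y _ _ h1 h2 => rw [mul_add, add_mul, h1, h2, add_zero]
  | neg x _ h1 => rw [mul_neg, neg_mul, h1, neg_zero]

/-- An element is a sum of its diagonal part and an element of `J`. -/
theorem sub_diag_mem (x : B) : x - ∑ l, e l * x * e l ∈ offDiagIdeal e := by
  classical
  have h : x = ∑ l, ∑ m, e m * x * e l := by
    simp only [← Finset.sum_mul, he.orth.complete, one_mul, he.mul_sum]
  have h2 : x - ∑ l, e l * x * e l = ∑ l, ((∑ m, e m * x * e l) - e l * x * e l) := by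
    rw [Finset.sum_sub_distrib, ← h]
  rw [h2]
  refine sum_mem fun l _ => ?_
  rw [← Finset.add_sum_erase _ _ (Finset.mem_univ l), add_sub_cancel_left]
  exact sum_mem fun m hm => mem_offDiagIdeal (Finset.ne_of_mem_erase hm).symm x

/-- Membership in J becomes finitely many equations, and in this form it is symmetric under passing
to the opposite algebra. -/
theorem mem_offDiagIdeal_iff_diag {x : B} :
    x ∈ offDiagIdeal e ↔ ∀ l, e l * x * e l = 0 := by
  refine ⟨he.diag_eq_zero_of_mem, fun h => ?_⟩
  have := he.sub_diag_mem x
  simpa [h] using this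

theorem idem_notMem_jacobson [Module.Finite k B] (l : Λ) : e l ∉ Ring.jacobson B := by
  have : IsArtinianRing B := IsArtinianRing.of_finite k B
  intro h
  obtain ⟨n, hn⟩ := IsSemiprimaryRing.isNilpotent (R := B)
  have : e l ∈ Ring.jacobson B ^ (n + 1) := by
    rw [← (he.orth.idem l).pow_succ_eq n]
    exact Ideal.pow_mem_pow h _
  rw [Submodule.pow_succ, hn] at this
  exact he.ne_zero l (by simpa using this)

omit he in
theorem isNilpotent_jacobson (k : Type u) [Field k] [Algebra k B] [Module.Finite k B] :
    IsNilpotent (Ring.jacobson B) := by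
  have : IsArtinianRing B := IsArtinianRing.of_finite k B
  exact IsSemiprimaryRing.isNilpotent (R := B)

theorem isNilpotent_offDiagIdeal [Module.Finite k B] : ∃ n, offDiagIdeal e ^ n = ⊥ := by
  obtain ⟨n, hn⟩ := isNilpotent_jacobson (B := B) k
  refine ⟨n, le_bot_iff.1 ?_⟩
  calc offDiagIdeal e ^ n ≤ Ring.jacobson B ^ n := Ideal.pow_right_mono he.offDiagIdeal_le_jacobson n
    _ = ⊥ := hn

/-- An element of a corner ring outside the radical is invertible in the corner ring. -/
theorem exists_corner_inv [Module.Finite k B] {l : Λ} {y : B} (hy : e l * y * e l = y)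
    (hn : y ∉ Ring.jacobson B) : ∃ u, u * y = e l ∧ e l * u * e l = u := by
  obtain ⟨c, hc⟩ := he.exists_scalar_sub_mem_jacobson l y
  rw [hy] at hc
  have hc0 : c ≠ 0 := by
    rintro rfl
    exact hn (by simpa using hc)
  have hnil : IsNilpotent (c⁻¹ • (y - c • e l)) := by
    obtain ⟨n, hn⟩ := isNilpotent_jacobson (B := B) k
    refine IsNilpotent.smul ⟨n, ?_⟩ _
    have := Ideal.pow_mem_pow hc n
    rw [hn] at this
    simpa using this
  have hl : e l * y = y := by rw [← hy]; simp only [mul_assoc, he.idem_assoc]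
  have hr : y * e l = y := by rw [← hy, he.mul_idem_assoc]
  obtain ⟨z, hz⟩ := hnil.isUnit_one_add.exists_left_inv
  have h0 : (1 + c⁻¹ • (y - c • e l)) * e l = c⁻¹ • y := by
    rw [add_mul, one_mul, smul_mul_assoc, sub_mul, hr, smul_mul_assoc, he.idem, smul_sub,
      smul_smul, inv_mul_cancel₀ hc0, one_smul]
    abel
  refine ⟨e l * (c⁻¹ • z) * e l, ?_, ?_⟩
  · rw [mul_assoc, hl, mul_assoc, smul_mul_assoc, ← mul_smul_comm, ← h0, ← mul_assoc z, hz, one_mul,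
      he.idem]
  · simp only [mul_assoc, he.idem, he.idem_assoc]

theorem mem_projMod_iff {l : Λ} {x : B} : x ∈ ProjMod e l ↔ x * e l = x := by
  rw [Submodule.mem_span_singleton]
  constructor
  · rintro ⟨a, rfl⟩
    rw [smul_eq_mul, he.mul_idem_assoc]
  · intro h
    exact ⟨x, h⟩

/-- The part of x outside the corner lies in J, hence in the radical. So P_l modulo the radical is
spanned by the class of e_l. -/
theorem exists_scalar_sub_mem_of_mem_projMod {l : Λ} {x : B} (hx : x * e l = x) :
    ∃ c : k, x - c • e l ∈ Ring.jacobson B := by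
  obtain ⟨c, hc⟩ := he.exists_scalar_sub_mem_jacobson l x
  refine ⟨c, ?_⟩
  have h1 : x - e l * x * e l ∈ offDiagIdeal e := by
    rw [he.mem_offDiagIdeal_iff_diag]
    intro m
    by_cases hm : m = l
    · subst hm
      simp only [mul_sub, mul_assoc, he.idem_assoc, hx, sub_self, zero_mul]
    · rw [← hx]
      simp only [mul_sub, sub_mul, mul_assoc, he.idem, he.mul_of_ne (Ne.symm hm), mul_zero, sub_self]
  have := add_mem (he.offDiagIdeal_le_jacobson h1) hc
  simpa using this

end

end SplitDirected

/-! ### Dimensions of the spaces `e M` and composition multiplicities -/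

section Weight

variable (k : Type u) [Field k] {B : Type v} [Ring B] [Algebra k B]

/-- The subspace `x M` of a module. -/
def smulRange (x : B) (M : Type*) [AddCommGroup M] [Module k M] [Module B M]
    [IsScalarTower k B M] : Submodule k M :=
  LinearMap.range (Algebra.lsmul k k M x)

/-- The dimension of `x M`. -/
noncomputable def weight (x : B) (M : Type*) [AddCommGroup M] [Module k M] [Module B M]
    [IsScalarTower k B M] : ℕ :=
  Module.finrank k (smulRange k x M)

variable {k}
variable {M : Type*} [AddCommGroup M] [Module k M] [Module B M] [IsScalarTower k B M]
  {M' : Type*} [AddCommGroup M'] [Module k M'] [Module B M'] [IsScalarTower k B M']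

theorem mem_smulRange_iff {x : B} (hx : IsIdempotentElem x) {m : M} :
    m ∈ smulRange k x M ↔ x • m = m := by
  constructor
  · rintro ⟨y, rfl⟩
    simp only [Algebra.lsmul_coe]
    rw [smul_smul, hx.eq]
  · intro h
    exact ⟨m, h⟩

theorem weight_congr (x : B) (f : M ≃ₗ[B] M') : weight k x M = weight k x M' := by
  refine LinearEquiv.finrank_eq ((f.restrictScalars k).ofSubmodules _ _ ?_)
  ext y
  simp only [Submodule.mem_map, smulRange, LinearMap.mem_range, Algebra.lsmul_coe]
  constructor
  · rintro ⟨_, ⟨z, rfl⟩, rfl⟩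
    exact ⟨f z, by simp⟩
  · rintro ⟨z, rfl⟩
    exact ⟨x • f.symm z, ⟨f.symm z, rfl⟩, by simp⟩

/-- For an idempotent x the functor M ↦ x M is exact. -/
theorem weight_add [Module.Finite k M] {x : B} (hx : IsIdempotentElem x) (N : Submodule B M) :
    weight k x M = weight k x N + weight k x (M ⧸ N) := by
  have hq : ∀ y ∈ smulRange k x M, (N.mkQ.restrictScalars k) y ∈ smulRange k x (M ⧸ N) := by
    rintro _ ⟨z, rfl⟩
    exact ⟨N.mkQ z, by simp⟩
  let f : smulRange k x M →ₗ[k] smulRange k x (M ⧸ N) := (N.mkQ.restrictScalars k).restrict hq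
  have hf : LinearMap.range f = ⊤ := by
    rw [LinearMap.range_eq_top]
    rintro ⟨_, ⟨z, rfl⟩⟩
    obtain ⟨z, rfl⟩ := N.mkQ_surjective z
    exact ⟨⟨x • z, ⟨z, rfl⟩⟩, Subtype.ext (by simp [f])⟩
  have hker : Module.finrank k (LinearMap.ker f) = weight k x N := by
    refine LinearEquiv.finrank_eq
      { toFun := fun y => ⟨⟨y.1.1, ?_⟩, ?_⟩
        invFun := fun y => ⟨⟨y.1.1, ?_⟩, ?_⟩
        map_add' := fun _ _ => rfl
        map_smul' := fun _ _ => rfl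
        left_inv := fun _ => rfl
        right_inv := fun _ => rfl }
    · have := y.2
      rw [LinearMap.mem_ker, Subtype.ext_iff] at this
      exact (Submodule.Quotient.mk_eq_zero N).1 this
    · rw [mem_smulRange_iff hx]
      exact Subtype.ext ((mem_smulRange_iff hx).1 y.1.2)
    · rw [mem_smulRange_iff hx]
      exact congrArg Subtype.val ((mem_smulRange_iff hx).1 y.2)
    · rw [LinearMap.mem_ker, Subtype.ext_iff]
      simp [f]
  rw [← hker, add_comm, weight, weight, ← LinearMap.finrank_range_add_finrank_ker f, hf, finrank_top]

theorem weight_eq_zero_iff [Module.Finite k M] {x : B} : weight k x M = 0 ↔ ∀ m : M, x • m = 0 := by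
  rw [weight, Submodule.finrank_eq_zero, smulRange, LinearMap.range_eq_bot]
  constructor
  · intro h m
    exact LinearMap.congr_fun h m
  · intro h
    ext m
    exact h m

theorem weight_subQuot [Module.Finite k M] {x : B} (hx : IsIdempotentElem x)
    {N₁ N₂ : Submodule B M} (h : N₁ ≤ N₂) :
    weight k x N₂ = weight k x N₁ + weight k x (SubQuot N₁ N₂) := by
  have : Module.Finite k N₂ := inferInstanceAs (Module.Finite k (N₂.restrictScalars k))
  rw [weight_add hx (N₁.submoduleOf N₂), weight_congr x (Submodule.submoduleOfEquivOfLe h)]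

theorem fin_telescope {n : ℕ} (f : Fin (n + 1) → ℕ) (g : Fin n → ℕ)
    (h : ∀ i : Fin n, f i.succ = f i.castSucc + g i) : f (Fin.last n) = f 0 + ∑ i, g i := by
  induction n with
  | zero => simp
  | succ n ih =>
    have h1 := ih (fun i => f i.castSucc) (fun i => g i.castSucc) fun i => by
      have := h i.castSucc
      simpa using this
    rw [Fin.sum_univ_castSucc, ← add_assoc]
    have h2 := h (Fin.last n)
    rw [Fin.succ_last] at h2
    rw [h2]
    simpa using h1

end Weight

namespace SplitDirected

variable {k : Type u} [Field k] {B : Type v} [Ring B] [Algebra k B]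
  {Λ : Type w} [Fintype Λ] {e : Λ → B}

section
variable (he : SplitDirected k e)
include he

/-- The generator `e l` of `P_l`. -/
def gen (e : Λ → B) (l : Λ) : ProjMod e l := ⟨e l, Submodule.mem_span_singleton_self _⟩

theorem smul_gen {l : Λ} (x : ProjMod e l) : (x : B) • gen e l = x :=
  Subtype.ext (he.mem_projMod_iff.1 x.2)

theorem idem_smul_gen (l : Λ) : e l • gen e l = gen e l := Subtype.ext (he.idem l)

variable [Module.Finite k B]

/-- An element of P_l outside the radical is c e_l plus a radical element with c ≠ 0, so together
with the radical it generates P_l. -/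
theorem isCoatom_jacobson_comap (l : Λ) :
    IsCoatom ((Ring.jacobson B).submoduleOf (ProjMod e l)) := by
  constructor
  · intro h
    have : gen e l ∈ (Ring.jacobson B).submoduleOf (ProjMod e l) := h ▸ Submodule.mem_top
    exact he.idem_notMem_jacobson l this
  · intro K hK
    obtain ⟨x, hxK, hx⟩ := SetLike.exists_of_lt hK
    obtain ⟨c, hc⟩ := he.exists_scalar_sub_mem_of_mem_projMod (he.mem_projMod_iff.1 x.2)
    have hc0 : c ≠ 0 := by
      rintro rfl
      exact hx (by simpa [Submodule.submoduleOf] using hc)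
    have h1 : x - c • gen e l ∈ K := hK.le hc
    have h2 : c • gen e l ∈ K := by simpa using sub_mem hxK h1
    have h3 : gen e l ∈ K := by
      have := Submodule.smul_of_tower_mem K c⁻¹ h2
      rwa [smul_smul, inv_mul_cancel₀ hc0, one_smul] at this
    rw [eq_top_iff]
    intro y _
    rw [← he.smul_gen y]
    exact K.smul_mem _ h3

theorem jacobson_projMod (l : Λ) :
    Module.jacobson B (ProjMod e l) = (Ring.jacobson B).submoduleOf (ProjMod e l) := by
  refine le_antisymm (sInf_le (he.isCoatom_jacobson_comap l)) fun x hx => ?_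
  rw [← he.smul_gen x]
  have := Module.le_comap_jacobson (LinearMap.toSpanSingleton B (ProjMod e l) (gen e l)) (x := (x : B))
  exact this hx

theorem isSimpleModule_topMod (l : Λ) : IsSimpleModule B (TopMod e l) := by
  rw [isSimpleModule_iff_isCoatom, he.jacobson_projMod]
  exact he.isCoatom_jacobson_comap l

theorem weight_topMod (l : Λ) : weight k (e l) (TopMod e l) = 1 := by
  rw [weight, finrank_eq_one_iff']
  have hid := he.orth.idem l
  have hg : Submodule.Quotient.mk (gen e l) ∈ smulRange k (e l) (TopMod e l) := by
    rw [mem_smulRange_iff hid, ← Submodule.Quotient.mk_smul, he.idem_smul_gen]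
  refine ⟨⟨_, hg⟩, ?_, ?_⟩
  · intro h
    rw [Subtype.ext_iff] at h
    have := (Submodule.Quotient.mk_eq_zero _).1 h
    rw [he.jacobson_projMod] at this
    exact he.idem_notMem_jacobson l this
  · rintro ⟨x, hx⟩
    obtain ⟨x, rfl⟩ := Submodule.Quotient.mk_surjective _ x
    obtain ⟨c, hc⟩ := he.exists_scalar_sub_mem_of_mem_projMod (he.mem_projMod_iff.1 x.2)
    refine ⟨c, Subtype.ext ?_⟩
    symm
    change Submodule.Quotient.mk x = c • Submodule.Quotient.mk (gen e l)
    rw [← Submodule.Quotient.mk_smul, Submodule.Quotient.eq, he.jacobson_projMod]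
    exact hc

variable {M : Type*} [AddCommGroup M] [Module k M] [Module B M] [IsScalarTower k B M]
  [Module.Finite k M]

/-- A vector m with e_l m ≠ 0 gives a nonzero map x ↦ x m from P_l. It kills the radical of P_l
because M is simple, and Schur's lemma makes the induced map an isomorphism. -/
theorem nonempty_equiv_topMod_iff [IsSimpleModule B M] (l : Λ) :
    Nonempty (M ≃ₗ[B] TopMod e l) ↔ weight k (e l) M ≠ 0 := by
  constructor
  · rintro ⟨f⟩
    rw [weight_congr _ f, he.weight_topMod]
    exact one_ne_zero
  · intro h
    rw [Ne, weight_eq_zero_iff] at h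
    push Not at h
    obtain ⟨m, hm⟩ := h
    let f : ProjMod e l →ₗ[B] M := (LinearMap.toSpanSingleton B M m).comp (ProjMod e l).subtype
    have hle : Module.jacobson B (ProjMod e l) ≤ LinearMap.ker f := by
      have h0 : Module.jacobson B M = ⊥ := IsSemisimpleModule.jacobson_eq_bot B M
      have := Module.le_comap_jacobson f
      rwa [h0] at this
    have := he.isSimpleModule_topMod l
    refine ⟨(LinearEquiv.ofBijective ((Module.jacobson B (ProjMod e l)).liftQ f hle)
      (LinearMap.bijective_of_ne_zero fun h => hm ?_)).symm⟩
    have := LinearMap.congr_fun h (Submodule.Quotient.mk (gen e l))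
    exact this

theorem weight_of_isSimpleModule [IsSimpleModule B M] (l : Λ)
    [Decidable (Nonempty (M ≃ₗ[B] TopMod e l))] :
    weight k (e l) M = if Nonempty (M ≃ₗ[B] TopMod e l) then 1 else 0 := by
  split_ifs with h
  · obtain ⟨f⟩ := h
    rw [weight_congr _ f, he.weight_topMod]
  · by_contra h0
    exact h ((he.nonempty_equiv_topMod_iff l).2 h0)

/-- Composition multiplicities are dimensions. -/
theorem hasCompMult_iff (l : Λ) (n : ℕ) :
    HasCompMult B M (TopMod e l) n ↔ weight k (e l) M = n := by
  classical
  have key : ∀ s : CompositionSeries (Submodule B M), s.head = ⊥ → s.last = ⊤ →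
      Nat.card {i : Fin s.length //
        Nonempty (SubQuot (s.toFun i.castSucc) (s.toFun i.succ) ≃ₗ[B] TopMod e l)} =
      weight k (e l) M := by
    intro s h0 h1
    -- Weights telescope along the series, and a simple factor has weight 1 or 0 according to
    -- whether it is S_l.
    have htel := fin_telescope (fun i => weight k (e l) (s.toFun i))
      (fun i => weight k (e l) (SubQuot (s.toFun i.castSucc) (s.toFun i.succ)))
      (fun i => weight_subQuot (he.orth.idem l) (s.step i).1.le)
    have hlast : s.toFun (Fin.last s.length) = ⊤ := h1
    have hhead : s.toFun 0 = ⊥ := h0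
    have ht : weight k (e l) (s.toFun (Fin.last s.length)) = weight k (e l) M :=
      weight_congr (e l) ((LinearEquiv.ofEq _ _ hlast).trans Submodule.topEquiv)
    have hb : weight k (e l) (s.toFun 0) = 0 := by
      have : Module.Finite k (s.toFun 0) :=
        inferInstanceAs (Module.Finite k ((s.toFun 0).restrictScalars k))
      rw [weight_eq_zero_iff]
      rintro ⟨m, hm⟩
      rw [hhead, Submodule.mem_bot] at hm
      exact Subtype.ext (by simp [hm])
    rw [← ht, htel, hb, zero_add, Nat.card_eq_fintype_card, Fintype.card_subtype, Finset.card_filter]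
    refine Finset.sum_congr rfl fun i _ => ?_
    have hs : IsSimpleModule B (SubQuot (s.toFun i.castSucc) (s.toFun i.succ)) :=
      (covBy_iff_quot_is_simple (s.step i).1.le).1 (s.step i)
    have : Module.Finite k (s.toFun i.succ) :=
      inferInstanceAs (Module.Finite k ((s.toFun i.succ).restrictScalars k))
    rw [he.weight_of_isSimpleModule]
  constructor
  · rintro ⟨s, h0, h1, rfl⟩
    exact (key s h0 h1).symm
  · rintro rfl
    have : IsNoetherian B M := isNoetherian_of_tower k inferInstance
    have : IsArtinian B M := isArtinian_of_tower k inferInstance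
    obtain ⟨s, h0, h1⟩ := exists_compositionSeries_of_isNoetherian_isArtinian B M
    exact ⟨s, h0, h1, key s h0 h1⟩

end

end SplitDirected

/-! ### Filtrations -/

section Filtration

open Relation

variable {B : Type v} [Ring B] {Λ : Type w}
  {M : Type*} [AddCommGroup M] [Module B M] {M' : Type*} [AddCommGroup M'] [Module B M']
  {M'' : Type*} [AddCommGroup M''] [Module B M'']
  {D : Λ → Type*} [∀ m, AddCommGroup (D m)] [∀ m, Module B (D m)] {I I' : Set Λ}

/-- A subquotient is isomorphic to any module onto which `N₂` maps with kernel `N₁`. -/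
noncomputable def subQuotEquiv {N₁ N₂ : Submodule B M} (h : N₂ →ₗ[B] M')
    (hs : Function.Surjective h) (hk : ∀ x, h x = 0 ↔ (x : M) ∈ N₁) : SubQuot N₁ N₂ ≃ₗ[B] M' :=
  (Submodule.quotEquivOfEq _ _ (by
    ext x
    rw [LinearMap.mem_ker, hk]
    rfl)).trans (h.quotKerEquivOfSurjective hs)

/-- One step of a filtration with factors `D m`, `m ∈ I`. -/
def FiltStep (D : Λ → Type*) [∀ m, AddCommGroup (D m)] [∀ m, Module B (D m)] (I : Set Λ)
    (N₁ N₂ : Submodule B M) : Prop :=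
  N₁ ≤ N₂ ∧ ∃ m ∈ I, Nonempty (SubQuot N₁ N₂ ≃ₗ[B] D m)

theorem exists_fin_chain {N₁ N₂ : Submodule B M} (h : ReflTransGen (FiltStep D I) N₁ N₂) :
    ∃ (n : ℕ) (F : Fin (n + 1) → Submodule B M), Monotone F ∧ F 0 = N₁ ∧ F (Fin.last n) = N₂ ∧
    ∀ i : Fin n, ∃ m ∈ I, Nonempty (SubQuot (F i.castSucc) (F i.succ) ≃ₗ[B] D m) := by
  induction h with
  | refl => exact ⟨0, fun _ => N₁, fun _ _ _ => le_rfl, rfl, rfl, fun i => i.elim0⟩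
  | tail _ hstep ih =>
    rename_i Na Nb _
    obtain ⟨n, F, hm, h0, hl, hF⟩ := ih
    refine ⟨n + 1, Fin.snoc F Nb, ?_, ?_, by simp, ?_⟩
    · rw [Fin.monotone_iff_le_succ]
      intro i
      refine Fin.lastCases ?_ (fun j => ?_) i
      · rw [Fin.succ_last, Fin.snoc_last, Fin.snoc_castSucc, hl]
        exact hstep.1
      · rw [Fin.succ_castSucc, Fin.snoc_castSucc, Fin.snoc_castSucc]
        exact hm (Fin.castSucc_le_succ j)
    · have : (0 : Fin (n + 1 + 1)) = Fin.castSucc 0 := rfl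
      rw [this, Fin.snoc_castSucc, h0]
    · intro i
      refine Fin.lastCases ?_ (fun j => ?_) i
      · rw [Fin.succ_last, Fin.snoc_last, Fin.snoc_castSucc, hl]
        exact hstep.2
      · rw [Fin.succ_castSucc, Fin.snoc_castSucc, Fin.snoc_castSucc]
        exact hF j

/-- Paths of steps concatenate and are transported along injections and surjections, so extensions
of filtered modules need no reindexing of chains. -/
theorem hasFiltrationBy_iff :
    HasFiltrationBy (A := B) M D I ↔ ReflTransGen (FiltStep (B := B) (M := M) D I) ⊥ ⊤ := by
  constructor
  · rintro ⟨n, F, hm, h0, hl, hF⟩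
    rw [← h0, ← hl]
    have : ∀ i : Fin (n + 1), ReflTransGen (FiltStep D I) (F 0) (F i) := by
      intro i
      induction i using Fin.induction with
      | zero => exact .refl
      | succ i ih => exact ih.tail ⟨hm (Fin.castSucc_le_succ i), hF i⟩
    exact this _
  · exact exists_fin_chain

theorem FiltStep.map {N₁ N₂ : Submodule B M} (h : FiltStep D I N₁ N₂) {f : M →ₗ[B] M'}
    (hf : Function.Injective f) : FiltStep D I (N₁.map f) (N₂.map f) := by
  obtain ⟨hle, m, hm, ⟨g⟩⟩ := h
  suffices E : SubQuot N₁ N₂ ≃ₗ[B] SubQuot (N₁.map f) (N₂.map f) from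
    ⟨Submodule.map_mono hle, m, hm, ⟨E.symm.trans g⟩⟩
  refine subQuotEquiv
    ((Submodule.mkQ ((N₁.map f).submoduleOf (N₂.map f))).comp
      (f.restrict (q := N₂.map f) fun x hx => Submodule.mem_map_of_mem hx)) ?_ ?_
  · refine (Submodule.mkQ_surjective _).comp ?_
    rintro ⟨_, x, hx, rfl⟩
    exact ⟨⟨x, hx⟩, rfl⟩
  · rintro ⟨x, hx⟩
    rw [LinearMap.comp_apply, Submodule.mkQ_apply, Submodule.Quotient.mk_eq_zero]
    exact hf.mem_set_image

theorem FiltStep.comap {N₁ N₂ : Submodule B M'} (h : FiltStep D I N₁ N₂) {f : M →ₗ[B] M'}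
    (hf : Function.Surjective f) : FiltStep D I (N₁.comap f) (N₂.comap f) := by
  obtain ⟨hle, m, hm, ⟨g⟩⟩ := h
  suffices E : SubQuot (N₁.comap f) (N₂.comap f) ≃ₗ[B] SubQuot N₁ N₂ from
    ⟨Submodule.comap_mono hle, m, hm, ⟨E.trans g⟩⟩
  refine subQuotEquiv
    ((Submodule.mkQ (N₁.submoduleOf N₂)).comp (f.restrict (p := N₂.comap f) fun x hx => hx)) ?_ ?_
  · refine (Submodule.mkQ_surjective _).comp ?_
    rintro ⟨y, hy⟩
    obtain ⟨x, rfl⟩ := hf y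
    exact ⟨⟨x, hy⟩, rfl⟩
  · rintro ⟨x, hx⟩
    rw [LinearMap.comp_apply, Submodule.mkQ_apply, Submodule.Quotient.mk_eq_zero]
    rfl

theorem reflTransGen_map {N₁ N₂ : Submodule B M} (h : ReflTransGen (FiltStep D I) N₁ N₂)
    {f : M →ₗ[B] M'} (hf : Function.Injective f) :
    ReflTransGen (FiltStep D I) (N₁.map f) (N₂.map f) :=
  h.lift _ fun _ _ hs => hs.map hf

theorem reflTransGen_comap {N₁ N₂ : Submodule B M'} (h : ReflTransGen (FiltStep D I) N₁ N₂)
    {f : M →ₗ[B] M'} (hf : Function.Surjective f) :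
    ReflTransGen (FiltStep D I) (N₁.comap f) (N₂.comap f) :=
  h.lift _ fun _ _ hs => hs.comap hf

namespace HasFiltrationBy

theorem congr (h : HasFiltrationBy (A := B) M D I) (f : M ≃ₗ[B] M') : HasFiltrationBy (A := B) M' D I := by
  rw [hasFiltrationBy_iff] at h ⊢
  have := reflTransGen_map h f.injective
  rwa [Submodule.map_bot, Submodule.map_top, LinearEquiv.range] at this

theorem mono (h : HasFiltrationBy (A := B) M D I) (hI : I ⊆ I') : HasFiltrationBy (A := B) M D I' := by
  obtain ⟨n, F, h1, h2, h3, h4⟩ := h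
  exact ⟨n, F, h1, h2, h3, fun i => let ⟨m, hm, e⟩ := h4 i; ⟨m, hI hm, e⟩⟩

theorem of_subsingleton [Subsingleton M] : HasFiltrationBy (A := B) M D I := by
  rw [hasFiltrationBy_iff, Subsingleton.elim (⊤ : Submodule B M) ⊥]

theorem of_equiv {m : Λ} (hm : m ∈ I) (f : M ≃ₗ[B] D m) : HasFiltrationBy (A := B) M D I := by
  rw [hasFiltrationBy_iff]
  refine .single ⟨bot_le, m, hm, ⟨(subQuotEquiv Submodule.topEquiv.toLinearMap
    Submodule.topEquiv.surjective fun x => ?_).trans f⟩⟩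
  rw [Submodule.mem_bot]
  rfl

theorem of_exact (h : HasFiltrationBy (A := B) M' D I) (h' : HasFiltrationBy (A := B) M'' D I) {f : M' →ₗ[B] M}
    {g : M →ₗ[B] M''} (hf : Function.Injective f) (hg : Function.Surjective g)
    (hfg : LinearMap.range f = LinearMap.ker g) : HasFiltrationBy (A := B) M D I := by
  rw [hasFiltrationBy_iff] at *
  have h1 := reflTransGen_map h hf
  have h2 := reflTransGen_comap h' hg
  rw [Submodule.map_bot, Submodule.map_top, hfg] at h1
  rw [Submodule.comap_top, Submodule.comap_bot] at h2
  exact h1.trans h2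

theorem of_submodule {N : Submodule B M} (h : HasFiltrationBy (A := B) N D I)
    (h' : HasFiltrationBy (A := B) (M ⧸ N) D I) : HasFiltrationBy (A := B) M D I :=
  h.of_exact h' N.subtype_injective N.mkQ_surjective (by simp)

theorem pi_fin {n : ℕ} {X : Fin n → Type*} [∀ q, AddCommGroup (X q)] [∀ q, Module B (X q)]
    (h : ∀ q, HasFiltrationBy (A := B) (X q) D I) : HasFiltrationBy (A := B) (∀ q, X q) D I := by
  induction n with
  | zero => exact of_subsingleton
  | succ n ih =>
    refine (ih fun q => h q.succ).of_exact (h 0)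
      (f := LinearMap.pi fun i => Fin.cases (motive := fun i => (∀ q : Fin n, X q.succ) →ₗ[B] X i)
        0 (fun q => LinearMap.proj q) i)
      (g := LinearMap.proj 0) ?_ (LinearMap.proj_surjective 0) ?_
    · intro x y hxy
      funext q
      exact congrFun hxy q.succ
    · ext x
      simp only [LinearMap.mem_range, LinearMap.mem_ker, LinearMap.proj_apply]
      constructor
      · rintro ⟨y, rfl⟩
        simp
      · intro hx
        refine ⟨fun q => x q.succ, ?_⟩
        funext i
        refine Fin.cases ?_ (fun q => ?_) i
        · simp [hx]
        · simp

theorem pi {ι : Type*} [Finite ι] {X : ι → Type*} [∀ q, AddCommGroup (X q)]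
    [∀ q, Module B (X q)] (h : ∀ q, HasFiltrationBy (A := B) (X q) D I) :
    HasFiltrationBy (A := B) (∀ q, X q) D I := by
  obtain ⟨n, ⟨f⟩⟩ := Finite.exists_equiv_fin ι
  exact (pi_fin fun q => h (f.symm q)).congr (LinearEquiv.piCongrLeft B X f.symm)

/-- A step N₁ ≤ N₂ is refined by pulling a filtration of N₂ / N₁ back to N₂. -/
theorem refine_by {D' : Λ → Type*} [∀ m, AddCommGroup (D' m)] [∀ m, Module B (D' m)]
    (h : HasFiltrationBy (A := B) M D I) (h' : ∀ m ∈ I, HasFiltrationBy (A := B) (D m) D' I') :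
    HasFiltrationBy (A := B) M D' I' := by
  rw [hasFiltrationBy_iff] at h ⊢
  refine reflTransGen_closed ?_ _ _ h
  rintro N₁ N₂ ⟨hle, m, hm, ⟨g⟩⟩
  have h1 := (hasFiltrationBy_iff.1 (h' m hm))
  have h2 := reflTransGen_map (reflTransGen_comap h1 (f := g.toLinearMap.comp
    (Submodule.mkQ (N₁.submoduleOf N₂))) (g.surjective.comp (Submodule.mkQ_surjective _)))
    N₂.subtype_injective
  rw [Submodule.comap_top, Submodule.map_subtype_top] at h2
  convert h2
  ext x
  simp only [Submodule.mem_map, Submodule.mem_comap, LinearMap.comp_apply, Submodule.mem_bot,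
    LinearEquiv.coe_coe, LinearEquiv.map_eq_zero_iff, Submodule.mkQ_apply,
    Submodule.Quotient.mk_eq_zero]
  constructor
  · intro hx
    exact ⟨⟨x, hle hx⟩, hx, rfl⟩
  · rintro ⟨y, hy, rfl⟩
    exact hy

/-- Induction along a filtration. -/
theorem induction (h : HasFiltrationBy (A := B) M D I) (P : Submodule B M → Prop) (h0 : P ⊥)
    (hs : ∀ N₁ N₂ : Submodule B M, N₁ ≤ N₂ → ∀ m ∈ I, (SubQuot N₁ N₂ ≃ₗ[B] D m) → P N₁ → P N₂) :
    P ⊤ := by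
  rw [hasFiltrationBy_iff] at h
  have : ∀ N, ReflTransGen (FiltStep D I) ⊥ N → P N := by
    intro N hN
    induction hN with
    | refl => exact h0
    | tail _ hst ih =>
      obtain ⟨hle, m, hm, ⟨g⟩⟩ := hst
      exact hs _ _ hle m hm g ih
  exact this _ h

end HasFiltrationBy

end Filtration

/-! ### Decomposition of projective modules -/

/-- The elements `g q` are generators of a decomposition `M = ⨁ A (g q)` with
`A (g q) ≅ P_(t q)`. -/
structure IsProjBasis {B : Type v} [Ring B] {Λ : Type w} (e : Λ → B) {M : Type*} [AddCommGroup M]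
    [Module B M] {ι : Type*} [Fintype ι] (t : ι → Λ) (g : ι → M) : Prop where
  idem : ∀ q, e (t q) • g q = g q
  span : ∀ y, ∃ x : ι → B, ∑ q, x q • g q = y
  indep : ∀ x : ι → B, ∑ q, x q • g q = 0 → ∀ q, x q * e (t q) = 0

namespace SplitDirected

variable {k : Type u} [Field k] {B : Type v} [Ring B] [Algebra k B]
  {Λ : Type w} [Fintype Λ] {e : Λ → B}
  {M : Type*} [AddCommGroup M] [Module B M] {ι : Type*} [Fintype ι] {t : ι → Λ} {g : ι → M}

/-- The linear map `⨁ P_(t q) → M` given by `g q ∈ M`. -/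
def sumMap (e : Λ → B) (t : ι → Λ) (g : ι → M) : (∀ q, ProjMod e (t q)) →ₗ[B] M :=
  ∑ q, (LinearMap.toSpanSingleton B M (g q)).comp
    ((ProjMod e (t q)).subtype.comp (LinearMap.proj q))

theorem sumMap_apply (x : ∀ q, ProjMod e (t q)) :
    sumMap e t g x = ∑ q, (x q : B) • g q := by
  simp [sumMap]

section
variable (he : SplitDirected k e)
include he

theorem projective_projMod (l : Λ) : Module.Projective B (ProjMod e l) := by
  refine Module.Projective.of_split (ProjMod e l).subtype
    ((LinearMap.toSpanSingleton B B (e l)).codRestrict _ fun x => ?_) ?_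
  · exact he.mem_projMod_iff.2 (he.mul_idem_assoc l x)
  · ext x
    exact he.mem_projMod_iff.1 x.2

theorem mul_idem_mem (l : Λ) (x : B) : x * e l ∈ ProjMod e l :=
  he.mem_projMod_iff.2 (he.mul_idem_assoc l x)

theorem sum_smul_eq_sumMap (hid : ∀ q, e (t q) • g q = g q) (x : ι → B) :
    ∑ q, x q • g q = sumMap e t g fun q => ⟨x q * e (t q), he.mul_idem_mem _ _⟩ := by
  rw [sumMap_apply]
  refine Finset.sum_congr rfl fun q _ => ?_
  rw [mul_smul, hid]

theorem bijective_sumMap (h : IsProjBasis e t g) : Function.Bijective (sumMap e t g) := by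
  constructor
  · rw [injective_iff_map_eq_zero]
    intro x hx
    rw [sumMap_apply] at hx
    funext q
    have := h.indep _ hx q
    rw [he.mem_projMod_iff.1 (x q).2] at this
    exact Subtype.ext this
  · intro y
    obtain ⟨x, rfl⟩ := h.span y
    exact ⟨_, (he.sum_smul_eq_sumMap h.idem x).symm⟩

theorem projective_of_isProjBasis (h : IsProjBasis e t g) : Module.Projective B M := by
  have := fun q => he.projective_projMod (t q)
  classical
  have : Module.Projective B (∀ q, ProjMod e (t q)) :=
    Module.Projective.of_equiv (DFinsupp.linearEquivFunOnFintype (R := B)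
      (M := fun q => ProjMod e (t q)))
  exact Module.Projective.of_equiv (LinearEquiv.ofBijective _ (he.bijective_sumMap h))

theorem mul_idem_sub_mem (l : Λ) (x : B) : x * e l - e l * x * e l ∈ offDiagIdeal e := by
  rw [he.mem_offDiagIdeal_iff_diag]
  intro m
  by_cases hm : m = l
  · subst hm
    simp only [mul_sub, mul_assoc, he.idem_assoc, sub_self, zero_mul]
  · simp only [mul_sub, sub_mul, mul_assoc, he.mul_of_ne (Ne.symm hm), mul_zero, sub_self]

variable [Module.Finite k B]

/-- A finite module has a family of homogeneous generators all of whose relations have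
coefficients in the radical. -/
theorem exists_minimal_generators (M : Type*) [AddCommGroup M] [Module B M] [Module.Finite B M] :
    ∃ (n : ℕ) (t : Fin n → Λ) (g : Fin n → M), (∀ q, e (t q) • g q = g q) ∧
      (∀ y, ∃ x : Fin n → B, ∑ q, x q • g q = y) ∧
      ∀ x : Fin n → B, ∑ q, x q • g q = 0 → ∀ q, x q * e (t q) ∈ Ring.jacobson B := by
  classical
  have hex : ∃ (n : ℕ) (t : Fin n → Λ) (g : Fin n → M), (∀ q, e (t q) • g q = g q) ∧
      (∀ y, ∃ x : Fin n → B, ∑ q, x q • g q = y) := by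
    obtain ⟨n, s, hs⟩ := Module.Finite.exists_fin (R := B) (M := M)
    obtain ⟨N, ⟨f⟩⟩ := Finite.exists_equiv_fin (Fin n × Λ)
    refine ⟨N, fun q => (f.symm q).2, fun q => e (f.symm q).2 • s (f.symm q).1, ?_, ?_⟩
    · intro q
      rw [smul_smul, he.idem]
    · intro y
      have : y ∈ Submodule.span B (Set.range s) := hs ▸ Submodule.mem_top
      obtain ⟨c, rfl⟩ := (Submodule.mem_span_range_iff_exists_fun B).1 this
      refine ⟨fun q => c (f.symm q).1, ?_⟩
      rw [f.symm.sum_comp (fun p : Fin n × Λ => c p.1 • e p.2 • s p.1), Fintype.sum_prod_type]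
      refine Finset.sum_congr rfl fun i _ => ?_
      simp only []
      rw [← Finset.smul_sum, ← Finset.sum_smul, he.orth.complete, one_smul]
  -- Take the least number of homogeneous generators. A relation with a coefficient outside the
  -- radical would make one of them redundant.
  have hspec := Nat.find_spec hex
  have hmin := fun m => Nat.find_min hex (m := m)
  generalize Nat.find hex = n at hspec hmin
  obtain ⟨t, g, hid, hspan⟩ := hspec
  refine ⟨n, t, g, hid, hspan, fun x hx p => ?_⟩
  by_contra hp
  obtain ⟨n, rfl⟩ : ∃ n', n = n' + 1 := ⟨n - 1, by have := p.pos; omega⟩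
  -- The coefficient differs from its corner component by an element of J, hence of the radical. So
  -- that component is outside the radical too, and is invertible in the corner.
  have hy : e (t p) * x p * e (t p) ∉ Ring.jacobson B := fun h => hp (by
    have := add_mem (he.offDiagIdeal_le_jacobson (he.mul_idem_sub_mem (t p) (x p))) h
    simpa using this)
  obtain ⟨u, hu, hu'⟩ := he.exists_corner_inv (l := t p) (by
    simp only [mul_assoc, he.idem, he.idem_assoc]) hy
  have hue : u * e (t p) = u := by rw [← hu', he.mul_idem_assoc]
  have hgp : g p = ∑ q, (-(u * x (p.succAbove q))) • g (p.succAbove q) := by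
    rw [Fin.sum_univ_succAbove _ p] at hx
    have h1 : g p = (u * x p) • g p := by
      conv_lhs => rw [← hid p, ← hu]
      rw [← mul_assoc, ← mul_assoc, hue, mul_smul, hid]
    rw [h1, mul_smul, eq_neg_of_add_eq_zero_left hx, smul_neg, Finset.smul_sum,
      ← Finset.sum_neg_distrib]
    exact Finset.sum_congr rfl fun q _ => by rw [neg_smul, mul_smul]
  refine hmin n (Nat.lt_succ_self n) ⟨fun q => t (p.succAbove q), fun q => g (p.succAbove q),
    fun q => hid _, fun y => ?_⟩
  obtain ⟨z, rfl⟩ := hspan y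
  refine ⟨fun q => z p * -(u * x (p.succAbove q)) + z (p.succAbove q), ?_⟩
  rw [Fin.sum_univ_succAbove _ p]
  conv_rhs => rw [hgp, Finset.smul_sum]
  rw [← Finset.sum_add_distrib]
  exact Finset.sum_congr rfl fun q _ => by rw [add_smul, mul_smul]

/-- A finitely generated projective module is a direct sum of modules `P_l`. -/
theorem exists_isProjBasis (M : Type*) [AddCommGroup M] [Module B M] [Module.Finite B M]
    [Module.Projective B M] :
    ∃ (n : ℕ) (t : Fin n → Λ) (g : Fin n → M), IsProjBasis e t g := by
  classical
  obtain ⟨n, t, g, hid, hspan, hrel⟩ := he.exists_minimal_generators M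
  refine ⟨n, t, g, hid, hspan, ?_⟩
  have hsurj : Function.Surjective (sumMap e t g) := fun y => by
    obtain ⟨x, rfl⟩ := hspan y
    exact ⟨_, (he.sum_smul_eq_sumMap hid x).symm⟩
  obtain ⟨σ, hσ⟩ := Module.projective_lifting_property (sumMap e t g) LinearMap.id hsurj
  have hσ' : ∀ y, sumMap e t g (σ y) = y := fun y => LinearMap.congr_fun hσ y
  -- π projects onto the kernel of the cover. Its entries are radical because all relations are, and
  -- it fixes the kernel, so kernel elements have entries in every power of the radical.
  let π : (∀ q, ProjMod e (t q)) →ₗ[B] (∀ q, ProjMod e (t q)) :=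
    LinearMap.id - σ.comp (sumMap e t g)
  have hπ : ∀ x q, (π x q : B) ∈ Ring.jacobson B := by
    intro x q
    have h0 : sumMap e t g (π x) = 0 := by simp [π, hσ']
    rw [sumMap_apply] at h0
    have := hrel _ h0 q
    rwa [he.mem_projMod_iff.1 (π x q).2] at this
  have hpow : ∀ (i : ℕ) (x : ∀ q, ProjMod e (t q)), sumMap e t g x = 0 →
      ∀ q, (x q : B) ∈ Ring.jacobson B ^ i := by
    intro i
    induction i with
    | zero => intro x _ q; exact GrPiece.mem_pow_zero _
    | succ i ih =>
      intro x hx p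
      have h1 : x = ∑ q, (x q : B) • Pi.single q (gen e (t q)) := by
        conv_lhs => rw [← Finset.univ_sum_single x]
        refine Finset.sum_congr rfl fun q _ => ?_
        rw [← Pi.single_smul, he.smul_gen]
      have h2 : x = π x := by simp [π, hx]
      have h3 : x p = ∑ q, (x q : B) • π (Pi.single q (gen e (t q))) p := by
        conv_lhs => rw [h2, h1, map_sum]
        simp
      rw [h3, Submodule.coe_sum]
      refine sum_mem fun q _ => ?_
      rw [Submodule.pow_succ]
      exact Ideal.mul_mem_mul (ih x hx q) (hπ _ p)
  intro x hx q
  obtain ⟨i, hi⟩ := isNilpotent_jacobson (B := B) k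
  rw [he.sum_smul_eq_sumMap hid] at hx
  have := hpow i _ hx q
  rw [hi] at this
  simpa using this

end

end SplitDirected

/-! ### Traces and standard modules -/

section Trace

variable {B : Type v} [Ring B] {Λ : Type w} (e : Λ → B) (U : Set Λ)
  {M : Type*} [AddCommGroup M] [Module B M] {M' : Type*} [AddCommGroup M'] [Module B M']

/-- The submodule of `N` generated by the `e z • n`, `z ∈ U`. -/
def idemTrace (N : Submodule B M) : Submodule B M :=
  Submodule.span B {x | ∃ z ∈ U, ∃ n ∈ N, x = e z • n}

variable {e U}

theorem smul_mem_idemTrace {N : Submodule B M} {z : Λ} (hz : z ∈ U) {n : M} (hn : n ∈ N) :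
    e z • n ∈ idemTrace e U N := Submodule.subset_span ⟨z, hz, n, hn, rfl⟩

theorem idemTrace_le_iff {N N' : Submodule B M} :
    idemTrace e U N ≤ N' ↔ ∀ z ∈ U, ∀ n ∈ N, e z • n ∈ N' := by
  rw [idemTrace, Submodule.span_le]
  constructor
  · intro h z hz n hn
    exact h ⟨z, hz, n, hn, rfl⟩
  · rintro h _ ⟨z, hz, n, hn, rfl⟩
    exact h z hz n hn

theorem idemTrace_le (N : Submodule B M) : idemTrace e U N ≤ N :=
  idemTrace_le_iff.2 fun _ _ _ hn => N.smul_mem _ hn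

theorem idemTrace_mono {N N' : Submodule B M} (h : N ≤ N') : idemTrace e U N ≤ idemTrace e U N' :=
  idemTrace_le_iff.2 fun _ hz _ hn => smul_mem_idemTrace hz (h hn)

theorem map_mem_idemTrace (f : M →ₗ[B] M') {N : Submodule B M} {x : M} (hx : x ∈ idemTrace e U N) :
    f x ∈ idemTrace e U (⊤ : Submodule B M') := by
  have : idemTrace e U N ≤ (idemTrace e U (⊤ : Submodule B M')).comap f :=
    idemTrace_le_iff.2 fun z hz n _ => by
      rw [Submodule.mem_comap, map_smul]
      exact smul_mem_idemTrace hz Submodule.mem_top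
  exact this hx

theorem idem_mul_mem_idemTrace {z : Λ} (hz : z ∈ U) (b : B) :
    e z * b ∈ idemTrace e U (⊤ : Submodule B B) :=
  smul_mem_idemTrace (M := B) hz Submodule.mem_top

theorem mul_mem_idemTrace {x : B} (hx : x ∈ idemTrace e U (⊤ : Submodule B B)) (b : B) :
    x * b ∈ idemTrace e U (⊤ : Submodule B B) :=
  map_mem_idemTrace (LinearMap.toSpanSingleton B B b) hx

/-- Each factor is generated by vectors e_m d, and applying e_m to a lift of d gives a lift of e_m d
inside the trace. -/
theorem HasFiltrationBy.idemTrace_eq_top {D : Λ → Type*} [∀ m, AddCommGroup (D m)]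
    [∀ m, Module B (D m)] (h : HasFiltrationBy (A := B) M D U)
    (hD : ∀ m ∈ U, idemTrace e {m} (⊤ : Submodule B (D m)) = ⊤) :
    idemTrace e U (⊤ : Submodule B M) = ⊤ := by
  rw [eq_top_iff]
  refine h.induction (fun N => N ≤ idemTrace e U ⊤) bot_le fun N₁ N₂ hle m hm φ ih n hn => ?_
  have key : ∀ d ∈ idemTrace e {m} (⊤ : Submodule B (D m)), ∃ n' : N₂,
      φ (Submodule.Quotient.mk n') = d ∧ (n' : M) ∈ idemTrace e U (⊤ : Submodule B M) := by
    intro d hd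
    refine Submodule.span_induction ?_ ?_ ?_ ?_ hd
    · rintro _ ⟨z, rfl, d, -, rfl⟩
      obtain ⟨q, rfl⟩ := φ.surjective d
      obtain ⟨n', rfl⟩ := Submodule.Quotient.mk_surjective _ q
      exact ⟨e z • n', by simp, smul_mem_idemTrace hm Submodule.mem_top⟩
    · exact ⟨0, by simp, zero_mem _⟩
    · rintro _ _ _ _ ⟨x, rfl, hx⟩ ⟨y, rfl, hy⟩
      exact ⟨x + y, by simp, add_mem hx hy⟩
    · rintro b _ _ ⟨x, rfl, hx⟩
      exact ⟨b • x, by simp, Submodule.smul_mem _ _ hx⟩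
  obtain ⟨n', h1, h2⟩ := key (φ (Submodule.Quotient.mk ⟨n, hn⟩)) (by rw [hD m hm]; trivial)
  rw [φ.injective.eq_iff, Submodule.Quotient.eq] at h1
  have h3 : (n' : M) - n ∈ N₁ := h1
  have := sub_mem h2 (ih h3)
  simpa using this

end Trace

namespace SplitDirected

variable {k : Type u} [Field k] {B : Type v} [Ring B] [Algebra k B]
  {Λ : Type w} [Fintype Λ] {e : Λ → B}

section
variable (he : SplitDirected k e)
include he

theorem idemTrace_quot_eq_top (m : Λ) (K : Submodule B (ProjMod e m)) :
    idemTrace e {m} (⊤ : Submodule B (ProjMod e m ⧸ K)) = ⊤ := by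
  rw [eq_top_iff]
  rintro x -
  obtain ⟨x, rfl⟩ := Submodule.Quotient.mk_surjective _ x
  rw [← he.smul_gen x, ← he.idem_smul_gen m, Submodule.Quotient.mk_smul,
    Submodule.Quotient.mk_smul]
  exact Submodule.smul_mem _ _ (smul_mem_idemTrace (Set.mem_singleton m) Submodule.mem_top)

/-- The trace of U in P_l is the least K such that S_m does not occur in P_l / K for m ∈ U. This
yields the formula for standard kernels. -/
theorem idemTrace_submoduleOf_le_iff {U : Set Λ} {l : Λ} {K : Submodule B (ProjMod e l)} :
    (idemTrace e U (⊤ : Submodule B B)).submoduleOf (ProjMod e l) ≤ K ↔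
      ∀ m ∈ U, ∀ x : ProjMod e l, e m • x ∈ K := by
  constructor
  · intro h m hm x
    exact h (smul_mem_idemTrace hm Submodule.mem_top)
  · intro h x hx
    let f : B →ₗ[B] ProjMod e l :=
      (LinearMap.toSpanSingleton B B (e l)).codRestrict _ fun x => he.mul_idem_mem l x
    have h1 : idemTrace e U (⊤ : Submodule B B) ≤ K.comap f := idemTrace_le_iff.2 fun m hm b _ => by
      rw [Submodule.mem_comap, map_smul]
      exact h m hm _
    have h2 : f x = x := Subtype.ext (he.mem_projMod_iff.1 x.2)
    rw [← h2]
    exact h1 hx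

/-- The directed order can be replaced by a height function. -/
theorem exists_height :
    ∃ ht : Λ → ℕ, ∀ l m : Λ, l ≠ m → ∀ a : B, e m * a * e l ≠ 0 → ht l < ht m := by
  classical
  obtain ⟨r, hr⟩ := he.dir
  refine ⟨fun l => (Finset.univ.filter fun x => r.lt x l).card, fun l m hlm a ha => ?_⟩
  have hlt : r.lt l m := lt_of_le_of_ne (hr l m ⟨a, ha⟩) hlm
  refine Finset.card_lt_card ⟨fun x hx => ?_, fun h => ?_⟩
  · rw [Finset.mem_filter] at hx ⊢
    exact ⟨hx.1, lt_trans hx.2 hlt⟩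
  · have := h (Finset.mem_filter.2 ⟨Finset.mem_univ l, hlt⟩)
    exact lt_irrefl l (Finset.mem_filter.1 this).2

variable [Module.Finite k B]

theorem finite_projMod (l : Λ) : Module.Finite k (ProjMod e l) :=
  inferInstanceAs (Module.Finite k ((ProjMod e l).restrictScalars k))

theorem hasCompMult_zero_iff {l m : Λ} {K : Submodule B (ProjMod e l)} :
    HasCompMult B (ProjMod e l ⧸ K) (TopMod e m) 0 ↔ ∀ x : ProjMod e l, e m • x ∈ K := by
  have := he.finite_projMod l
  have : Module.Finite k (ProjMod e l ⧸ K) :=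
    Module.Finite.of_surjective (K.mkQ.restrictScalars k) K.mkQ_surjective
  rw [he.hasCompMult_iff, weight_eq_zero_iff]
  constructor
  · intro h x
    have := h (Submodule.Quotient.mk x)
    rwa [← Submodule.Quotient.mk_smul, Submodule.Quotient.mk_eq_zero] at this
  · intro h x
    obtain ⟨x, rfl⟩ := Submodule.Quotient.mk_surjective _ x
    rw [← Submodule.Quotient.mk_smul, Submodule.Quotient.mk_eq_zero]
    exact h x

theorem standardKer_eq [LinearOrder Λ] (l : Λ) :
    standardKer e l =
      (idemTrace e {m | l < m} (⊤ : Submodule B B)).submoduleOf (ProjMod e l) := by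
  have : {K : Submodule B (ProjMod e l) | ∀ m : Λ, ¬ m ≤ l →
      HasCompMult B (↥(ProjMod e l) ⧸ K) (TopMod e m) 0} =
      Set.Ici ((idemTrace e {m | l < m} (⊤ : Submodule B B)).submoduleOf (ProjMod e l)) := by
    ext K
    simp only [Set.mem_ofPred_eq, Set.mem_Ici, he.hasCompMult_zero_iff, not_le,
      he.idemTrace_submoduleOf_le_iff]
  rw [standardKer, this, csInf_Ici]

/-- The factors `P_l` of the regular module. -/
noncomputable def piEquiv : B ≃ₗ[B] ∀ l, ProjMod e l := by
  refine LinearEquiv.ofBijective (LinearMap.pi fun l =>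
    (LinearMap.toSpanSingleton B B (e l)).codRestrict _ fun x => he.mul_idem_mem l x) ⟨?_, ?_⟩
  · intro x y hxy
    rw [← he.mul_sum x, ← he.mul_sum y]
    refine Finset.sum_congr rfl fun l _ => ?_
    exact congrArg Subtype.val (congrFun hxy l)
  · intro x
    refine ⟨∑ l, (x l : B), ?_⟩
    funext l
    refine Subtype.ext ?_
    change (∑ m, (x m : B)) * e l = x l
    rw [Finset.sum_mul, Finset.sum_eq_single l]
    · exact he.mem_projMod_iff.1 (x l).2
    · intro m _ hm
      rw [← he.mem_projMod_iff.1 (x m).2, mul_assoc, he.mul_of_ne hm, mul_zero]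
    · simp

theorem hasFiltrationBy_of_forall_projMod {D : Λ → Type*} [∀ m, AddCommGroup (D m)]
    [∀ m, Module B (D m)] {I : Set Λ} (h : ∀ l, HasFiltrationBy (A := B) (ProjMod e l) D I) :
    HasFiltrationBy (A := B) B D I :=
  (HasFiltrationBy.pi h).congr he.piEquiv.symm

/-- For a standardly stratified algebra the regular module is filtered by standard modules. -/
theorem hasFiltrationBy_of_isStandardlyStratified [LinearOrder Λ] (h : IsStandardlyStratified e) :
    HasFiltrationBy (A := B) B (StandardMod e) Set.univ := by
  obtain ⟨K, hK, hF⟩ := h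
  -- The conditions determine K: a filtration by modules Δ_m with m > l makes K_l equal to its own
  -- trace, and the condition on composition factors puts the trace of P_l inside K_l.
  obtain rfl : K = standardKer e := by
    funext l
    rw [he.standardKer_eq]
    refine le_antisymm (fun x hx => ?_) (he.idemTrace_submoduleOf_le_iff.2 fun m hm x => ?_)
    · have := (hF l).idemTrace_eq_top fun m _ => he.idemTrace_quot_eq_top m (K m)
      have hx' : (⟨x, hx⟩ : K l) ∈ idemTrace e {m | l < m} (⊤ : Submodule B (K l)) := by
        rw [this]; trivial
      exact map_mem_idemTrace ((ProjMod e l).subtype.comp (K l).subtype) hx'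
    · exact he.hasCompMult_zero_iff.1 (hK l m (not_le.2 hm)) x
  exact he.hasFiltrationBy_of_forall_projMod fun l =>
    HasFiltrationBy.of_submodule ((hF l).mono (Set.subset_univ _))
      (HasFiltrationBy.of_equiv (Set.mem_univ l) (LinearEquiv.refl _ _))

/-! ### Projectivity of the off-diagonal ideal -/

/-- The left module `J e_l`. -/
abbrev radAt (e : Λ → B) (l : Λ) : Submodule B B := offDiagIdeal e ⊓ ProjMod e l

theorem mul_idem_mem_radAt {l : Λ} {x : B} (hx : x ∈ offDiagIdeal e) : x * e l ∈ radAt e l :=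
  ⟨Ideal.mul_mem_right _ _ hx, he.mul_idem_mem l x⟩

theorem projective_radAt (h : Module.Projective B (offDiagIdeal e)) (l : Λ) :
    Module.Projective B (radAt e l) := by
  refine Module.Projective.of_split (Submodule.inclusion inf_le_left)
    (((LinearMap.toSpanSingleton B B (e l)).comp (offDiagIdeal e).subtype).codRestrict _
      fun x => he.mul_idem_mem_radAt x.2) ?_
  ext x
  exact he.mem_projMod_iff.1 x.2.2

theorem projective_of_projective_radAt (h : ∀ l, Module.Projective B (radAt e l)) :
    Module.Projective B (offDiagIdeal e) := by
  classical
  have : Module.Projective B (∀ l, radAt e l) :=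
    Module.Projective.of_equiv (DFinsupp.linearEquivFunOnFintype (R := B)
      (M := fun l => radAt e l))
  refine Module.Projective.of_split
    (LinearMap.pi fun l => ((LinearMap.toSpanSingleton B B (e l)).comp
      (offDiagIdeal e).subtype).codRestrict (radAt e l) fun x => he.mul_idem_mem_radAt x.2)
    (∑ l, (Submodule.inclusion inf_le_left).comp (LinearMap.proj l)) ?_
  ext x
  simp only [LinearMap.comp_apply, LinearMap.sum_apply, Submodule.coe_sum, LinearMap.id_apply]
  exact he.mul_sum _

theorem exists_isProjBasis_radAt (h : Module.Projective B (offDiagIdeal e)) (l : Λ) :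
    ∃ (n : ℕ) (t : Fin n → Λ) (g : Fin n → radAt e l), IsProjBasis e t g := by
  have : IsNoetherian B B := isNoetherian_of_tower k inferInstance
  have := he.projective_radAt h l
  exact he.exists_isProjBasis (radAt e l)

/-- A trace of a module filtered by projective modules `P_m`, `m ∈ U`, and by modules with
trivial trace. -/
theorem exists_isProjBasis_idemTrace {M : Type*} [AddCommGroup M] [Module B M]
    {D : Λ → Type*} [∀ m, AddCommGroup (D m)] [∀ m, Module B (D m)] {U : Set Λ}
    (h : HasFiltrationBy (A := B) M D Set.univ)
    (hU : ∀ m ∈ U, Nonempty (D m ≃ₗ[B] ProjMod e m))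
    (hU' : ∀ m ∉ U, ∀ z ∈ U, ∀ d : D m, e z • d = 0) :
    ∃ (n : ℕ) (t : Fin n → Λ) (g : Fin n → idemTrace e U (⊤ : Submodule B M)),
      IsProjBasis e t g := by
  refine h.induction (fun N => ∃ (n : ℕ) (t : Fin n → Λ) (g : Fin n → idemTrace e U N),
    IsProjBasis e t g) ?_ ?_
  · refine ⟨0, Fin.elim0, fun q => q.elim0, fun q => q.elim0, fun y => ⟨0, ?_⟩, fun _ _ q => q.elim0⟩
    obtain ⟨y, hy⟩ := y
    have := idemTrace_le _ hy
    rw [Submodule.mem_bot] at this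
    subst this
    simp
    rfl
  · rintro N₁ N₂ hle m - φ ⟨n, t, g, hg⟩
    -- If m ∈ U, the factor is P_m, and a lift a of its generator splits off: the trace of N₂ is
    -- that of N₁ plus a free summand on e_m a. If m ∉ U, then e_z N₂ ⊆ N₁ for z ∈ U and the trace
    -- does not change.
    by_cases hm : m ∈ U
    · obtain ⟨ψ⟩ := hU m hm
      let f : N₂ →ₗ[B] ProjMod e m := (φ.trans ψ).toLinearMap.comp (Submodule.mkQ _)
      have hf : Function.Surjective f := (φ.trans ψ).surjective.comp (Submodule.mkQ_surjective _)
      have hker : ∀ x : N₂, f x = 0 ↔ (x : M) ∈ N₁ := by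
        intro x
        simp only [f, LinearMap.comp_apply, LinearEquiv.coe_coe, LinearEquiv.map_eq_zero_iff,
          Submodule.mkQ_apply, Submodule.Quotient.mk_eq_zero]
        rfl
      obtain ⟨a, ha⟩ := hf (gen e m)
      have ha' : f (e m • a) = gen e m := by rw [map_smul, ha, he.idem_smul_gen]
      let a' : idemTrace e U N₂ := ⟨e m • a, smul_mem_idemTrace hm a.2⟩
      let i : idemTrace e U N₁ →ₗ[B] idemTrace e U N₂ := Submodule.inclusion (idemTrace_mono hle)
      refine ⟨n + 1, Fin.cons m t, Fin.cons a' fun q => i (g q), ?_, ?_, ?_⟩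
      · intro q
        refine Fin.cases ?_ (fun q => ?_) q
        · simp only [Fin.cons_zero]
          refine Subtype.ext ?_
          change e m • e m • (a : M) = e m • (a : M)
          rw [smul_smul, he.idem]
        · simp only [Fin.cons_succ]
          rw [← map_smul, hg.idem]
      · have key : ∀ y ∈ idemTrace e U N₂, ∃ b : B, y - b • (a' : M) ∈ idemTrace e U N₁ := by
          intro y hy
          refine Submodule.span_induction ?_ ?_ ?_ ?_ hy
          · rintro _ ⟨z, hz, y, hy, rfl⟩
            refine ⟨e z * (f ⟨y, hy⟩ : B), ?_⟩
            rw [mul_smul, ← smul_sub]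
            refine smul_mem_idemTrace hz ?_
            have := (hker (⟨y, hy⟩ - (f ⟨y, hy⟩ : B) • (e m • a))).1 (by
              rw [map_sub, map_smul, ha', he.smul_gen, sub_self])
            exact this
          · exact ⟨0, by simp⟩
          · rintro x y _ _ ⟨b, hb⟩ ⟨c, hc⟩
            refine ⟨b + c, ?_⟩
            have := add_mem hb hc
            rwa [add_smul, add_sub_add_comm]
          · rintro c x _ ⟨b, hb⟩
            refine ⟨c * b, ?_⟩
            rw [mul_smul, ← smul_sub]
            exact Submodule.smul_mem _ _ hb
        rintro ⟨y, hy⟩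
        obtain ⟨b, hb⟩ := key y hy
        obtain ⟨x, hx⟩ := hg.span ⟨_, hb⟩
        refine ⟨Fin.cons b x, ?_⟩
        rw [Fin.sum_univ_succ]
        simp only [Fin.cons_zero, Fin.cons_succ]
        simp only [← map_smul, ← map_sum, hx]
        refine Subtype.ext ?_
        change b • (a' : M) + (y - b • (a' : M)) = y
        abel
      · intro x hx
        rw [Fin.sum_univ_succ] at hx
        simp only [Fin.cons_zero, Fin.cons_succ, ← map_smul, ← map_sum] at hx
        have hx0 : x 0 * e m = 0 := by
          have h1 : x 0 • (a' : M) ∈ N₁ := by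
            have h2 := congrArg Subtype.val hx
            have h3 : x 0 • (a' : M) = -((∑ q, x (Fin.succ q) • g q : idemTrace e U N₁) : M) :=
              eq_neg_of_add_eq_zero_left h2
            rw [h3]
            exact neg_mem (idemTrace_le _ (Subtype.property _))
          have h2 := (hker (x 0 • (e m • a))).2 h1
          rw [map_smul, ha'] at h2
          exact congrArg Subtype.val h2
        have ha0 : x 0 • a' = 0 := by
          refine Subtype.ext ?_
          change x 0 • e m • (a : M) = 0
          rw [smul_smul, hx0, zero_smul]
        intro q
        refine Fin.cases ?_ (fun q => ?_) q
        · exact hx0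
        · rw [ha0, zero_add] at hx
          have hx' := (Submodule.inclusion_injective (idemTrace_mono hle)) (hx.trans (map_zero i).symm)
          exact hg.indep _ hx' q
    · have heq : idemTrace e U N₂ = idemTrace e U N₁ := by
        refine le_antisymm (idemTrace_le_iff.2 fun z hz y hy => ?_) (idemTrace_mono hle)
        have h1 : e z • y ∈ N₁ := by
          have h2 : φ (Submodule.Quotient.mk (e z • ⟨y, hy⟩)) = 0 := by
            rw [Submodule.Quotient.mk_smul, map_smul]
            exact hU' m hm z hz _
          rw [LinearEquiv.map_eq_zero_iff, Submodule.Quotient.mk_eq_zero] at h2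
          exact h2
        have := smul_mem_idemTrace (e := e) hz h1
        rwa [smul_smul, he.idem] at this
      rw [heq]
      exact ⟨n, t, g, hg⟩

theorem smul_standardMod_eq_zero [LinearOrder Λ] {l m : Λ} (h : l < m) (d : StandardMod e l) :
    e m • d = 0 := by
  obtain ⟨x, rfl⟩ := Submodule.Quotient.mk_surjective _ d
  rw [← Submodule.Quotient.mk_smul, Submodule.Quotient.mk_eq_zero, he.standardKer_eq]
  exact idem_mul_mem_idemTrace (U := {m | l < m}) h _

omit he in
/-- There is a linear order refining a given function to `ℕ` that reverses a given height function
on the fibres of that function. -/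
theorem exists_linearOrder (ρ ht : Λ → ℕ) :
    ∃ s : LinearOrder Λ, (∀ z w, ρ z < ρ w → s.lt z w) ∧
      ∀ z w, s.lt z w → ρ z = ρ w → ht w ≤ ht z := by
  let ν := Fintype.equivFin Λ
  -- Lexicographic: first ρ, then reversed height, then an enumeration of Λ to break ties.
  let f : Λ → ℕ ×ₗ (ℕᵒᵈ ×ₗ Fin (Fintype.card Λ)) := fun z =>
    toLex (ρ z, toLex (OrderDual.toDual (ht z), ν z))
  have hf : Function.Injective f := by
    intro a b hab
    have := congrArg (fun p => (ofLex (ofLex p).2).2) hab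
    exact ν.injective this
  have hlt : ∀ z w, (LinearOrder.lift' f hf).lt z w ↔ f z < f w := fun _ _ => Iff.rfl
  refine ⟨LinearOrder.lift' f hf, fun z w h => ?_, fun z w h hzw => ?_⟩
  · rw [hlt, Prod.Lex.toLex_lt_toLex]
    exact Or.inl h
  · rw [hlt, Prod.Lex.toLex_lt_toLex] at h
    rcases h with h | ⟨-, h⟩
    · exact absurd hzw h.ne
    · rw [Prod.Lex.toLex_lt_toLex] at h
      rcases h with h | ⟨h, -⟩
      · exact (OrderDual.toDual_lt_toDual.1 h).le
      · exact (OrderDual.toDual.injective h).ge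

/-- If the regular module is filtered by standard modules for all linear orders, then `J` is
projective. -/
theorem projective_of_forall_hasFiltrationBy
    (h : ∀ _ : LinearOrder Λ, HasFiltrationBy (A := B) B (StandardMod e) Set.univ) :
    Module.Projective B (offDiagIdeal e) := by
  classical
  refine he.projective_of_projective_radAt fun l => ?_
  obtain ⟨ht, hht⟩ := he.exists_height
  -- Here l is least, and above it larger elements have smaller or equal height. So e_z A e_m = 0
  -- for z > m ≠ l, that is, Δ_m = P_m.
  obtain ⟨s, hs, hs'⟩ := exists_linearOrder (fun z => if z = l then 0 else 1) ht
  have hl : ∀ z, z ≠ l → l < z := fun z hz => hs l z (by simp [hz])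
  obtain ⟨n, t, g, hg⟩ := he.exists_isProjBasis_idemTrace (U := {z | z ≠ l}) (h s) (by
    intro m hm
    have hb : standardKer e m = ⊥ := by
      rw [he.standardKer_eq, eq_bot_iff, he.idemTrace_submoduleOf_le_iff]
      intro z hz x
      have hzl : z ≠ l := fun h0 => lt_asymm (hl m hm) (h0 ▸ hz)
      have h0 : e z * (x : B) * e m = 0 := by
        by_contra h0
        exact absurd (hht m z (ne_of_lt hz) x h0) (not_lt.2 (hs' m z hz (by simp [hzl, hm.out])))
      rw [mul_assoc, he.mem_projMod_iff.1 x.2] at h0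
      rw [Submodule.mem_bot]
      exact Subtype.ext h0
    exact ⟨Submodule.quotEquivOfEqBot _ hb⟩) (by
    intro m hm z hz d
    obtain rfl : m = l := not_not.1 hm
    exact he.smul_standardMod_eq_zero (hl z hz) d)
  have := he.projective_of_isProjBasis hg
  have hle : radAt e l ≤ idemTrace e {z | z ≠ l} (⊤ : Submodule B B) := by
    intro x hx
    rw [← he.sum_mul x]
    refine sum_mem fun z _ => ?_
    by_cases hz : z = l
    · subst hz
      rw [← he.mem_projMod_iff.1 hx.2, ← mul_assoc, he.diag_eq_zero_of_mem hx.1]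
      exact zero_mem _
    · exact idem_mul_mem_idemTrace (U := {z | z ≠ l}) hz _
  -- Right multiplication by e_l retracts the trace onto J e_l.
  refine Module.Projective.of_split (Submodule.inclusion hle)
    (((LinearMap.toSpanSingleton B B (e l)).comp (Submodule.subtype _)).codRestrict (radAt e l)
      fun x => ⟨?_, he.mul_idem_mem l _⟩) ?_
  · have : idemTrace e {z | z ≠ l} (⊤ : Submodule B B) ≤
        Submodule.comap (LinearMap.toSpanSingleton B B (e l)) (offDiagIdeal e) :=
      idemTrace_le_iff.2 fun z hz b _ => mem_offDiagIdeal (Ne.symm hz) b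
    exact this x.2
  · ext x
    exact he.mem_projMod_iff.1 x.2.2

/-! ### Standard filtrations -/

/-- As l ∉ U, an element e_z b e_l with z ∈ U lies in J e_l. Multiplying its coefficients by e_z on
the left does not change the sum and moves them into the trace. -/
theorem exists_sum_eq_of_mem_idemTrace {U : Set Λ} {l : Λ} (hl : l ∉ U) {ι : Type*} [Fintype ι]
    {t : ι → Λ} {g : ι → radAt e l} (hg : IsProjBasis e t g) {y : B}
    (hy : y ∈ idemTrace e U (⊤ : Submodule B B)) :
    ∃ x : ι → B, (∀ q, x q ∈ idemTrace e U (⊤ : Submodule B B)) ∧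
      ∑ q, x q * (g q : B) = y * e l := by
  refine Submodule.span_induction ?_ ?_ ?_ ?_ hy
  · rintro _ ⟨z, hz, b, -, rfl⟩
    have hzl : l ≠ z := fun h => hl (h ▸ hz)
    obtain ⟨x, hx⟩ := hg.span ⟨e z * b * e l, mem_offDiagIdeal hzl b, he.mul_idem_mem _ _⟩
    refine ⟨fun q => e z * x q, fun q => smul_mem_idemTrace hz Submodule.mem_top, ?_⟩
    have hx' : ∑ q, x q * (g q : B) = e z * b * e l := by
      have := congrArg Subtype.val hx
      simpa using this
    simp only [mul_assoc, ← Finset.mul_sum, hx', he.idem_assoc, smul_eq_mul]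
  · exact ⟨0, fun _ => zero_mem _, by simp⟩
  · rintro a b _ _ ⟨x, hx, hx'⟩ ⟨y, hy, hy'⟩
    exact ⟨x + y, fun q => add_mem (hx q) (hy q), by
      simp [add_mul, Finset.sum_add_distrib, hx', hy']⟩
  · rintro c b _ ⟨x, hx, hx'⟩
    refine ⟨fun q => c * x q, fun q => Submodule.smul_mem _ _ (hx q), ?_⟩
    simp only [mul_assoc, ← Finset.mul_sum, hx', smul_eq_mul]

/-- The map (x_q) ↦ ∑ x_q g_q identifies the sum of the traces in the P_(t q) with the trace in P_l.
It is injective by freeness and surjective because coefficients can be chosen in the trace. -/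
theorem hasFiltrationBy_idemTrace_step {U : Set Λ} {l : Λ} (hl : l ∉ U)
    {D : Λ → Type*} [∀ m, AddCommGroup (D m)] [∀ m, Module B (D m)] {n : ℕ} {t : Fin n → Λ}
    {g : Fin n → radAt e l} (hg : IsProjBasis e t g)
    (h : ∀ q, HasFiltrationBy (A := B)
      ↥(idemTrace e U (⊤ : Submodule B B) ⊓ ProjMod e (t q)) D U) :
    HasFiltrationBy (A := B) ↥(idemTrace e U (⊤ : Submodule B B) ⊓ ProjMod e l) D U := by
  let f : (∀ q, ↥(idemTrace e U (⊤ : Submodule B B) ⊓ ProjMod e (t q))) →ₗ[B] B :=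
    ∑ q, (LinearMap.toSpanSingleton B B (g q : B)).comp
      ((Submodule.subtype _).comp (LinearMap.proj q))
  have hf : ∀ x, f x = ∑ q, (x q : B) * (g q : B) := fun x => by simp [f]
  refine (HasFiltrationBy.pi h).congr (LinearEquiv.ofBijective (f.codRestrict _ fun x => ?_) ⟨?_, ?_⟩)
  · rw [hf]
    refine sum_mem fun q _ => ⟨mul_mem_idemTrace (x q).2.1 _, ?_⟩
    exact (ProjMod e l).smul_mem _ (g q).2.2
  · rw [injective_iff_map_eq_zero]
    intro x hx
    have hx1 : f x = 0 := congrArg Subtype.val hx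
    rw [hf] at hx1
    have h0 : ∑ q, (x q : B) • g q = 0 := Subtype.ext (by simpa using hx1)
    funext q
    have := hg.indep _ h0 q
    rw [he.mem_projMod_iff.1 (x q).2.2] at this
    exact Subtype.ext this
  · rintro ⟨y, hy, hy'⟩
    obtain ⟨x, hx, hx'⟩ := he.exists_sum_eq_of_mem_idemTrace hl hg hy
    refine ⟨fun q => ⟨x q * e (t q), mul_mem_idemTrace (hx q) _, he.mul_idem_mem _ _⟩, ?_⟩
    refine Subtype.ext ?_
    rw [LinearMap.codRestrict_apply, hf]
    rw [he.mem_projMod_iff.1 hy'] at hx'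
    refine Eq.trans ?_ hx'
    refine Finset.sum_congr rfl fun q _ => ?_
    rw [mul_assoc]
    congr 1
    exact congrArg Subtype.val (hg.idem q)

/-- A basis element g_q is a nonzero element of e_(t q) J e_l. This makes the recursion from l to
the t q well founded. -/
theorem height_lt_of_isProjBasis {ht : Λ → ℕ}
    (hht : ∀ l m : Λ, l ≠ m → ∀ a : B, e m * a * e l ≠ 0 → ht l < ht m) {l : Λ} {ι : Type*} [Fintype ι]
    {t : ι → Λ} {g : ι → radAt e l} (hg : IsProjBasis e t g) (q : ι) : ht l < ht (t q) := by
  classical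
  have h1 : e (t q) * (g q : B) * e l = g q := by
    rw [mul_assoc, he.mem_projMod_iff.1 (g q).2.2]
    exact congrArg Subtype.val (hg.idem q)
  have h2 : (g q : B) ≠ 0 := by
    intro h0
    have h3 := hg.indep (Pi.single q 1) (by
      rw [Finset.sum_eq_single q]
      · simp only [Pi.single_eq_same, one_smul]
        exact Subtype.ext h0
      · intro p _ hp
        simp [Pi.single_eq_of_ne hp]
      · simp) q
    rw [Pi.single_eq_same, one_mul] at h3
    exact he.ne_zero _ h3
  refine hht l (t q) (fun h => h2 ?_) (g q) (by rwa [h1])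
  rw [← h1, ← h]
  exact he.diag_eq_zero_of_mem (g q).2.1 l

/-- If `J` is projective, then all traces in the modules `P_l` have standard filtrations. -/
theorem hasFiltrationBy_idemTrace [LinearOrder Λ] (h : Module.Projective B (offDiagIdeal e))
    (l : Λ) (U : Set Λ) (hU : IsUpperSet U) :
    HasFiltrationBy (A := B) ↥(idemTrace e U (⊤ : Submodule B B) ⊓ ProjMod e l)
      (StandardMod e) U := by
  obtain ⟨ht, hht⟩ := he.exists_height
  have hwf : WellFounded fun a b => ht b < ht a :=
    @Finite.wellFounded_of_trans_of_irrefl Λ _ (fun a b => ht b < ht a)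
      ⟨fun a b c h1 h2 => h2.trans h1⟩ ⟨fun a => lt_irrefl _⟩
  induction l using hwf.induction generalizing U with
  | _ l ih =>
    obtain ⟨n, t, g, hg⟩ := he.exists_isProjBasis_radAt h l
    have hstep : ∀ V : Set Λ, IsUpperSet V → l ∉ V → HasFiltrationBy (A := B)
        ↥(idemTrace e V (⊤ : Submodule B B) ⊓ ProjMod e l) (StandardMod e) V := fun V hV hl =>
      he.hasFiltrationBy_idemTrace_step hl hg fun q =>
        ih _ (he.height_lt_of_isProjBasis hht hg q) V hV
    -- For l ∈ U the trace is all of P_l, an extension of Δ_l by the trace of {m | l < m}, and the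
    -- case l ∉ U covers the latter.
    by_cases hl : l ∈ U
    · have h1 := (hstep {m | l < m} (fun a b hab ha => lt_of_lt_of_le ha hab) (lt_irrefl l)).mono
        fun m (hm : l < m) => hU hm.le hl
      have hP : idemTrace e U (⊤ : Submodule B B) ⊓ ProjMod e l = ProjMod e l := by
        rw [inf_eq_right]
        rw [Submodule.span_le, Set.singleton_subset_iff]
        have := smul_mem_idemTrace (e := e) (M := B) hl (Submodule.mem_top (x := (1 : B)))
        simpa using this
      rw [hP]
      refine HasFiltrationBy.of_submodule (N := standardKer e l) (h1.congr ?_)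
        (HasFiltrationBy.of_equiv hl (LinearEquiv.refl _ _))
      rw [he.standardKer_eq]
      exact ((Submodule.equivMapOfInjective (ProjMod e l).subtype (Submodule.subtype_injective _)
        _).trans (LinearEquiv.ofEq _ _ (by
          rw [Submodule.submoduleOf, Submodule.map_comap_subtype, inf_comm]))).symm
    · exact hstep U hU hl

theorem hasFiltrationBy_standardMod [LinearOrder Λ] (h : Module.Projective B (offDiagIdeal e)) :
    HasFiltrationBy (A := B) B (StandardMod e) Set.univ := by
  refine he.hasFiltrationBy_of_forall_projMod fun l => ?_
  refine (he.hasFiltrationBy_idemTrace h l Set.univ isUpperSet_univ).congr (LinearEquiv.ofEq _ _ ?_)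
  rw [inf_eq_right]
  intro x _
  rw [← he.sum_mul x]
  exact sum_mem fun z _ => smul_mem_idemTrace (Set.mem_univ z) Submodule.mem_top

theorem isStandardlyStratified [LinearOrder Λ] (h : Module.Projective B (offDiagIdeal e)) :
    IsStandardlyStratified e := by
  refine ⟨standardKer e, fun l m hm => ?_, fun l => ?_⟩
  · rw [he.hasCompMult_zero_iff, he.standardKer_eq]
    exact fun x => smul_mem_idemTrace (not_le.1 hm) Submodule.mem_top
  · refine (he.hasFiltrationBy_idemTrace h l {m | l < m}
      fun a b hab ha => lt_of_lt_of_le ha hab).congr ?_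
    rw [he.standardKer_eq]
    exact ((Submodule.equivMapOfInjective (ProjMod e l).subtype (Submodule.subtype_injective _)
      _).trans (LinearEquiv.ofEq _ _ (by
        rw [Submodule.submoduleOf, Submodule.map_comap_subtype, inf_comm]))).symm

theorem forall_isStandardlyStratified_iff :
    (∀ _ : LinearOrder Λ, IsStandardlyStratified e) ↔ Module.Projective B (offDiagIdeal e) :=
  ⟨fun h => he.projective_of_forall_hasFiltrationBy fun s =>
    he.hasFiltrationBy_of_isStandardlyStratified (h s), fun h _ => he.isStandardlyStratified h⟩

end

end SplitDirected

/-! ### Bases of `J / J ^ 2` -/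

/-- The elements `a q` of `J` give a basis of `J ^ (i + 1) / J ^ (i + 2)` over
`J ^ i / J ^ (i + 1)` for all `i`. -/
structure IsGradedBasis {B : Type v} [Ring B] {Λ : Type w} (e : Λ → B) {n : ℕ} (t : Fin n → Λ)
    (a : Fin n → B) : Prop where
  mem : ∀ q, a q ∈ offDiagIdeal e
  idem : ∀ q, e (t q) * a q = a q
  span : ∀ y ∈ offDiagIdeal e, ∃ x : Fin n → B, y - ∑ q, x q * a q ∈ offDiagIdeal e ^ 2
  indep : ∀ (i : ℕ) (x : Fin n → B), (∀ q, x q ∈ offDiagIdeal e ^ i) →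
    ∑ q, x q * a q ∈ offDiagIdeal e ^ (i + 2) → ∀ q, x q * e (t q) ∈ offDiagIdeal e ^ (i + 1)

/-- The existence of a graded basis. -/
def HasGradedBasis {B : Type v} [Ring B] {Λ : Type w} (e : Λ → B) : Prop :=
  ∃ (n : ℕ) (t : Fin n → Λ) (a : Fin n → B), IsGradedBasis e t a

/-- The elements `b q` of `J` give a basis of the right module `J / J ^ 2`. -/
structure IsRightBasis {B : Type v} [Ring B] {Λ : Type w} (e : Λ → B) {n : ℕ} (t : Fin n → Λ)
    (b : Fin n → B) : Prop where
  mem : ∀ q, b q ∈ offDiagIdeal e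
  idem : ∀ q, b q * e (t q) = b q
  span : ∀ y ∈ offDiagIdeal e, ∃ x : Fin n → B, y - ∑ q, b q * x q ∈ offDiagIdeal e ^ 2
  indep : ∀ x : Fin n → B, ∑ q, b q * x q ∈ offDiagIdeal e ^ 2 →
    ∀ q, e (t q) * x q ∈ offDiagIdeal e

/-- The existence of a basis of the right module `J / J ^ 2`. -/
def HasRightBasis {B : Type v} [Ring B] {Λ : Type w} (e : Λ → B) : Prop :=
  ∃ (n : ℕ) (t : Fin n → Λ) (b : Fin n → B), IsRightBasis e t b

section Pow

variable {B : Type v} [Ring B] {I : Ideal B} [I.IsTwoSided]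

theorem mul_mem_pow_add_one {i : ℕ} {x y : B} (hx : x ∈ I ^ i) (hy : y ∈ I) :
    x * y ∈ I ^ (i + 1) := by
  rw [Submodule.pow_succ]
  exact Ideal.mul_mem_mul hx hy

theorem pow_mul_mem_of_mem {i : ℕ} {x : B} (hx : x ∈ I ^ i) (y : B) : x * y ∈ I ^ i :=
  Ideal.mul_mem_right _ _ hx

theorem mem_pow_one_iff {x : B} : x ∈ I ^ 1 ↔ x ∈ I := by
  rw [Submodule.pow_one]

theorem pow_succ_le (i : ℕ) : I ^ (i + 1) ≤ I ^ i := Ideal.pow_le_pow_right (Nat.le_succ i)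

/-- Elements of `I ^ (i + 1)` are combinations of left generators of `I` with coefficients in
`I ^ i`. -/
theorem exists_sum_of_mem_pow_succ {ι : Type*} [Fintype ι] {a : ι → B}
    (ha : ∀ y ∈ I, ∃ x : ι → B, ∑ q, x q * a q = y) {i : ℕ} {y : B} (hy : y ∈ I ^ (i + 1)) :
    ∃ x : ι → B, (∀ q, x q ∈ I ^ i) ∧ ∑ q, x q * a q = y := by
  rw [Submodule.pow_succ] at hy
  refine Submodule.mul_induction_on hy ?_ ?_
  · intro u hu v hv
    obtain ⟨x, rfl⟩ := ha v hv
    exact ⟨fun q => u * x q, fun q => pow_mul_mem_of_mem hu _, by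
      simp only [mul_assoc, Finset.mul_sum]⟩
  · rintro _ _ ⟨x, hx, rfl⟩ ⟨y, hy, rfl⟩
    exact ⟨x + y, fun q => add_mem (hx q) (hy q), by simp [add_mul, Finset.sum_add_distrib]⟩

/-- Left generators of `I` modulo `I ^ 2` generate `I` if `I` is nilpotent. -/
theorem exists_sum_of_span_sq {ι : Type*} [Fintype ι] {a : ι → B}
    (ha : ∀ y ∈ I, ∃ x : ι → B, y - ∑ q, x q * a q ∈ I ^ 2) (hI : ∃ n, I ^ n = ⊥) :
    ∀ y ∈ I, ∃ x : ι → B, ∑ q, x q * a q = y := by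
  have key : ∀ i : ℕ, ∀ y ∈ I ^ (i + 1), ∃ x : ι → B, y - ∑ q, x q * a q ∈ I ^ (i + 2) := by
    intro i y hy
    rw [Submodule.pow_succ] at hy
    refine Submodule.mul_induction_on hy ?_ ?_
    · intro u hu v hv
      obtain ⟨x, hx⟩ := ha v hv
      refine ⟨fun q => u * x q, ?_⟩
      have := GrPiece.mul_mem hu hx
      simpa only [mul_assoc, Finset.mul_sum, mul_sub] using this
    · rintro y z ⟨x, hx⟩ ⟨x', hx'⟩
      refine ⟨x + x', ?_⟩
      have := add_mem hx hx'
      simp only [Pi.add_apply, add_mul, Finset.sum_add_distrib]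
      rwa [add_sub_add_comm]
  -- Successive approximation: each correction moves the error one power deeper, until nilpotency
  -- removes it.
  have key2 : ∀ i : ℕ, ∀ y ∈ I, ∃ x : ι → B, y - ∑ q, x q * a q ∈ I ^ (i + 1) := by
    intro i
    induction i with
    | zero => intro y hy; exact ⟨0, by simpa [Submodule.pow_one] using hy⟩
    | succ i ih =>
      intro y hy
      obtain ⟨x, hx⟩ := ih y hy
      obtain ⟨x', hx'⟩ := key i _ hx
      refine ⟨x + x', ?_⟩
      simp only [Pi.add_apply, add_mul, Finset.sum_add_distrib]
      rwa [sub_sub] at hx'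
  intro y hy
  obtain ⟨n, hn⟩ := hI
  obtain ⟨x, hx⟩ := key2 n y hy
  refine ⟨x, ?_⟩
  have := pow_succ_le n hx
  rw [hn, Submodule.mem_bot, sub_eq_zero] at this
  exact this.symm

end Pow

namespace SplitDirected

variable {k : Type u} [Field k] {B : Type v} [Ring B] [Algebra k B]
  {Λ : Type w} [Fintype Λ] {e : Λ → B}

section
variable (he : SplitDirected k e) [Module.Finite k B]
include he

/-- A basis of J itself works: an element of J^(i+2) also has coefficients in J^(i+1), and
coefficients are unique after multiplication by e_(t q). -/
theorem hasGradedBasis_of_projective (h : Module.Projective B (offDiagIdeal e)) :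
    HasGradedBasis e := by
  have : IsNoetherian B B := isNoetherian_of_tower k inferInstance
  obtain ⟨n, t, g, hg⟩ := he.exists_isProjBasis (offDiagIdeal e)
  have hspan : ∀ y ∈ offDiagIdeal e, ∃ x : Fin n → B, ∑ q, x q * (g q : B) = y := by
    intro y hy
    obtain ⟨x, hx⟩ := hg.span ⟨y, hy⟩
    exact ⟨x, by simpa using congrArg Subtype.val hx⟩
  refine ⟨n, t, fun q => g q, fun q => (g q).2, fun q => congrArg Subtype.val (hg.idem q), ?_, ?_⟩
  · intro y hy
    obtain ⟨x, hx⟩ := hspan y hy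
    exact ⟨x, by rw [hx, sub_self]; exact zero_mem _⟩
  · intro i x _ hsum q
    obtain ⟨y, hy, hyx⟩ := exists_sum_of_mem_pow_succ hspan (i := i + 1) hsum
    have h0 : ∑ q, (x q - y q) • g q = 0 := Subtype.ext (by
      simpa [sub_mul, Finset.sum_sub_distrib, sub_eq_zero] using hyx.symm)
    have := hg.indep _ h0 q
    rw [sub_mul, sub_eq_zero] at this
    rw [this]
    exact pow_mul_mem_of_mem (hy q) _

/-- Generation is Nakayama's lemma. The value 0 of a relation lies in all powers of J, so `indep`
pushes the coefficients through all powers of J down to 0. -/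
theorem projective_of_hasGradedBasis (h : HasGradedBasis e) :
    Module.Projective B (offDiagIdeal e) := by
  obtain ⟨n, t, a, ha⟩ := h
  refine he.projective_of_isProjBasis (t := t) (g := fun q => ⟨a q, ha.mem q⟩) ⟨?_, ?_, ?_⟩
  · exact fun q => Subtype.ext (ha.idem q)
  · rintro ⟨y, hy⟩
    obtain ⟨x, hx⟩ := exists_sum_of_span_sq ha.span he.isNilpotent_offDiagIdeal y hy
    exact ⟨x, Subtype.ext (by simpa using hx)⟩
  · intro x hx q
    have h0 : ∑ q, x q * e (t q) * a q = 0 := by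
      have := congrArg Subtype.val hx
      simp only [mul_assoc, ha.idem]
      simpa using this
    have key : ∀ i : ℕ, ∀ q, x q * e (t q) ∈ offDiagIdeal e ^ i := by
      intro i
      induction i with
      | zero => exact fun q => GrPiece.mem_pow_zero _
      | succ i ih =>
        intro q
        have := ha.indep i _ ih (by rw [h0]; exact zero_mem _) q
        rwa [he.mul_idem_assoc] at this
    obtain ⟨i, hi⟩ := he.isNilpotent_offDiagIdeal
    have := key i q
    rwa [hi, Submodule.mem_bot] at this

theorem projective_iff_hasGradedBasis :
    Module.Projective B (offDiagIdeal e) ↔ HasGradedBasis e :=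
  ⟨he.hasGradedBasis_of_projective, he.projective_of_hasGradedBasis⟩

end

end SplitDirected

/-! ### The associated graded algebra -/

section Symbol

variable {B : Type v} [Ring B] (I : Ideal B)

/-- The class of `x ∈ I ^ i` in degree `i` of the associated graded algebra. -/
def grSymb (i : ℕ) (x : B) (hx : x ∈ I ^ i) : AssocGr I :=
  DirectSum.of (GrPiece I) i (GrPiece.mk I i x hx)

variable {I}

theorem grSymb_congr {i j : ℕ} {x y : B} (hx : x ∈ I ^ i) (hy : y ∈ I ^ j) (hij : i = j)
    (hxy : x = y) : grSymb I i x hx = grSymb I j y hy := by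
  subst hij hxy
  rfl

theorem grSymb_add {i : ℕ} {x y : B} (hx : x ∈ I ^ i) (hy : y ∈ I ^ i) :
    grSymb I i (x + y) (add_mem hx hy) = grSymb I i x hx + grSymb I i y hy := by
  rw [grSymb, GrPiece.mk_add, map_add]
  rfl

theorem grSymb_eq_zero_iff {i : ℕ} {x : B} (hx : x ∈ I ^ i) :
    grSymb I i x hx = 0 ↔ x ∈ I ^ (i + 1) := by
  rw [grSymb, ← map_zero (DirectSum.of (GrPiece I) i), (DirectSum.of_injective i).eq_iff,
    ← GrPiece.mk_zero, GrPiece.mk_eq_mk, sub_zero]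

theorem grSymb_sub {i : ℕ} {x y : B} (hx : x ∈ I ^ i) (hy : y ∈ I ^ i) :
    grSymb I i (x - y) (sub_mem hx hy) = grSymb I i x hx - grSymb I i y hy := by
  rw [eq_sub_iff_add_eq, ← grSymb_add]
  exact grSymb_congr _ _ rfl (sub_add_cancel x y)

theorem grSymb_sum {ι : Type*} (s : Finset ι) {i : ℕ} {x : ι → B} (hx : ∀ q, x q ∈ I ^ i) :
    grSymb I i (∑ q ∈ s, x q) (sum_mem fun q _ => hx q) = ∑ q ∈ s, grSymb I i (x q) (hx q) := by
  classical
  induction s using Finset.induction_on with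
  | empty => simp only [Finset.sum_empty, grSymb_eq_zero_iff]; exact zero_mem _
  | insert a s ha ih =>
    refine (grSymb_congr _ (add_mem (hx a) (sum_mem fun q _ => hx q)) rfl
      (Finset.sum_insert ha)).trans ?_
    rw [Finset.sum_insert ha, ← ih, ← grSymb_add]

variable [I.IsTwoSided]

theorem grSymb_mul {i j : ℕ} {x y : B} (hx : x ∈ I ^ i) (hy : y ∈ I ^ j) :
    grSymb I i x hx * grSymb I j y hy = grSymb I (i + j) (x * y) (GrPiece.mul_mem hx hy) := by
  rw [grSymb, grSymb, DirectSum.of_mul_of]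
  rfl

theorem ofAlg_apply {k : Type u} [CommRing k] [Algebra k B] (x : B) :
    AssocGr.ofAlg I k x = grSymb I 0 x (GrPiece.mem_pow_zero x) := rfl

theorem ofAlg_mul_grSymb {k : Type u} [CommRing k] [Algebra k B] (a : B) {i : ℕ} {x : B}
    (hx : x ∈ I ^ i) :
    AssocGr.ofAlg I k a * grSymb I i x hx = grSymb I i (a * x) (Ideal.mul_mem_left _ a hx) := by
  rw [ofAlg_apply, grSymb_mul]
  exact grSymb_congr _ _ (Nat.zero_add i) rfl

theorem grSymb_mul_ofAlg {k : Type u} [CommRing k] [Algebra k B] (a : B) {i : ℕ} {x : B}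
    (hx : x ∈ I ^ i) :
    grSymb I i x hx * AssocGr.ofAlg I k a = grSymb I i (x * a) (Ideal.mul_mem_right a _ hx) := by
  rw [ofAlg_apply, grSymb_mul]
  exact grSymb_congr _ _ (Nat.add_zero i) rfl

theorem assocGr_induction {P : AssocGr I → Prop} (h0 : P 0)
    (hs : ∀ i x hx, P (grSymb I i x hx)) (ha : ∀ x y, P x → P y → P (x + y)) (x : AssocGr I) :
    P x := by
  induction x using DirectSum.induction_on with
  | zero => exact h0
  | of i x =>
    induction x using GrPiece.ind with
    | _ x hx => exact hs i x hx
  | add x y hx hy => exact ha x y hx hy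

theorem finite_assocGr {k : Type u} [Field k] [Algebra k B] [Module.Finite k B]
    (hI : ∃ n, I ^ n = ⊥) : Module.Finite k (AssocGr I) := by
  obtain ⟨n, hn⟩ := hI
  have hfin : ∀ i : ℕ, Module.Finite k ↥(I ^ i) := fun i =>
    inferInstanceAs (Module.Finite k ((I ^ i).restrictScalars k))
  let f : (∀ i : Fin n, ↥(I ^ (i : ℕ))) →ₗ[k] AssocGr I :=
    { toFun := fun x => ∑ i : Fin n, grSymb I i (x i) (x i).2
      map_add' := fun x y => by
        rw [← Finset.sum_add_distrib]
        exact Finset.sum_congr rfl fun i _ => grSymb_add _ _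
      map_smul' := fun c x => by
        rw [RingHom.id_apply, Finset.smul_sum]
        refine Finset.sum_congr rfl fun i _ => ?_
        rw [Algebra.smul_def, ← AlgHom.commutes (AssocGr.ofAlg I k), ofAlg_mul_grSymb]
        exact grSymb_congr _ _ rfl (Algebra.smul_def c _) }
  refine Module.Finite.of_surjective f fun x => ?_
  classical
  induction x using assocGr_induction with
  | h0 => exact ⟨0, map_zero f⟩
  | hs i x hx =>
    by_cases hi : i < n
    · refine ⟨Pi.single ⟨i, hi⟩ ⟨x, hx⟩, ?_⟩
      change ∑ j : Fin n, grSymb I j _ _ = _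
      rw [Finset.sum_eq_single ⟨i, hi⟩]
      · exact grSymb_congr _ _ rfl (by simp)
      · intro j _ hj
        rw [grSymb_eq_zero_iff, Pi.single_eq_of_ne hj]
        exact zero_mem _
      · simp
    · refine ⟨0, ?_⟩
      rw [map_zero]
      symm
      rw [grSymb_eq_zero_iff]
      have h1 := Ideal.pow_le_pow_right (not_lt.1 hi) hx
      rw [hn, Submodule.mem_bot] at h1
      rw [h1]
      exact zero_mem _
  | ha x y hx hy =>
    obtain ⟨a, rfl⟩ := hx
    obtain ⟨b, rfl⟩ := hy
    exact ⟨a + b, map_add f a b⟩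

end Symbol

namespace SplitDirected

variable {k : Type u} [Field k] {B : Type v} [Ring B] [Algebra k B]
  {Λ : Type w} [Fintype Λ] {e : Λ → B}

section
variable (he : SplitDirected k e)
include he

theorem grIdem_mul_grSymb_mul (l m : Λ) {i : ℕ} {x : B} (hx : x ∈ offDiagIdeal e ^ i) :
    grIdem k e m * grSymb _ i x hx * grIdem k e l =
      grSymb _ i (e m * x * e l) (Ideal.mul_mem_right _ _ (Ideal.mul_mem_left _ _ hx)) := by
  rw [grIdem, grIdem, ofAlg_mul_grSymb, grSymb_mul_ofAlg]

theorem mem_of_mem_pow_succ {i : ℕ} {x : B} (hx : x ∈ offDiagIdeal e ^ (i + 1)) :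
    x ∈ offDiagIdeal e := by
  have := Ideal.pow_le_pow_right (Nat.le_add_left 1 i) hx
  rwa [Submodule.pow_one] at this

/-- Only degree 0 contributes to the corners of gr A, because elements of J have zero diagonal. So
gr A inherits the splitting of the corners of A. -/
theorem exists_corner_eq (l : Λ) (x : AssocGr (offDiagIdeal e)) :
    ∃ b : B, grIdem k e l * x * grIdem k e l = AssocGr.ofAlg (offDiagIdeal e) k (e l * b * e l) := by
  induction x using assocGr_induction with
  | h0 => exact ⟨0, by simp⟩
  | hs i x hx =>
    cases i with
    | zero =>
      refine ⟨x, ?_⟩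
      rw [he.grIdem_mul_grSymb_mul]
      rfl
    | succ i =>
      refine ⟨0, ?_⟩
      rw [he.grIdem_mul_grSymb_mul, mul_zero, zero_mul, map_zero, grSymb_eq_zero_iff,
        he.diag_eq_zero_of_mem (he.mem_of_mem_pow_succ hx)]
      exact zero_mem _
  | ha x y hx hy =>
    obtain ⟨b, hb⟩ := hx
    obtain ⟨c, hc⟩ := hy
    exact ⟨b + c, by rw [mul_add, add_mul, hb, hc, ← map_add, mul_add, add_mul]⟩

/-- The associated graded algebra is again split directed. -/
theorem assocGr : SplitDirected k (grIdem k e) where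
  orth := he.orth.map (AssocGr.ofAlg (offDiagIdeal e) k).toRingHom
  ne_zero l h := by
    rw [grIdem, ofAlg_apply, grSymb_eq_zero_iff, zero_add, Submodule.pow_one] at h
    have := he.diag_eq_zero_of_mem h l
    rw [he.idem, he.idem] at this
    exact he.ne_zero l this
  split l x := by
    obtain ⟨b, hb⟩ := he.exists_corner_eq l x
    obtain ⟨c, hc⟩ := he.split l b
    refine ⟨c, ?_⟩
    rw [hb, grIdem, ← map_smul, ← map_sub]
    exact hc.map _
  dir := by
    obtain ⟨r, hr⟩ := he.dir
    refine ⟨r, fun l m ⟨x, hx⟩ => hr l m ?_⟩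
    by_contra h
    push Not at h
    refine hx ?_
    clear hx
    induction x using assocGr_induction with
    | h0 => simp
    | hs i x hx =>
      rw [he.grIdem_mul_grSymb_mul, grSymb_eq_zero_iff, h]
      exact zero_mem _
    | ha x y hx hy => rw [mul_add, add_mul, hx, hy, add_zero]

theorem grSymb_mem {i : ℕ} {x : B} (hx : x ∈ offDiagIdeal e ^ i) :
    grSymb _ i x hx ∈ offDiagIdeal (grIdem k e) ^ i := by
  induction i generalizing x with
  | zero => exact GrPiece.mem_pow_zero _
  | succ i ih =>
    have key : ∀ y (hy : y ∈ offDiagIdeal e),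
        grSymb (offDiagIdeal e) 1 y (mem_pow_one_iff.2 hy) ∈ offDiagIdeal (grIdem k e) := by
      intro y hy
      rw [he.assocGr.mem_offDiagIdeal_iff_diag]
      intro l
      rw [he.grIdem_mul_grSymb_mul, grSymb_eq_zero_iff, he.diag_eq_zero_of_mem hy]
      exact zero_mem _
    have hx' := hx
    rw [Submodule.pow_succ] at hx'
    -- The symbol depends on a membership proof, so the induction over products has to carry that
    -- proof along.
    suffices H : ∃ h : x ∈ offDiagIdeal e ^ (i + 1),
        grSymb _ (i + 1) x h ∈ offDiagIdeal (grIdem k e) ^ (i + 1) from H.2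
    refine Submodule.mul_induction_on hx' ?_ ?_
    · intro u hu v hv
      refine ⟨mul_mem_pow_add_one hu hv, ?_⟩
      rw [← grSymb_mul hu (mem_pow_one_iff.2 hv)]
      exact mul_mem_pow_add_one (ih hu) (key v hv)
    · rintro u v ⟨hu, hu'⟩ ⟨hv, hv'⟩
      refine ⟨add_mem hu hv, ?_⟩
      rw [grSymb_add hu hv]
      exact add_mem hu' hv'

omit he in
theorem apply_grSymb_of_ne {i j : ℕ} (hij : i ≠ j) {x : B} (hx : x ∈ offDiagIdeal e ^ i) :
    (grSymb _ i x hx) j = 0 := DirectSum.of_eq_of_ne _ _ _ hij.symm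

theorem grSymb_apply_self {i : ℕ} {x : B} (hx : x ∈ offDiagIdeal e ^ i) :
    (grSymb _ i x hx) i = GrPiece.mk _ i x hx := DirectSum.of_eq_same _ _

/-- The elements of degree at least `i`. -/
def degreeGE (e : Λ → B) (i : ℕ) : AddSubgroup (AssocGr (offDiagIdeal e)) where
  carrier := {x | ∀ j < i, x j = 0}
  zero_mem' := fun j _ => rfl
  add_mem' := fun {x y} hx hy j hj => by
    change x j + y j = 0
    rw [hx j hj, hy j hj, add_zero]
  neg_mem' := fun {x} hx j hj => by
    change -x j = 0
    rw [hx j hj, neg_zero]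

omit he in
theorem grSymb_mem_degreeGE {i j : ℕ} (hij : j ≤ i) {x : B} (hx : x ∈ offDiagIdeal e ^ i) :
    grSymb _ i x hx ∈ degreeGE e j :=
  fun p hp => apply_grSymb_of_ne (by omega) hx

omit he in
theorem exists_grSymb_sub_mem_degreeGE {i : ℕ} {x : AssocGr (offDiagIdeal e)}
    (hx : x ∈ degreeGE e i) :
    ∃ y, ∃ hy : y ∈ offDiagIdeal e ^ i, x - grSymb _ i y hy ∈ degreeGE e (i + 1) := by
  obtain ⟨y, hy, hyx⟩ : ∃ y, ∃ hy : y ∈ offDiagIdeal e ^ i, GrPiece.mk _ i y hy = x i := by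
    generalize x i = z
    induction z using GrPiece.ind with
    | _ y hy => exact ⟨y, hy, rfl⟩
  refine ⟨y, hy, fun j hj => ?_⟩
  change x j - (grSymb _ i y hy) j = 0
  rcases Nat.lt_succ_iff_lt_or_eq.1 hj with h | rfl
  · rw [hx j h, apply_grSymb_of_ne h.ne', sub_zero]
  · rw [← hyx, sub_eq_zero]
    exact (DirectSum.of_eq_same _ _).symm

omit he in
theorem degreeGE_induction {i : ℕ} {P : AssocGr (offDiagIdeal e) → Prop} (h0 : P 0)
    (hs : ∀ j, i ≤ j → ∀ x hx, P (grSymb _ j x hx)) (ha : ∀ x y, P x → P y → P (x + y))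
    {x : AssocGr (offDiagIdeal e)} (hx : x ∈ degreeGE e i) : P x := by
  classical
  rw [← DirectSum.sum_support_of x]
  refine Finset.sum_induction _ P ha h0 fun j hj => ?_
  have hij : i ≤ j := by
    by_contra h
    exact (DFinsupp.mem_support_iff.1 hj) (hx j (not_le.1 h))
  generalize x j = z
  induction z using GrPiece.ind with
  | _ y hy => exact hs j hij y hy

theorem mul_mem_degreeGE {i j : ℕ} {x y : AssocGr (offDiagIdeal e)} (hx : x ∈ degreeGE e i)
    (hy : y ∈ degreeGE e j) : x * y ∈ degreeGE e (i + j) := by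
  refine degreeGE_induction (P := fun x => x * y ∈ degreeGE e (i + j)) ?_ (fun p hp u hu => ?_)
    (fun a b ha hb => ?_) hx
  · rw [zero_mul]; exact zero_mem _
  · refine degreeGE_induction (P := fun y => grSymb _ p u hu * y ∈ degreeGE e (i + j)) ?_
      (fun q hq v hv => ?_) (fun a b ha hb => ?_) hy
    · rw [mul_zero]; exact zero_mem _
    · rw [grSymb_mul]
      exact grSymb_mem_degreeGE (by omega) _
    · rw [mul_add]; exact add_mem ha hb
  · rw [add_mul]; exact add_mem ha hb

/-- The off-diagonal ideal of gr A is the part of positive degree, and gr A is generated in degrees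
0 and 1. Hence the symbol of an element of A determines its position in the filtration of gr A as
well. -/
theorem mem_pow_iff_mem_degreeGE {i : ℕ} {x : AssocGr (offDiagIdeal e)} :
    x ∈ offDiagIdeal (grIdem k e) ^ i ↔ x ∈ degreeGE e i := by
  constructor
  · have h1 : ∀ x ∈ offDiagIdeal (grIdem k e), x ∈ degreeGE e 1 := by
      intro x hx j hj
      obtain rfl : j = 0 := by omega
      obtain ⟨y, hy, hyx⟩ : ∃ y, ∃ hy : y ∈ offDiagIdeal e ^ 0, GrPiece.mk _ 0 y hy = x 0 := by
        generalize x 0 = z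
        induction z using GrPiece.ind with
        | _ y hy => exact ⟨y, hy, rfl⟩
      have hdiff : x - grSymb _ 0 y hy ∈ degreeGE e 1 := by
        intro j hj
        obtain rfl : j = 0 := by omega
        change x 0 - (grSymb _ 0 y hy) 0 = 0
        rw [he.grSymb_apply_self, hyx, sub_self]
      have hy1 : y ∈ offDiagIdeal e := by
        rw [he.mem_offDiagIdeal_iff_diag]
        intro l
        have h2 : grIdem k e l * (x - grSymb _ 0 y hy) * grIdem k e l ∈ degreeGE e 1 := by
          have := he.mul_mem_degreeGE (he.mul_mem_degreeGE (i := 0) (j := 1)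
            (x := grIdem k e l) (fun j hj => absurd hj (Nat.not_lt_zero j)) hdiff) (j := 0)
            (y := grIdem k e l) (fun j hj => absurd hj (Nat.not_lt_zero j))
          exact this
        rw [mul_sub, sub_mul, he.assocGr.diag_eq_zero_of_mem hx, he.grIdem_mul_grSymb_mul,
          zero_sub, neg_mem_iff] at h2
        have h3 := h2 0 Nat.zero_lt_one
        rw [he.grSymb_apply_self, ← GrPiece.mk_zero, GrPiece.mk_eq_mk, sub_zero, zero_add,
          Submodule.pow_one] at h3
        have := he.diag_eq_zero_of_mem h3 l
        simpa only [mul_assoc, he.idem, he.idem_assoc] using this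
      rw [← hyx, ← GrPiece.mk_zero, GrPiece.mk_eq_mk, sub_zero, zero_add, Submodule.pow_one]
      exact hy1
    intro hx
    induction i generalizing x with
    | zero => exact fun j hj => absurd hj (Nat.not_lt_zero j)
    | succ i ih =>
      rw [Submodule.pow_succ] at hx
      refine Submodule.mul_induction_on hx ?_ ?_
      · intro u hu v hv
        exact he.mul_mem_degreeGE (ih hu) (h1 v hv)
      · intro u v hu hv
        exact add_mem hu hv
  · intro hx
    refine degreeGE_induction (zero_mem _) (fun j hj y hy => ?_) (fun a b ha hb => add_mem ha hb) hx
    exact Ideal.pow_le_pow_right hj (he.grSymb_mem hy)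

theorem grSymb_mem_pow_succ_iff {i : ℕ} {x : B} (hx : x ∈ offDiagIdeal e ^ i) :
    grSymb _ i x hx ∈ offDiagIdeal (grIdem k e) ^ (i + 1) ↔ x ∈ offDiagIdeal e ^ (i + 1) := by
  rw [he.mem_pow_iff_mem_degreeGE]
  constructor
  · intro h
    have := h i (Nat.lt_succ_self i)
    rwa [he.grSymb_apply_self, ← GrPiece.mk_zero, GrPiece.mk_eq_mk, sub_zero] at this
  · intro h
    rw [(grSymb_eq_zero_iff hx).2 h]
    exact zero_mem _

theorem exists_grSymb_sub_mem {i : ℕ} {x : AssocGr (offDiagIdeal e)}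
    (hx : x ∈ offDiagIdeal (grIdem k e) ^ i) :
    ∃ y, ∃ hy : y ∈ offDiagIdeal e ^ i,
      x - grSymb _ i y hy ∈ offDiagIdeal (grIdem k e) ^ (i + 1) := by
  simp only [he.mem_pow_iff_mem_degreeGE] at hx ⊢
  exact exists_grSymb_sub_mem_degreeGE hx

/-- Leading terms multiply: an error of degree i + 1 in x times a factor of degree 1, and a factor
of degree i times an error of degree 2 in α, both have degree i + 2. -/
theorem sum_mul_sub_grSymb_mem {n i : ℕ} {x α : Fin n → AssocGr (offDiagIdeal e)} {y a : Fin n → B}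
    (hx : ∀ q, x q ∈ offDiagIdeal (grIdem k e) ^ i) (hy : ∀ q, y q ∈ offDiagIdeal e ^ i)
    (hxy : ∀ q, x q - grSymb _ i (y q) (hy q) ∈ offDiagIdeal (grIdem k e) ^ (i + 1))
    (ha : ∀ q, a q ∈ offDiagIdeal e ^ 1)
    (hα : ∀ q, α q - grSymb _ 1 (a q) (ha q) ∈ offDiagIdeal (grIdem k e) ^ 2) :
    ∑ q, x q * α q - grSymb _ (i + 1) (∑ q, y q * a q)
      (sum_mem fun q _ => GrPiece.mul_mem (hy q) (ha q)) ∈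
      offDiagIdeal (grIdem k e) ^ (i + 2) := by
  rw [grSymb_sum Finset.univ fun q => GrPiece.mul_mem (hy q) (ha q), ← Finset.sum_sub_distrib]
  refine sum_mem fun q _ => ?_
  rw [← grSymb_mul (hy q) (ha q)]
  have h1 := GrPiece.mul_mem (hx q) (hα q)
  have h2 := GrPiece.mul_mem (hxy q) (he.grSymb_mem (ha q))
  rw [add_assoc] at h2
  have := add_mem h1 h2
  convert this using 1
  noncomm_ring

theorem sum_mul_sub_grSymb_mem' {n : ℕ} {x α : Fin n → AssocGr (offDiagIdeal e)} {y a : Fin n → B}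
    (hy : ∀ q, y q ∈ offDiagIdeal e ^ 0)
    (hxy : ∀ q, x q - grSymb _ 0 (y q) (hy q) ∈ offDiagIdeal (grIdem k e) ^ 1)
    (ha : ∀ q, a q ∈ offDiagIdeal e ^ 1)
    (hα : ∀ q, α q - grSymb _ 1 (a q) (ha q) ∈ offDiagIdeal (grIdem k e) ^ 2) :
    ∑ q, α q * x q - grSymb _ 1 (∑ q, a q * y q)
      (sum_mem fun q _ => Ideal.mul_mem_right _ _ (ha q)) ∈
      offDiagIdeal (grIdem k e) ^ 2 := by
  have hq : ∀ q, a q * y q ∈ offDiagIdeal e ^ 1 := fun q => Ideal.mul_mem_right _ _ (ha q)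
  rw [grSymb_sum Finset.univ hq, ← Finset.sum_sub_distrib]
  refine sum_mem fun q _ => ?_
  have h0 : grSymb _ 1 (a q * y q) (hq q) = grSymb _ 1 (a q) (ha q) * grSymb _ 0 (y q) (hy q) := by
    rw [grSymb_mul]
  rw [h0]
  have h1 := Ideal.mul_mem_right (x q) _ (hα q)
  have h2 := mul_mem_pow_add_one (he.grSymb_mem (ha q)) (mem_pow_one_iff.1 (hxy q))
  have := add_mem h1 h2
  convert this using 1
  noncomm_ring

theorem exists_degree_one_lift {α : AssocGr (offDiagIdeal e)} (hα : α ∈ offDiagIdeal (grIdem k e)) :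
    ∃ a, ∃ ha : a ∈ offDiagIdeal e ^ 1,
      α - grSymb _ 1 a ha ∈ offDiagIdeal (grIdem k e) ^ 2 :=
  he.exists_grSymb_sub_mem (mem_pow_one_iff.2 hα)

theorem exists_degree_zero_lift (x : AssocGr (offDiagIdeal e)) :
    ∃ y, ∃ hy : y ∈ offDiagIdeal e ^ 0,
      x - grSymb _ 0 y hy ∈ offDiagIdeal (grIdem k e) ^ 1 :=
  he.exists_grSymb_sub_mem (GrPiece.mem_pow_zero x)

theorem mem_sq_of_grSymb_sub_mem {y z : B} (hy : y ∈ offDiagIdeal e ^ 1)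
    (hz : z ∈ offDiagIdeal e ^ 1)
    (h : grSymb _ 1 y hy - grSymb _ 1 z hz ∈ offDiagIdeal (grIdem k e) ^ 2) :
    y - z ∈ offDiagIdeal e ^ 2 := by
  rw [← grSymb_sub] at h
  exact (he.grSymb_mem_pow_succ_iff _).1 h

theorem grSymb_sub_mem_sq {y z : B} (hy : y ∈ offDiagIdeal e ^ 1)
    (hz : z ∈ offDiagIdeal e ^ 1) (h : y - z ∈ offDiagIdeal e ^ 2) :
    grSymb _ 1 y hy - grSymb _ 1 z hz ∈ offDiagIdeal (grIdem k e) ^ 2 := by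
  rw [← grSymb_sub]
  exact (he.grSymb_mem_pow_succ_iff _).2 h

/-! ### Transfer of left and right bases between A and gr A -/

theorem hasGradedBasis_assocGr (h : HasGradedBasis e) : HasGradedBasis (grIdem k e) := by
  obtain ⟨n, t, a, ha⟩ := h
  have ha1 : ∀ q, a q ∈ offDiagIdeal e ^ 1 := fun q => mem_pow_one_iff.2 (ha.mem q)
  have hself : ∀ q, grSymb _ 1 (a q) (ha1 q) - grSymb _ 1 (a q) (ha1 q) ∈
      offDiagIdeal (grIdem k e) ^ 2 := fun q => by rw [sub_self]; exact zero_mem _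
  refine ⟨n, t, fun q => grSymb _ 1 (a q) (ha1 q), fun q => mem_pow_one_iff.1 (he.grSymb_mem _),
    fun q => ?_, fun y hy => ?_, fun i x hx hsum q => ?_⟩
  · rw [grIdem, ofAlg_mul_grSymb]
    exact grSymb_congr _ _ rfl (ha.idem q)
  · obtain ⟨y', hy', hyy⟩ := he.exists_degree_one_lift hy
    obtain ⟨x, hx⟩ := ha.span y' (mem_pow_one_iff.1 hy')
    refine ⟨fun q => AssocGr.ofAlg (offDiagIdeal e) k (x q), ?_⟩
    have h1 := he.sum_mul_sub_grSymb_mem (i := 0) (x := fun q => AssocGr.ofAlg (offDiagIdeal e) k (x q))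
      (y := x) (fun q => GrPiece.mem_pow_zero _) (fun q => GrPiece.mem_pow_zero _)
      (fun q => by rw [ofAlg_apply, sub_self]; exact zero_mem _) ha1 hself
    have h2 := he.grSymb_sub_mem_sq hy' (sum_mem fun q _ =>
      GrPiece.mul_mem (i := 0) (j := 1) (GrPiece.mem_pow_zero (x q)) (ha1 q)) hx
    have := sub_mem (add_mem hyy h2) h1
    convert this using 1
    abel
  -- Only the components of degree i of the coefficients matter. They come from A, where
  -- independence is known.
  · choose y hy hxy using fun q => he.exists_grSymb_sub_mem (hx q)
    have h1 := he.sum_mul_sub_grSymb_mem hx hy hxy ha1 hself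
    have h1' := sub_mem hsum h1
    rw [sub_sub_cancel] at h1'
    have h2 := (he.grSymb_mem_pow_succ_iff _).1 h1'
    have h3 := ha.indep i y hy h2 q
    have h4 : grSymb _ i (y q) (hy q) * grIdem k e (t q) = 0 := by
      rw [grIdem, grSymb_mul_ofAlg, grSymb_eq_zero_iff]
      exact h3
    have h5 := Ideal.mul_mem_right (grIdem k e (t q)) _ (hxy q)
    rwa [sub_mul, h4, sub_zero] at h5

/-- The conditions see only the degree 1 terms of a basis of gr A, so these are lifted to A. Left
multiplication by e_(t q) makes the lifts homogeneous. -/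
theorem hasGradedBasis_of_assocGr (h : HasGradedBasis (grIdem k e)) : HasGradedBasis e := by
  obtain ⟨n, t, α, hα⟩ := h
  obtain ⟨a, ha1, hαa, hid⟩ : ∃ a : Fin n → B, ∃ ha : ∀ q, a q ∈ offDiagIdeal e ^ 1,
      (∀ q, α q - grSymb _ 1 (a q) (ha q) ∈ offDiagIdeal (grIdem k e) ^ 2) ∧
      ∀ q, e (t q) * a q = a q := by
    choose a ha h using fun q => he.exists_degree_one_lift (hα.mem q)
    refine ⟨fun q => e (t q) * a q, fun q => Ideal.mul_mem_left _ _ (ha q), fun q => ?_,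
      fun q => he.idem_assoc _ _⟩
    have := Ideal.mul_mem_left _ (grIdem k e (t q)) (h q)
    rw [mul_sub, hα.idem] at this
    convert this using 2
    rw [grIdem, ofAlg_mul_grSymb]
  refine ⟨n, t, a, fun q => mem_pow_one_iff.1 (ha1 q), hid, fun y hy => ?_, fun i x hx hsum q => ?_⟩
  · obtain ⟨x, hx⟩ := hα.span _ (mem_pow_one_iff.1 (he.grSymb_mem (mem_pow_one_iff.2 hy)))
    choose z hz hxz using fun q => he.exists_degree_zero_lift (x q)
    have h1 := he.sum_mul_sub_grSymb_mem (i := 0) (fun q => GrPiece.mem_pow_zero _) hz hxz ha1 hαa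
    refine ⟨z, he.mem_sq_of_grSymb_sub_mem (mem_pow_one_iff.2 hy) (sum_mem fun q _ =>
      GrPiece.mul_mem (i := 0) (j := 1) (hz q) (ha1 q)) ?_⟩
    have := add_mem hx h1
    convert this using 1
    abel
  · have h1 := he.sum_mul_sub_grSymb_mem (fun q => he.grSymb_mem (hx q)) hx
      (fun q => by rw [sub_self]; exact zero_mem _) ha1 hαa
    have h0 : grSymb _ (i + 1) (∑ q, x q * a q)
        (sum_mem fun q _ => GrPiece.mul_mem (hx q) (ha1 q)) = 0 := (grSymb_eq_zero_iff _).2 hsum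
    rw [h0, sub_zero] at h1
    have h2 := hα.indep i _ (fun q => he.grSymb_mem (hx q)) h1 q
    rw [grIdem, grSymb_mul_ofAlg] at h2
    exact (he.grSymb_mem_pow_succ_iff _).1 h2

theorem hasGradedBasis_assocGr_iff : HasGradedBasis (grIdem k e) ↔ HasGradedBasis e :=
  ⟨he.hasGradedBasis_of_assocGr, he.hasGradedBasis_assocGr⟩

theorem hasRightBasis_assocGr (h : HasRightBasis e) : HasRightBasis (grIdem k e) := by
  obtain ⟨n, t, a, ha⟩ := h
  have ha1 : ∀ q, a q ∈ offDiagIdeal e ^ 1 := fun q => mem_pow_one_iff.2 (ha.mem q)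
  have hself : ∀ q, grSymb _ 1 (a q) (ha1 q) - grSymb _ 1 (a q) (ha1 q) ∈
      offDiagIdeal (grIdem k e) ^ 2 := fun q => by rw [sub_self]; exact zero_mem _
  refine ⟨n, t, fun q => grSymb _ 1 (a q) (ha1 q), fun q => mem_pow_one_iff.1 (he.grSymb_mem _),
    fun q => ?_, fun y hy => ?_, fun x hsum q => ?_⟩
  · rw [grIdem, grSymb_mul_ofAlg]
    exact grSymb_congr _ _ rfl (ha.idem q)
  · obtain ⟨y', hy', hyy⟩ := he.exists_degree_one_lift hy
    obtain ⟨x, hx⟩ := ha.span y' (mem_pow_one_iff.1 hy')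
    refine ⟨fun q => AssocGr.ofAlg (offDiagIdeal e) k (x q), ?_⟩
    have h1 := he.sum_mul_sub_grSymb_mem' (x := fun q => AssocGr.ofAlg (offDiagIdeal e) k (x q))
      (y := x) (fun q => GrPiece.mem_pow_zero _)
      (fun q => by rw [ofAlg_apply, sub_self]; exact zero_mem _) ha1 hself
    have h2 := he.grSymb_sub_mem_sq hy' (sum_mem fun q _ =>
      Ideal.mul_mem_right _ _ (ha1 q)) hx
    have := sub_mem (add_mem hyy h2) h1
    convert this using 1
    abel
  · choose y hy hxy using fun q => he.exists_degree_zero_lift (x q)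
    have h1 := he.sum_mul_sub_grSymb_mem' hy hxy ha1 hself
    have h1' := sub_mem hsum h1
    rw [sub_sub_cancel] at h1'
    have h2 := (he.grSymb_mem_pow_succ_iff _).1 h1'
    have h3 := ha.indep y h2 q
    have h4 : grIdem k e (t q) * grSymb _ 0 (y q) (hy q) = 0 := by
      rw [grIdem, ofAlg_mul_grSymb, grSymb_eq_zero_iff]
      exact mem_pow_one_iff.2 h3
    have h5 := Ideal.mul_mem_left _ (grIdem k e (t q)) (hxy q)
    rw [mul_sub, h4, sub_zero] at h5
    exact mem_pow_one_iff.1 h5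

theorem hasRightBasis_of_assocGr (h : HasRightBasis (grIdem k e)) : HasRightBasis e := by
  obtain ⟨n, t, α, hα⟩ := h
  obtain ⟨a, ha1, hαa, hid⟩ : ∃ a : Fin n → B, ∃ ha : ∀ q, a q ∈ offDiagIdeal e ^ 1,
      (∀ q, α q - grSymb _ 1 (a q) (ha q) ∈ offDiagIdeal (grIdem k e) ^ 2) ∧
      ∀ q, a q * e (t q) = a q := by
    choose a ha h using fun q => he.exists_degree_one_lift (hα.mem q)
    refine ⟨fun q => a q * e (t q), fun q => Ideal.mul_mem_right _ _ (ha q), fun q => ?_,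
      fun q => he.mul_idem_assoc _ _⟩
    have := Ideal.mul_mem_right (grIdem k e (t q)) _ (h q)
    rw [sub_mul, hα.idem] at this
    convert this using 2
    rw [grIdem, grSymb_mul_ofAlg]
  refine ⟨n, t, a, fun q => mem_pow_one_iff.1 (ha1 q), hid, fun y hy => ?_, fun x hsum q => ?_⟩
  · obtain ⟨x, hx⟩ := hα.span _ (mem_pow_one_iff.1 (he.grSymb_mem (mem_pow_one_iff.2 hy)))
    choose z hz hxz using fun q => he.exists_degree_zero_lift (x q)
    have h1 := he.sum_mul_sub_grSymb_mem' hz hxz ha1 hαa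
    refine ⟨z, he.mem_sq_of_grSymb_sub_mem (mem_pow_one_iff.2 hy) (sum_mem fun q _ =>
      Ideal.mul_mem_right _ _ (ha1 q)) ?_⟩
    have := add_mem hx h1
    convert this using 1
    abel
  · have hx0 : ∀ q, x q ∈ offDiagIdeal e ^ 0 := fun q => GrPiece.mem_pow_zero _
    have h1 := he.sum_mul_sub_grSymb_mem' (x := fun q => grSymb _ 0 (x q) (hx0 q)) hx0
      (fun q => by rw [sub_self]; exact zero_mem _) ha1 hαa
    have h0 : grSymb _ 1 (∑ q, a q * x q)
        (sum_mem fun q _ => Ideal.mul_mem_right _ _ (ha1 q)) = 0 :=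
      (grSymb_eq_zero_iff _).2 hsum
    rw [h0, sub_zero] at h1
    have h2 := hα.indep _ h1 q
    rw [grIdem, ofAlg_mul_grSymb] at h2
    exact mem_pow_one_iff.1 ((he.grSymb_mem_pow_succ_iff _).1 (mem_pow_one_iff.2 h2))

theorem hasRightBasis_assocGr_iff : HasRightBasis (grIdem k e) ↔ HasRightBasis e :=
  ⟨he.hasRightBasis_of_assocGr, he.hasRightBasis_assocGr⟩

end

end SplitDirected

/-! ### Tensor algebras of bimodules -/

namespace BimoduleTensorAlgebra

variable {k : Type u} [CommRing k] {S : Type*} [Ring S] [Algebra k S]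
  {X : Type*} [AddCommGroup X] [Module k X] [Module S X] [Module Sᵐᵒᵖ X]
  [IsScalarTower k S X] [IsScalarTower k Sᵐᵒᵖ X] [SMulCommClass S Sᵐᵒᵖ X]
  {C : Type*} [Semiring C] [Algebra k C]

/-- The universal property. -/
def lift (f : S →ₐ[k] C) (g : X →ₗ[k] C) (hl : ∀ a x, g (a • x) = f a * g x)
    (hr : ∀ a x, g (MulOpposite.op a • x) = g x * f a) : BimoduleTensorAlgebra k S X →ₐ[k] C :=
  RingQuot.liftAlgHom k ⟨TensorAlgebra.lift k (f.toLinearMap.coprod g), by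
    rintro _ _ (_ | ⟨a, b⟩ | ⟨a, x⟩ | ⟨a, x⟩)
    · simp
    · simp
    · simp [hl]
    · simp [hr]⟩

theorem lift_ofScalar (f : S →ₐ[k] C) (g : X →ₗ[k] C) (hl hr) (a : S) :
    lift f g hl hr (ofScalar k S X a) = f a := by
  rw [lift, ofScalar]
  refine (RingQuot.liftAlgHom_mkAlgHom_apply k _ _ _).trans ?_
  simp

theorem lift_ofVector (f : S →ₐ[k] C) (g : X →ₗ[k] C) (hl hr) (x : X) :
    lift f g hl hr (ofVector k S X x) = g x := by
  rw [lift, ofVector]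
  refine (RingQuot.liftAlgHom_mkAlgHom_apply k _ _ _).trans ?_
  simp

variable (k S X) in
/-- The structure map `S → S[X]` as a linear map. -/
def scalarMap : S →ₗ[k] BimoduleTensorAlgebra k S X :=
  (RingQuot.mkAlgHom k (Rel k S X)).toLinearMap.comp
    ((TensorAlgebra.ι k).comp (LinearMap.inl k S X))

variable (k S X) in
/-- The structure map `X → S[X]` as a linear map. -/
def vectorMap : X →ₗ[k] BimoduleTensorAlgebra k S X :=
  (RingQuot.mkAlgHom k (Rel k S X)).toLinearMap.comp
    ((TensorAlgebra.ι k).comp (LinearMap.inr k S X))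

theorem scalarMap_apply (a : S) : scalarMap k S X a = ofScalar k S X a := rfl

theorem vectorMap_apply (x : X) : vectorMap k S X x = ofVector k S X x := rfl

theorem ofScalar_one : ofScalar k S X 1 = 1 :=
  (RingQuot.mkAlgHom_rel k Rel.one).trans (map_one _)

theorem ofScalar_mul (a b : S) :
    ofScalar k S X (a * b) = ofScalar k S X a * ofScalar k S X b :=
  (RingQuot.mkAlgHom_rel k (Rel.mul a b)).trans (map_mul _ _ _)

theorem ofVector_smul (a : S) (x : X) :
    ofVector k S X (a • x) = ofScalar k S X a * ofVector k S X x :=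
  (RingQuot.mkAlgHom_rel k (Rel.left a x)).trans (map_mul _ _ _)

theorem ofVector_op_smul (a : S) (x : X) :
    ofVector k S X (MulOpposite.op a • x) = ofVector k S X x * ofScalar k S X a :=
  (RingQuot.mkAlgHom_rel k (Rel.right a x)).trans (map_mul _ _ _)

theorem ofScalar_zero : ofScalar k S X 0 = 0 := map_zero (scalarMap k S X)

theorem ofScalar_add (a b : S) : ofScalar k S X (a + b) = ofScalar k S X a + ofScalar k S X b :=
  map_add (scalarMap k S X) a b

theorem ofVector_add (a b : X) : ofVector k S X (a + b) = ofVector k S X a + ofVector k S X b :=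
  map_add (vectorMap k S X) a b

theorem ofVector_sum {ι : Type*} (s : Finset ι) (x : ι → X) :
    ofVector k S X (∑ q ∈ s, x q) = ∑ q ∈ s, ofVector k S X (x q) :=
  map_sum (vectorMap k S X) x s

theorem algebraMap_eq (c : k) :
    algebraMap k (BimoduleTensorAlgebra k S X) c = ofScalar k S X (algebraMap k S c) := by
  rw [Algebra.algebraMap_eq_smul_one, Algebra.algebraMap_eq_smul_one, ← ofScalar_one]
  exact ((scalarMap k S X).map_smul c 1).symm

/-- Induction on the elements of `S[X]`. -/
theorem induction {P : BimoduleTensorAlgebra k S X → Prop}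
    (hs : ∀ a, P (ofScalar k S X a)) (hv : ∀ x, P (ofVector k S X x))
    (hm : ∀ x y, P x → P y → P (x * y)) (ha : ∀ x y, P x → P y → P (x + y))
    (x : BimoduleTensorAlgebra k S X) : P x := by
  obtain ⟨x, rfl⟩ := RingQuot.mkAlgHom_surjective k (Rel k S X) x
  induction x using TensorAlgebra.induction with
  | algebraMap c =>
    rw [AlgHom.commutes]
    have := hs (algebraMap k S c)
    rw [← algebraMap_eq] at this
    exact this
  | ι x =>
    have h : (TensorAlgebra.ι k) x = TensorAlgebra.ι k (x.1, (0 : X)) +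
        TensorAlgebra.ι k ((0 : S), x.2) := by
      rw [← map_add]
      simp
    rw [h, map_add]
    exact ha _ _ (hs x.1) (hv x.2)
  | mul a b h1 h2 => rw [map_mul]; exact hm _ _ h1 h2
  | add a b h1 h2 => rw [map_add]; exact ha _ _ h1 h2

theorem algHom_ext {f g : BimoduleTensorAlgebra k S X →ₐ[k] C}
    (hs : ∀ a, f (ofScalar k S X a) = g (ofScalar k S X a))
    (hv : ∀ x, f (ofVector k S X x) = g (ofVector k S X x)) : f = g := by
  ext x
  induction x using induction with
  | hs a => exact hs a
  | hv x => exact hv x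
  | hm x y h1 h2 => rw [map_mul, map_mul, h1, h2]
  | ha x y h1 h2 => rw [map_add, map_add, h1, h2]

/-! #### The powers of `X` -/

variable (k S X) in
/-- The image of the `i`-th tensor power of `X`. -/
def tpow : ℕ → Submodule k (BimoduleTensorAlgebra k S X)
  | 0 => LinearMap.range (scalarMap k S X)
  | i + 1 => tpow i * LinearMap.range (vectorMap k S X)

theorem mul_ofScalar_mem_tpow {i : ℕ} {x : BimoduleTensorAlgebra k S X} (hx : x ∈ tpow k S X i)
    (a : S) : x * ofScalar k S X a ∈ tpow k S X i := by
  cases i with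
  | zero =>
    obtain ⟨b, rfl⟩ := hx
    exact ⟨b * a, ofScalar_mul b a⟩
  | succ i =>
    refine Submodule.mul_induction_on hx ?_ ?_
    · rintro u hu _ ⟨y, rfl⟩
      rw [mul_assoc, vectorMap_apply, ← ofVector_op_smul]
      exact Submodule.mul_mem_mul hu ⟨_, rfl⟩
    · intro u v hu hv
      rw [add_mul]
      exact add_mem hu hv

/-- The sum of the powers contains 1 and is stable under right multiplication by the generators.
Stability, unlike membership, passes to products, which is why the induction is on it. -/
theorem mem_iSup_tpow (x : BimoduleTensorAlgebra k S X) : x ∈ ⨆ i, tpow k S X i := by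
  suffices H : ∀ y ∈ ⨆ i, tpow k S X i, y * x ∈ ⨆ i, tpow k S X i by
    have h1 : (1 : BimoduleTensorAlgebra k S X) ∈ ⨆ i, tpow k S X i :=
      (le_iSup (tpow k S X) 0) ⟨1, ofScalar_one⟩
    have := H 1 h1
    rwa [one_mul] at this
  induction x using induction with
  | hs a =>
    intro y hy
    refine Submodule.iSup_induction (tpow k S X)
      (motive := fun y => y * ofScalar k S X a ∈ ⨆ i, tpow k S X i) hy ?_ ?_ ?_
    · intro i y hy
      exact (le_iSup (tpow k S X) i) (mul_ofScalar_mem_tpow hy a)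
    · rw [zero_mul]; exact zero_mem _
    · intro u v hu hv
      rw [add_mul]; exact add_mem hu hv
  | hv z =>
    intro y hy
    refine Submodule.iSup_induction (tpow k S X)
      (motive := fun y => y * ofVector k S X z ∈ ⨆ i, tpow k S X i) hy ?_ ?_ ?_
    · intro i y hy
      exact (le_iSup (tpow k S X) (i + 1)) (Submodule.mul_mem_mul hy ⟨z, rfl⟩)
    · rw [zero_mul]; exact zero_mem _
    · intro u v hu hv
      rw [add_mul]; exact add_mem hu hv
  | hm a b h1 h2 =>
    intro y hy
    rw [← mul_assoc]
    exact h2 _ (h1 y hy)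
  | ha a b h1 h2 =>
    intro y hy
    rw [mul_add]
    exact add_mem (h1 y hy) (h2 y hy)

theorem exists_sum_of_mem_tpow_succ {ι : Type*} [Fintype ι] {g : ι → X}
    (hg : ∀ y, ∃ x : ι → S, ∑ q, x q • g q = y) {i : ℕ} {z : BimoduleTensorAlgebra k S X}
    (hz : z ∈ tpow k S X (i + 1)) :
    ∃ y : ι → BimoduleTensorAlgebra k S X, (∀ q, y q ∈ tpow k S X i) ∧
      ∑ q, y q * ofVector k S X (g q) = z := by
  refine Submodule.mul_induction_on hz ?_ ?_
  · rintro u hu _ ⟨v, rfl⟩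
    obtain ⟨x, rfl⟩ := hg v
    refine ⟨fun q => u * ofScalar k S X (x q), fun q => mul_ofScalar_mem_tpow hu _, ?_⟩
    rw [vectorMap_apply, ofVector_sum, Finset.mul_sum]
    exact Finset.sum_congr rfl fun q _ => by rw [ofVector_smul, mul_assoc]
  · rintro _ _ ⟨y, hy, rfl⟩ ⟨y', hy', rfl⟩
    exact ⟨y + y', fun q => add_mem (hy q) (hy' q), by simp [add_mul, Finset.sum_add_distrib]⟩

/-! #### Partial derivatives -/

/-- The action of `S` on `S[X] × Hom_S(X, S)`. -/
def leftScalarAction : S →ₐ[k] Module.End k (BimoduleTensorAlgebra k S X × (X →ₗ[S] S)) where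
  toFun a :=
    { toFun := fun p => (ofScalar k S X a * p.1,
        -- The twist by the right action of a is forced by (x a) · f = x · (a · f).
        { toFun := fun x => p.2 (MulOpposite.op a • x)
          map_add' := fun x y => by rw [smul_add, map_add]
          map_smul' := fun b x => by
            rw [← smul_comm b (MulOpposite.op a) x, map_smul, RingHom.id_apply] })
      map_add' := fun p q => Prod.ext (mul_add _ _ _) (LinearMap.ext fun x => rfl)
      map_smul' := fun c p => Prod.ext (mul_smul_comm _ _ _) (LinearMap.ext fun x => rfl) }
  map_one' := LinearMap.ext fun p => Prod.ext (by
    change ofScalar k S X 1 * p.1 = p.1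
    rw [ofScalar_one, one_mul]) (LinearMap.ext fun x => congrArg p.2 (one_smul _ x))
  map_mul' a b := LinearMap.ext fun p => Prod.ext (by
    change ofScalar k S X (a * b) * p.1 = ofScalar k S X a * (ofScalar k S X b * p.1)
    rw [ofScalar_mul, mul_assoc]) (LinearMap.ext fun x => by
      change p.2 (MulOpposite.op (a * b) • x) = p.2 (MulOpposite.op b • MulOpposite.op a • x)
      rw [smul_smul, MulOpposite.op_mul])
  map_zero' := LinearMap.ext fun p => Prod.ext (by
    change ofScalar k S X 0 * p.1 = 0
    rw [ofScalar_zero, zero_mul]) (LinearMap.ext fun x => by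
      change p.2 (MulOpposite.op 0 • x) = 0
      rw [MulOpposite.op_zero, zero_smul, map_zero])
  map_add' a b := LinearMap.ext fun p => Prod.ext (by
    change ofScalar k S X (a + b) * p.1 = ofScalar k S X a * p.1 + ofScalar k S X b * p.1
    rw [ofScalar_add, add_mul]) (LinearMap.ext fun x => by
      change p.2 (MulOpposite.op (a + b) • x) = p.2 (MulOpposite.op a • x) + p.2 (MulOpposite.op b • x)
      rw [MulOpposite.op_add, add_smul, map_add])
  commutes' c := LinearMap.ext fun p => Prod.ext (by
    change ofScalar k S X (algebraMap k S c) * p.1 = c • p.1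
    rw [← algebraMap_eq, Algebra.smul_def]) (LinearMap.ext fun x => by
      change p.2 (MulOpposite.op (algebraMap k S c) • x) = c • p.2 x
      rw [← MulOpposite.algebraMap_apply, algebraMap_smul, p.2.map_smul_of_tower])

/-- The action of `X` on `S[X] × Hom_S(X, S)`. -/
def leftVectorAction : X →ₗ[k] Module.End k (BimoduleTensorAlgebra k S X × (X →ₗ[S] S)) where
  toFun x :=
    { toFun := fun p => (ofVector k S X x * p.1 + ofScalar k S X (p.2 x), 0)
      map_add' := fun p q => Prod.ext (by
        change ofVector k S X x * (p.1 + q.1) + ofScalar k S X (p.2 x + q.2 x) = _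
        rw [mul_add, ofScalar_add]
        exact add_add_add_comm _ _ _ _) (by simp)
      map_smul' := fun c p => Prod.ext (by
        change ofVector k S X x * (c • p.1) + scalarMap k S X (c • p.2 x) = _
        rw [mul_smul_comm, map_smul, ← smul_add]
        rfl) (by simp) }
  map_add' x y := LinearMap.ext fun p => Prod.ext (by
    change ofVector k S X (x + y) * p.1 + ofScalar k S X (p.2 (x + y)) = _
    rw [ofVector_add, map_add, ofScalar_add, add_mul]
    exact add_add_add_comm _ _ _ _) (by simp)
  map_smul' c x := LinearMap.ext fun p => Prod.ext (by
    change vectorMap k S X (c • x) * p.1 + scalarMap k S X (p.2 (c • x)) = _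
    rw [p.2.map_smul_of_tower, map_smul, map_smul, smul_mul_assoc, ← smul_add]
    rfl) (by simp)

variable (k S X) in
/-- The left module `S[X] × Hom_S(X, S)`. -/
def leftAction :
    BimoduleTensorAlgebra k S X →ₐ[k] Module.End k (BimoduleTensorAlgebra k S X × (X →ₗ[S] S)) :=
  lift (leftScalarAction (k := k) (S := S) (X := X)) (leftVectorAction (k := k) (S := S) (X := X))
    (fun a x => LinearMap.ext fun p => Prod.ext (by
      change ofVector k S X (a • x) * p.1 + ofScalar k S X (p.2 (a • x)) =
        ofScalar k S X a * (ofVector k S X x * p.1 + ofScalar k S X (p.2 x))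
      rw [ofVector_smul, map_smul, smul_eq_mul, ofScalar_mul, mul_add, mul_assoc])
      (LinearMap.ext fun y => rfl))
    (fun a x => LinearMap.ext fun p => Prod.ext (by
      change ofVector k S X (MulOpposite.op a • x) * p.1 + ofScalar k S X (p.2 (MulOpposite.op a • x)) =
        ofVector k S X x * (ofScalar k S X a * p.1) + ofScalar k S X (p.2 (MulOpposite.op a • x))
      rw [ofVector_op_smul, mul_assoc]) rfl)

theorem leftAction_zero (x y : BimoduleTensorAlgebra k S X) :
    leftAction k S X x (y, 0) = (x * y, 0) := by
  induction x using induction generalizing y with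
  | hs a => rw [leftAction, lift_ofScalar]; rfl
  | hv z =>
    rw [leftAction, lift_ofVector]
    change (ofVector k S X z * y + ofScalar k S X 0, 0) = _
    rw [ofScalar_zero, add_zero]
  | hm a b h1 h2 => rw [map_mul, Module.End.mul_apply, h2, h1, mul_assoc]
  | ha a b h1 h2 => rw [map_add, LinearMap.add_apply, h1, h2, add_mul]; simp

/-- A partial derivative along f. In the module S[X] × Hom_S(X, S) one has x · (0, f) = (f x, 0), so
evaluating a relation at (0, f) strips the last factor of each term. No decomposition of S[X] into
tensor powers is needed. -/
theorem sum_mul_ofScalar_eq_zero {ι : Type*} (s : Finset ι) (c : ι → BimoduleTensorAlgebra k S X)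
    (x : ι → X) (h : ∑ q ∈ s, c q * ofVector k S X (x q) = 0) (f : X →ₗ[S] S) :
    ∑ q ∈ s, c q * ofScalar k S X (f (x q)) = 0 := by
  have h1 := congrArg (fun z => (leftAction k S X z (0, f)).1) h
  simp only [map_sum, map_zero, LinearMap.sum_apply, LinearMap.zero_apply, Prod.fst_sum, map_mul,
    Prod.fst_zero] at h1
  rw [← h1]
  refine Finset.sum_congr rfl fun q _ => ?_
  have h2 : leftAction k S X (ofVector k S X (x q)) (0, f) = (ofScalar k S X (f (x q)), 0) := by
    rw [leftAction, lift_ofVector]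
    change (ofVector k S X (x q) * 0 + ofScalar k S X (f (x q)), 0) = _
    rw [mul_zero, zero_add]
  rw [Module.End.mul_apply, h2, leftAction_zero]

/-- The right action of `S` on `S[X] × Hom_S(X, S)`, for homomorphisms of right modules. -/
def rightScalarAction :
    S →ₐ[k] (Module.End k (BimoduleTensorAlgebra k S X × (X →ₗ[Sᵐᵒᵖ] S)))ᵐᵒᵖ where
  toFun a := MulOpposite.op
    { toFun := fun p => (p.1 * ofScalar k S X a,
        { toFun := fun x => p.2 (a • x)
          map_add' := fun x y => by rw [smul_add, map_add]
          map_smul' := fun b x => by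
            rw [smul_comm a b x, map_smul, RingHom.id_apply] })
      map_add' := fun p q => Prod.ext (add_mul _ _ _) (LinearMap.ext fun x => rfl)
      map_smul' := fun c p => Prod.ext (smul_mul_assoc _ _ _) (LinearMap.ext fun x => rfl) }
  map_one' := MulOpposite.unop_injective <| LinearMap.ext fun p => Prod.ext (by
    change p.1 * ofScalar k S X 1 = p.1
    rw [ofScalar_one, mul_one]) (LinearMap.ext fun x => congrArg p.2 (one_smul _ x))
  map_mul' a b := MulOpposite.unop_injective <| LinearMap.ext fun p => Prod.ext (by
    change p.1 * ofScalar k S X (a * b) = p.1 * ofScalar k S X a * ofScalar k S X b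
    rw [ofScalar_mul, mul_assoc]) (LinearMap.ext fun x => by
      change p.2 ((a * b) • x) = p.2 (a • b • x)
      rw [smul_smul])
  map_zero' := MulOpposite.unop_injective <| LinearMap.ext fun p => Prod.ext (by
    change p.1 * ofScalar k S X 0 = 0
    rw [ofScalar_zero, mul_zero]) (LinearMap.ext fun x => by
      change p.2 ((0 : S) • x) = 0
      rw [zero_smul, map_zero])
  map_add' a b := MulOpposite.unop_injective <| LinearMap.ext fun p => Prod.ext (by
    change p.1 * ofScalar k S X (a + b) = p.1 * ofScalar k S X a + p.1 * ofScalar k S X b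
    rw [ofScalar_add, mul_add]) (LinearMap.ext fun x => by
      change p.2 ((a + b) • x) = p.2 (a • x) + p.2 (b • x)
      rw [add_smul, map_add])
  commutes' c := MulOpposite.unop_injective <| LinearMap.ext fun p => Prod.ext (by
    change p.1 * ofScalar k S X (algebraMap k S c) = c • p.1
    rw [← algebraMap_eq, ← Algebra.commutes, Algebra.smul_def]) (LinearMap.ext fun x => by
      change p.2 (algebraMap k S c • x) = c • p.2 x
      rw [algebraMap_smul, p.2.map_smul_of_tower])

/-- The right action of `X` on `S[X] × Hom_S(X, S)`, for homomorphisms of right modules. -/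
def rightVectorAction :
    X →ₗ[k] (Module.End k (BimoduleTensorAlgebra k S X × (X →ₗ[Sᵐᵒᵖ] S)))ᵐᵒᵖ where
  toFun x := MulOpposite.op
    { toFun := fun p => (p.1 * ofVector k S X x + ofScalar k S X (p.2 x), 0)
      map_add' := fun p q => Prod.ext (by
        change (p.1 + q.1) * ofVector k S X x + ofScalar k S X (p.2 x + q.2 x) = _
        rw [add_mul, ofScalar_add]
        exact add_add_add_comm _ _ _ _) (by simp)
      map_smul' := fun c p => Prod.ext (by
        change (c • p.1) * ofVector k S X x + scalarMap k S X (c • p.2 x) = _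
        rw [smul_mul_assoc, map_smul, ← smul_add]
        rfl) (by simp) }
  map_add' x y := MulOpposite.unop_injective <| LinearMap.ext fun p => Prod.ext (by
    change p.1 * ofVector k S X (x + y) + ofScalar k S X (p.2 (x + y)) = _
    rw [ofVector_add, map_add, ofScalar_add, mul_add]
    exact add_add_add_comm _ _ _ _) (by simp)
  map_smul' c x := MulOpposite.unop_injective <| LinearMap.ext fun p => Prod.ext (by
    change p.1 * vectorMap k S X (c • x) + scalarMap k S X (p.2 (c • x)) = _
    rw [p.2.map_smul_of_tower, map_smul, map_smul, mul_smul_comm, ← smul_add]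
    rfl) (by simp)

variable (k S X) in
/-- The right module `S[X] × Hom_S(X, S)`. -/
def rightAction : BimoduleTensorAlgebra k S X →ₐ[k]
    (Module.End k (BimoduleTensorAlgebra k S X × (X →ₗ[Sᵐᵒᵖ] S)))ᵐᵒᵖ :=
  lift (rightScalarAction (k := k) (S := S) (X := X)) (rightVectorAction (k := k) (S := S) (X := X))
    (fun a x => MulOpposite.unop_injective <| LinearMap.ext fun p => Prod.ext (by
      change p.1 * ofVector k S X (a • x) + ofScalar k S X (p.2 (a • x)) =
        p.1 * ofScalar k S X a * ofVector k S X x + ofScalar k S X (p.2 (a • x))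
      rw [ofVector_smul, mul_assoc]) rfl)
    (fun a x => MulOpposite.unop_injective <| LinearMap.ext fun p => Prod.ext (by
      change p.1 * ofVector k S X (MulOpposite.op a • x) + ofScalar k S X (p.2 (MulOpposite.op a • x)) =
        (p.1 * ofVector k S X x + ofScalar k S X (p.2 x)) * ofScalar k S X a
      rw [ofVector_op_smul, map_smul, op_smul_eq_mul, ofScalar_mul, add_mul, mul_assoc])
      (LinearMap.ext fun y => rfl))

theorem rightAction_zero (x y : BimoduleTensorAlgebra k S X) :
    (rightAction k S X x).unop (y, 0) = (y * x, 0) := by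
  induction x using induction generalizing y with
  | hs a => rw [rightAction, lift_ofScalar]; rfl
  | hv z =>
    rw [rightAction, lift_ofVector]
    change (y * ofVector k S X z + ofScalar k S X 0, 0) = _
    rw [ofScalar_zero, add_zero]
  | hm a b h1 h2 =>
    rw [map_mul, MulOpposite.unop_mul, Module.End.mul_apply, h1, h2, mul_assoc]
  | ha a b h1 h2 =>
    rw [map_add, MulOpposite.unop_add, LinearMap.add_apply, h1, h2, mul_add]
    simp

/-- The mirror image: for a homomorphism of right modules the first factor is stripped. The
operators form a right action, hence the opposite endomorphism ring. -/
theorem sum_ofScalar_mul_eq_zero {ι : Type*} (s : Finset ι) (c : ι → BimoduleTensorAlgebra k S X)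
    (x : ι → X) (h : ∑ q ∈ s, ofVector k S X (x q) * c q = 0) (f : X →ₗ[Sᵐᵒᵖ] S) :
    ∑ q ∈ s, ofScalar k S X (f (x q)) * c q = 0 := by
  have h1 := congrArg (fun z => ((rightAction k S X z).unop (0, f)).1) h
  simp only [map_sum, map_zero, Finset.unop_sum, MulOpposite.unop_zero, LinearMap.sum_apply,
    LinearMap.zero_apply, Prod.fst_sum, map_mul, MulOpposite.unop_mul, Prod.fst_zero] at h1
  rw [← h1]
  refine Finset.sum_congr rfl fun q _ => ?_
  have h2 : (rightAction k S X (ofVector k S X (x q))).unop (0, f) =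
      (ofScalar k S X (f (x q)), 0) := by
    rw [rightAction, lift_ofVector]
    change (0 * ofVector k S X (x q) + ofScalar k S X (f (x q)), 0) = _
    rw [zero_mul, zero_add]
  rw [Module.End.mul_apply, h2, rightAction_zero]

end BimoduleTensorAlgebra

/-! ### The opposite algebra and the diagonal subalgebra -/

theorem GrPiece.mk_sum {B : Type v} [Ring B] {I : Ideal B} {ι : Type*} (s : Finset ι) {i : ℕ}
    {x : ι → B} (hx : ∀ q, x q ∈ I ^ i) :
    GrPiece.mk I i (∑ q ∈ s, x q) (sum_mem fun q _ => hx q) =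
      ∑ q ∈ s, GrPiece.mk I i (x q) (hx q) := by
  refine DirectSum.of_injective (β := GrPiece I) i ?_
  rw [map_sum]
  exact grSymb_sum s hx

theorem GrPiece.mk_eq_zero_iff {B : Type v} [Ring B] {I : Ideal B} {i : ℕ} {x : B} (hx : x ∈ I ^ i) :
    GrPiece.mk I i x hx = 0 ↔ x ∈ I ^ (i + 1) := by
  rw [← GrPiece.mk_zero, GrPiece.mk_eq_mk, sub_zero]

theorem GrPiece.mk_congr {B : Type v} [Ring B] {I : Ideal B} {i : ℕ} {x y : B} (h : x = y)
    (hx : x ∈ I ^ i) (hy : y ∈ I ^ i) : GrPiece.mk I i x hx = GrPiece.mk I i y hy := by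
  subst h; rfl

namespace SplitDirected

variable {k : Type u} [Field k] {B : Type v} [Ring B] [Algebra k B]
  {Λ : Type w} [Fintype Λ] {e : Λ → B}

/-- A module with a decomposition into modules `P_l` has coordinate functions. -/
theorem exists_coord {M : Type*} [AddCommGroup M] [Module B M] {ι : Type*} [Fintype ι]
    [DecidableEq ι] {t : ι → Λ} {g : ι → M} (he : SplitDirected k e) (h : IsProjBasis e t g) :
    ∃ f : ι → M →ₗ[B] B, ∀ p q, f p (g q) = if p = q then e (t p) else 0 := by
  let E := LinearEquiv.ofBijective _ (he.bijective_sumMap h)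
  refine ⟨fun p => (ProjMod e (t p)).subtype.comp ((LinearMap.proj p).comp E.symm.toLinearMap),
    fun p q => ?_⟩
  have h1 : E.symm (g q) = Pi.single q (gen e (t q)) := by
    rw [LinearEquiv.symm_apply_eq]
    change g q = sumMap e t g _
    rw [sumMap_apply, Finset.sum_eq_single q]
    · rw [Pi.single_eq_same]; exact (h.idem q).symm
    · intro p _ hp
      rw [Pi.single_eq_of_ne hp]; simp
    · simp
  change ((E.symm (g q) p : ProjMod e (t p)) : B) = _
  rw [h1]
  by_cases hpq : p = q
  · subst hpq
    rw [Pi.single_eq_same, if_pos rfl]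
    rfl
  · rw [Pi.single_eq_of_ne hpq, if_neg hpq]
    rfl

section
variable (he : SplitDirected k e)
include he

/-- The opposite algebra has reversed arrows, hence the dual order. This makes all results on left
modules available for right modules. -/
theorem op : SplitDirected k (fun l => MulOpposite.op (e l)) where
  orth :=
    { idem := fun l => congrArg MulOpposite.op (he.idem l)
      ortho := fun l m h => congrArg MulOpposite.op (he.mul_of_ne h.symm)
      complete := by
        apply MulOpposite.unop_injective
        rw [Finset.unop_sum]
        exact he.orth.complete }
  ne_zero l h := he.ne_zero l (MulOpposite.op_injective h)
  split l b := by
    obtain ⟨c, n, hc⟩ := he.split l b.unop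
    refine ⟨c, n, MulOpposite.unop_injective ?_⟩
    rw [MulOpposite.unop_pow]
    simpa [mul_assoc] using hc
  dir := by
    obtain ⟨r, hr⟩ := he.dir
    refine ⟨@OrderDual.instPartialOrder Λ r, fun l m ⟨a, ha⟩ => hr m l ⟨a.unop, fun h => ha ?_⟩⟩
    apply MulOpposite.unop_injective
    simpa [mul_assoc] using h

theorem op_mem_offDiagIdeal_iff {x : B} :
    MulOpposite.op x ∈ offDiagIdeal (fun l => MulOpposite.op (e l)) ↔ x ∈ offDiagIdeal e := by
  rw [he.op.mem_offDiagIdeal_iff_diag, he.mem_offDiagIdeal_iff_diag]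
  refine forall_congr' fun m => ?_
  rw [← MulOpposite.op_mul, ← MulOpposite.op_mul, MulOpposite.op_eq_zero_iff, mul_assoc]

theorem op_mem_offDiagIdeal_pow_iff {i : ℕ} {x : B} :
    MulOpposite.op x ∈ offDiagIdeal (fun l => MulOpposite.op (e l)) ^ i ↔
      x ∈ offDiagIdeal e ^ i := by
  induction i generalizing x with
  | zero => exact ⟨fun _ => GrPiece.mem_pow_zero _, fun _ => GrPiece.mem_pow_zero _⟩
  | succ i ih =>
    constructor
    · intro h
      rw [Submodule.pow_succ] at h
      suffices H : ∀ y ∈ offDiagIdeal (fun l => MulOpposite.op (e l)) ^ i •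
          offDiagIdeal (fun l => MulOpposite.op (e l)), y.unop ∈ offDiagIdeal e ^ (i + 1) from
        H _ h
      intro y hy
      refine Submodule.smul_induction_on hy (fun u hu v hv => ?_) (fun u v hu hv => ?_)
      · rw [add_comm]
        exact GrPiece.mul_mem (mem_pow_one_iff.2 (he.op_mem_offDiagIdeal_iff.1 hv)) (ih.1 hu)
      · exact add_mem hu hv
    · intro h
      rw [Submodule.pow_succ] at h
      refine Submodule.smul_induction_on h (fun u hu v hv => ?_) (fun u v hu hv => ?_)
      · rw [add_comm]
        exact GrPiece.mul_mem (mem_pow_one_iff.2 (he.op_mem_offDiagIdeal_iff.2 hv)) (ih.2 hu)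
      · exact add_mem hu hv

theorem idem_mem_diag (l : Λ) : e l ∈ diagSubalgebra k e := by
  classical
  rw [diagSubalgebra, Subalgebra.mem_centralizer_iff, Set.forall_mem_range]
  intro m
  by_cases h : m = l
  · rw [h]
  · rw [he.mul_of_ne h, he.mul_of_ne (Ne.symm h)]

theorem sum_diag_mem (x : B) : ∑ l, e l * x * e l ∈ diagSubalgebra k e := by
  classical
  rw [mem_diagSubalgebra_iff k he.orth]
  refine Finset.sum_congr rfl fun m _ => ?_
  rw [Finset.mul_sum, Finset.sum_mul, Finset.sum_eq_single m]
  · simp only [mul_assoc, he.idem, he.idem_assoc]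
  · intro l _ hl
    rw [mul_assoc (e l), ← mul_assoc (e m), he.mul_of_ne (Ne.symm hl)]
    simp
  · simp

theorem eq_zero_of_mem_diag {x : B} (hx : x ∈ diagSubalgebra k e) (h : x ∈ offDiagIdeal e) :
    x = 0 := by
  rw [(mem_diagSubalgebra_iff k he.orth x).1 hx]
  exact Finset.sum_eq_zero fun l _ => he.diag_eq_zero_of_mem h l

/-- A_0 has the same corner rings as A. So the decomposition of projective modules applies to J /
J^2 over A_0 and, through `op`, to its right module structure. -/
theorem diag : SplitDirected k (fun l => (⟨e l, he.idem_mem_diag l⟩ : diagSubalgebra k e)) where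
  orth :=
    { idem := fun l => Subtype.ext (he.idem l)
      ortho := fun l m h => Subtype.ext (he.mul_of_ne h)
      complete := Subtype.ext (by
        rw [AddSubmonoidClass.coe_finsetSum]
        exact he.orth.complete) }
  ne_zero l h := he.ne_zero l (congrArg Subtype.val h)
  split l b := by
    obtain ⟨c, n, hc⟩ := he.split l b
    exact ⟨c, n, Subtype.ext (by simpa using hc)⟩
  dir := by
    obtain ⟨r, hr⟩ := he.dir
    refine ⟨r, fun l m ⟨a, ha⟩ => hr l m ⟨a, fun h => ha (Subtype.ext h)⟩⟩

end

theorem finite_mulOpposite [Module.Finite k B] : Module.Finite k Bᵐᵒᵖ :=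
  Module.Finite.equiv (MulOpposite.opLinearEquiv k)

theorem finite_grPiece [Module.Finite k B] (I : Ideal B) (i : ℕ) : Module.Finite k (GrPiece I i) := by
  have : Module.Finite k ↥(I ^ i) := inferInstanceAs (Module.Finite k ((I ^ i).restrictScalars k))
  exact inferInstanceAs (Module.Finite k (↥(I ^ i) ⧸ (I ^ (i + 1)).submoduleOf (I ^ i)))

section
variable (he : SplitDirected k e)
include he

/-- Modulo J^2 a coefficient of an element of J may be replaced by its diagonal part, so
combinations over A and over A_0 agree in J / J^2. -/
theorem sub_diag_mul_mem {x y : B} (hy : y ∈ offDiagIdeal e) :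
    (x - ∑ l, e l * x * e l) * y ∈ offDiagIdeal e ^ 2 :=
  GrPiece.mul_mem (i := 1) (j := 1) (mem_pow_one_iff.2 (he.sub_diag_mem x)) (mem_pow_one_iff.2 hy)

theorem mul_sub_diag_mem {x y : B} (hy : y ∈ offDiagIdeal e) :
    y * (x - ∑ l, e l * x * e l) ∈ offDiagIdeal e ^ 2 :=
  GrPiece.mul_mem (i := 1) (j := 1) (mem_pow_one_iff.2 hy) (mem_pow_one_iff.2 (he.sub_diag_mem x))

/-! ### Left and right bases of `J / J ^ 2` -/

theorem isProjBasis_of_isGradedBasis {n : ℕ} {t : Fin n → Λ} {a : Fin n → B}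
    (h : IsGradedBasis e t a) :
    IsProjBasis (fun l => (⟨e l, he.idem_mem_diag l⟩ : diagSubalgebra k e)) t
      (fun q => GrPiece.mk (offDiagIdeal e) 1 (a q) (mem_pow_one_iff.2 (h.mem q))) where
  idem q := GrPiece.mk_congr (h.idem q) _ _
  span y := by
    induction y using GrPiece.ind with
    | _ y hy =>
      obtain ⟨x, hx⟩ := h.span y (mem_pow_one_iff.1 hy)
      refine ⟨fun q => ⟨_, he.sum_diag_mem (x q)⟩, ?_⟩
      simp only [GrPiece.mk_smul_subalgebra]
      rw [← GrPiece.mk_sum Finset.univ fun q => Ideal.mul_mem_left _ _ (mem_pow_one_iff.2 (h.mem q)),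
        GrPiece.mk_eq_mk, ← neg_mem_iff, neg_sub]
      have := add_mem hx (sum_mem (t := Finset.univ) fun q _ =>
        he.sub_diag_mul_mem (x := x q) (h.mem q))
      simpa only [sub_mul, Finset.sum_sub_distrib, sub_add_sub_cancel] using this
  indep x hx q := by
    simp only [GrPiece.mk_smul_subalgebra] at hx
    rw [← GrPiece.mk_sum Finset.univ fun q => Ideal.mul_mem_left _ _ (mem_pow_one_iff.2 (h.mem q)),
      GrPiece.mk_eq_zero_iff] at hx
    have := h.indep 0 _ (fun q => GrPiece.mem_pow_zero _) hx q
    rw [zero_add, Submodule.pow_one] at this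
    exact Subtype.ext (he.eq_zero_of_mem_diag (x q * ⟨e (t q), he.idem_mem_diag _⟩ :
      diagSubalgebra k e).2 this)

theorem isProjBasis_of_isRightBasis {n : ℕ} {t : Fin n → Λ} {b : Fin n → B}
    (h : IsRightBasis e t b) :
    IsProjBasis (fun l => MulOpposite.op (⟨e l, he.idem_mem_diag l⟩ : diagSubalgebra k e)) t
      (fun q => GrPiece.mk (offDiagIdeal e) 1 (b q) (mem_pow_one_iff.2 (h.mem q))) where
  idem q := GrPiece.mk_congr (h.idem q) _ _
  span y := by
    induction y using GrPiece.ind with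
    | _ y hy =>
      obtain ⟨x, hx⟩ := h.span y (mem_pow_one_iff.1 hy)
      refine ⟨fun q => MulOpposite.op ⟨_, he.sum_diag_mem (x q)⟩, ?_⟩
      simp only [GrPiece.mk_op_smul_subalgebra]
      rw [← GrPiece.mk_sum Finset.univ fun q => Ideal.mul_mem_right _ _ (mem_pow_one_iff.2 (h.mem q)),
        GrPiece.mk_eq_mk, ← neg_mem_iff, neg_sub]
      have := add_mem hx (sum_mem (t := Finset.univ) fun q _ =>
        he.mul_sub_diag_mem (x := x q) (h.mem q))
      simp only [mul_sub, Finset.sum_sub_distrib, sub_add_sub_cancel] at this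
      exact this
  indep x hx q := by
    simp only [GrPiece.mk_op_smul_subalgebra] at hx
    rw [← GrPiece.mk_sum Finset.univ fun q => Ideal.mul_mem_right _ _ (mem_pow_one_iff.2 (h.mem q)),
      GrPiece.mk_eq_zero_iff] at hx
    have := h.indep _ hx q
    exact MulOpposite.unop_injective (Subtype.ext (he.eq_zero_of_mem_diag
      (⟨e (t q), he.idem_mem_diag _⟩ * (x q).unop : diagSubalgebra k e).2 this))

variable [Module.Finite k B]

theorem hasRightBasis_of_projective
    (h : Module.Projective (diagSubalgebra k e)ᵐᵒᵖ (GrPiece (offDiagIdeal e) 1)) :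
    HasRightBasis e := by
  have h1 := finite_grPiece (k := k) (offDiagIdeal e) 1
  have h2 : Module.Finite k (diagSubalgebra k e)ᵐᵒᵖ := finite_mulOpposite
  have h3 : Module.Finite (diagSubalgebra k e)ᵐᵒᵖ (GrPiece (offDiagIdeal e) 1) :=
    Module.Finite.of_restrictScalars_finite k _ _
  obtain ⟨n, t, g, hg⟩ := he.diag.op.exists_isProjBasis (GrPiece (offDiagIdeal e) 1)
  obtain ⟨b, hb, hbe, hbg⟩ : ∃ b : Fin n → B, ∃ hb : ∀ q, b q ∈ offDiagIdeal e ^ 1,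
      (∀ q, b q * e (t q) = b q) ∧ g = fun q => GrPiece.mk _ 1 (b q) (hb q) := by
    have hex : ∀ q, ∃ b, ∃ hb : b ∈ offDiagIdeal e ^ 1, g q = GrPiece.mk _ 1 b hb := fun q => by
      generalize g q = z
      induction z using GrPiece.ind with
      | _ b hb => exact ⟨b, hb, rfl⟩
    choose b hb h using hex
    refine ⟨fun q => b q * e (t q), fun q => Ideal.mul_mem_right _ _ (hb q),
      fun q => he.mul_idem_assoc _ _, funext fun q => ?_⟩
    rw [← hg.idem q, h q]
    rfl
  subst hbg
  refine ⟨n, t, b, fun q => mem_pow_one_iff.1 (hb q), hbe, fun y hy => ?_, fun x hx q => ?_⟩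
  · obtain ⟨x, hx⟩ := hg.span (GrPiece.mk _ 1 y (mem_pow_one_iff.2 hy))
    refine ⟨fun q => (x q).unop, ?_⟩
    simp only [GrPiece.mk_op_smul_subalgebra] at hx
    rw [← GrPiece.mk_sum Finset.univ fun q => Ideal.mul_mem_right _ _ (hb q),
      GrPiece.mk_eq_mk, ← neg_mem_iff, neg_sub] at hx
    exact hx
  -- Only the diagonal part of x q acts on J / J^2. The rest of x q lies in J, where the conclusion
  -- does not see it.
  · have h0 : ∑ q, (MulOpposite.op (⟨_, he.sum_diag_mem (x q)⟩ : diagSubalgebra k e)) •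
        GrPiece.mk (offDiagIdeal e) 1 (b q) (hb q) = 0 := by
      simp only [GrPiece.mk_op_smul_subalgebra]
      rw [← GrPiece.mk_sum Finset.univ fun q => Ideal.mul_mem_right _ _ (hb q),
        GrPiece.mk_eq_zero_iff]
      have := sub_mem hx (sum_mem (t := Finset.univ) fun q _ =>
        he.mul_sub_diag_mem (x := x q) (mem_pow_one_iff.1 (hb q)))
      simp only [mul_sub, Finset.sum_sub_distrib, sub_sub_cancel] at this
      exact this
    have h4 := congrArg (fun z => ((MulOpposite.unop z : diagSubalgebra k e) : B)) (hg.indep _ h0 q)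
    have h5 : e (t q) * ∑ l, e l * x q * e l = 0 := h4
    have h6 := Ideal.mul_mem_left _ (e (t q)) (he.sub_diag_mem (x q))
    rwa [mul_sub, h5, sub_zero] at h6

theorem hasRightBasis_iff_projective : HasRightBasis e ↔
    Module.Projective (diagSubalgebra k e)ᵐᵒᵖ (GrPiece (offDiagIdeal e) 1) := by
  refine ⟨fun ⟨n, t, b, h⟩ => ?_, he.hasRightBasis_of_projective⟩
  exact he.diag.op.projective_of_isProjBasis (he.isProjBasis_of_isRightBasis h)

end

/-! ### The canonical map from the tensor algebra -/

variable (k e) in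
/-- The canonical homomorphism `A_0[J / J ^ 2] → gr A`. -/
def grMap : BimoduleTensorAlgebra k (diagSubalgebra k e) (GrPiece (offDiagIdeal e) 1) →ₐ[k]
    AssocGr (offDiagIdeal e) :=
  BimoduleTensorAlgebra.lift
    ((AssocGr.ofAlg (offDiagIdeal e) k).comp (diagSubalgebra k e).val)
    (DirectSum.lof k ℕ (GrPiece (offDiagIdeal e)) 1)
    (fun a x => by
      induction x using GrPiece.ind with
      | _ x hx => exact (ofAlg_mul_grSymb (k := k) (a : B) hx).symm)
    (fun a x => by
      induction x using GrPiece.ind with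
      | _ x hx => exact (grSymb_mul_ofAlg (k := k) (a : B) hx).symm)

theorem grMap_ofScalar (a : diagSubalgebra k e) :
    grMap k e (BimoduleTensorAlgebra.ofScalar k _ _ a) = AssocGr.ofAlg (offDiagIdeal e) k (a : B) :=
  BimoduleTensorAlgebra.lift_ofScalar _ _ _ _ _

theorem grMap_ofVector (x : GrPiece (offDiagIdeal e) 1) :
    grMap k e (BimoduleTensorAlgebra.ofVector k _ _ x) =
      DirectSum.of (GrPiece (offDiagIdeal e)) 1 x :=
  BimoduleTensorAlgebra.lift_ofVector _ _ _ _ _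

theorem grMap_ofVector_mk {x : B} (hx : x ∈ offDiagIdeal e ^ 1) :
    grMap k e (BimoduleTensorAlgebra.ofVector k _ _ (GrPiece.mk _ 1 x hx)) = grSymb _ 1 x hx :=
  grMap_ofVector _

/-- The isomorphism is prescribed on generators, so it can only be the canonical map. -/
theorem grIsTensorAlgebra_iff : GrIsTensorAlgebra k e ↔ Function.Bijective (grMap k e) := by
  constructor
  · rintro ⟨φ, h1, h2⟩
    have : grMap k e = φ.toAlgHom := BimoduleTensorAlgebra.algHom_ext
      (fun a => (grMap_ofScalar a).trans (h1 a).symm) (fun x => (grMap_ofVector x).trans (h2 x).symm)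
    rw [this]
    exact φ.bijective
  · intro h
    exact ⟨AlgEquiv.ofBijective _ h, grMap_ofScalar, grMap_ofVector⟩

section
variable (he : SplitDirected k e)
include he

/-- gr A is generated by its components of degrees 0 and 1, and A_0 covers A / J. -/
theorem surjective_grMap : Function.Surjective (grMap k e) := by
  have key : ∀ (i : ℕ) (x : B) (hx : x ∈ offDiagIdeal e ^ i),
      grSymb _ i x hx ∈ (grMap k e).range := by
    intro i
    induction i with
    | zero =>
      intro x hx
      refine ⟨BimoduleTensorAlgebra.ofScalar k _ _ ⟨_, he.sum_diag_mem x⟩, ?_⟩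
      refine (grMap_ofScalar _).trans ?_
      rw [ofAlg_apply, ← sub_eq_zero, ← grSymb_sub, grSymb_eq_zero_iff, zero_add, Submodule.pow_one,
        ← neg_mem_iff, neg_sub]
      exact he.sub_diag_mem x
    | succ i ih =>
      have : ∀ x ∈ offDiagIdeal e ^ i • offDiagIdeal e, ∀ hx : x ∈ offDiagIdeal e ^ (i + 1),
          grSymb _ (i + 1) x hx ∈ (grMap k e).range := by
        intro x hx
        have hle : offDiagIdeal e ^ i • offDiagIdeal e = offDiagIdeal e ^ (i + 1) :=
          (Submodule.pow_succ ..).symm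
        refine Submodule.smul_induction_on' hx (fun u hu v hv h => ?_) (fun u hu v hv h1 h2 h => ?_)
        · have := (grMap k e).range.mul_mem (ih u hu)
            ⟨_, grMap_ofVector_mk (k := k) (mem_pow_one_iff.2 hv)⟩
          rwa [grSymb_mul] at this
        · rw [hle] at hu hv
          rw [grSymb_add hu hv]
          exact add_mem (h1 hu) (h2 hv)
      intro x hx
      exact this x (by rw [Submodule.pow_succ] at hx; exact hx) hx
  intro x
  change x ∈ (grMap k e).range
  induction x using assocGr_induction with
  | h0 => exact zero_mem _
  | hs i x hx => exact key i x hx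
  | ha x y h1 h2 => exact add_mem h1 h2

theorem exists_grMap_eq_grSymb {i : ℕ} {z : BimoduleTensorAlgebra k (diagSubalgebra k e)
    (GrPiece (offDiagIdeal e) 1)} (hz : z ∈ BimoduleTensorAlgebra.tpow k _ _ i) :
    ∃ x, ∃ hx : x ∈ offDiagIdeal e ^ i, grMap k e z = grSymb _ i x hx := by
  induction i generalizing z with
  | zero =>
    obtain ⟨a, rfl⟩ := hz
    exact ⟨a, GrPiece.mem_pow_zero _, grMap_ofScalar a⟩
  | succ i ih =>
    refine Submodule.mul_induction_on hz ?_ ?_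
    · rintro u hu _ ⟨v, rfl⟩
      obtain ⟨x, hx, h⟩ := ih hu
      induction v using GrPiece.ind with
      | _ v hv =>
        refine ⟨x * v, GrPiece.mul_mem hx hv, ?_⟩
        rw [map_mul, h, BimoduleTensorAlgebra.vectorMap_apply, grMap_ofVector_mk, grSymb_mul]
    · rintro u v ⟨x, hx, h1⟩ ⟨y, hy, h2⟩
      exact ⟨x + y, add_mem hx hy, by rw [map_add, h1, h2, grSymb_add]⟩

/-- Write an element of the power i + 1 as ∑ y_q a_q. If its image vanishes, independence kills the
image of y_q e_(t q), induction on i kills y_q e_(t q) itself, and y_q a_q = y_q e_(t q) a_q. -/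
theorem injective_grMap (h : HasGradedBasis e) : Function.Injective (grMap k e) := by
  obtain ⟨n, t, a, ha⟩ := h
  have hb := he.isProjBasis_of_isGradedBasis ha
  have key : ∀ (i : ℕ) (z : BimoduleTensorAlgebra k (diagSubalgebra k e)
      (GrPiece (offDiagIdeal e) 1)), z ∈ BimoduleTensorAlgebra.tpow k _ _ i →
      grMap k e z = 0 → z = 0 := by
    intro i
    induction i with
    | zero =>
      rintro _ ⟨a, rfl⟩ h
      rw [BimoduleTensorAlgebra.scalarMap_apply, grMap_ofScalar, ofAlg_apply, grSymb_eq_zero_iff,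
        zero_add, Submodule.pow_one] at h
      have : a = 0 := Subtype.ext (he.eq_zero_of_mem_diag a.2 h)
      rw [this, map_zero]
    | succ i ih =>
      intro z hz h
      obtain ⟨y, hy, rfl⟩ := BimoduleTensorAlgebra.exists_sum_of_mem_tpow_succ hb.span hz
      choose x hx hxy using fun q => he.exists_grMap_eq_grSymb (hy q)
      have h1 : ∑ q, x q * a q ∈ offDiagIdeal e ^ (i + 2) := by
        simp only [map_sum, map_mul, hxy, grMap_ofVector_mk, grSymb_mul] at h
        rwa [← grSymb_sum Finset.univ fun q =>
          GrPiece.mul_mem (hx q) (mem_pow_one_iff.2 (ha.mem q)), grSymb_eq_zero_iff] at h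
      have h2 := ha.indep i x hx h1
      refine Finset.sum_eq_zero fun q _ => ?_
      have h3 := ih _ (BimoduleTensorAlgebra.mul_ofScalar_mem_tpow (hy q)
        ⟨e (t q), he.idem_mem_diag _⟩) (by
          rw [map_mul, hxy, grMap_ofScalar, grSymb_mul_ofAlg, grSymb_eq_zero_iff]
          exact h2 q)
      rw [← hb.idem q, BimoduleTensorAlgebra.ofVector_smul, ← mul_assoc, h3, zero_mul]
  rw [injective_iff_map_eq_zero]
  intro z hz
  obtain ⟨f, hf, rfl⟩ := (Submodule.mem_iSup_iff_exists_finsupp _ z).1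
    (BimoduleTensorAlgebra.mem_iSup_tpow z)
  refine Finset.sum_eq_zero fun i hi => key i _ (hf i) ?_
  -- The map sends the i-th power to degree i, so each component of a kernel element is in the
  -- kernel.
  choose x hx hxy using fun i => he.exists_grMap_eq_grSymb (hf i)
  rw [Finsupp.sum, map_sum] at hz
  have h1 := congrArg (fun w : AssocGr (offDiagIdeal e) => w i) hz
  simp only [hxy] at h1
  replace h1 := (DFinsupp.finsetSum_apply _ _ _).symm.trans h1
  rw [Finset.sum_eq_single i (fun j _ hj => apply_grSymb_of_ne hj _) (fun h => absurd hi h),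
    he.grSymb_apply_self] at h1
  rw [hxy, grSymb, h1]
  exact map_zero _

theorem projective_grPiece_of_hasGradedBasis (h : HasGradedBasis e) :
    Module.Projective (diagSubalgebra k e) (GrPiece (offDiagIdeal e) 1) := by
  obtain ⟨n, t, a, ha⟩ := h
  exact he.diag.projective_of_isProjBasis (he.isProjBasis_of_isGradedBasis ha)

theorem grIsTensorAlgebra_of_hasGradedBasis (h : HasGradedBasis e) : GrIsTensorAlgebra k e :=
  grIsTensorAlgebra_iff.2 ⟨he.injective_grMap h, he.surjective_grMap⟩

variable [Module.Finite k B]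

/-- A relation between symbols is pulled back to the tensor algebra, and the derivative along the
p-th coordinate function isolates the p-th coefficient times e_(t p). -/
theorem hasGradedBasis_of_grIsTensorAlgebra (hT : GrIsTensorAlgebra k e)
    (h : Module.Projective (diagSubalgebra k e) (GrPiece (offDiagIdeal e) 1)) :
    HasGradedBasis e := by
  classical
  rw [grIsTensorAlgebra_iff] at hT
  have h1 := finite_grPiece (k := k) (offDiagIdeal e) 1
  have h3 : Module.Finite (diagSubalgebra k e) (GrPiece (offDiagIdeal e) 1) :=
    Module.Finite.of_restrictScalars_finite k _ _
  obtain ⟨n, t, g, hg⟩ := he.diag.exists_isProjBasis (GrPiece (offDiagIdeal e) 1)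
  obtain ⟨a, ha, hae, hag⟩ : ∃ a : Fin n → B, ∃ ha : ∀ q, a q ∈ offDiagIdeal e ^ 1,
      (∀ q, e (t q) * a q = a q) ∧ g = fun q => GrPiece.mk _ 1 (a q) (ha q) := by
    have hex : ∀ q, ∃ b, ∃ hb : b ∈ offDiagIdeal e ^ 1, g q = GrPiece.mk _ 1 b hb := fun q => by
      generalize g q = z
      induction z using GrPiece.ind with
      | _ b hb => exact ⟨b, hb, rfl⟩
    choose a ha h using hex
    refine ⟨fun q => e (t q) * a q, fun q => Ideal.mul_mem_left _ _ (ha q),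
      fun q => he.idem_assoc _ _, funext fun q => ?_⟩
    rw [← hg.idem q, h q]
    rfl
  subst hag
  refine ⟨n, t, a, fun q => mem_pow_one_iff.1 (ha q), hae, fun y hy => ?_, fun i x hx hsum p => ?_⟩
  · obtain ⟨x, hx⟩ := hg.span (GrPiece.mk _ 1 y (mem_pow_one_iff.2 hy))
    refine ⟨fun q => x q, ?_⟩
    simp only [GrPiece.mk_smul_subalgebra] at hx
    rw [← GrPiece.mk_sum Finset.univ fun q => Ideal.mul_mem_left _ _ (ha q),
      GrPiece.mk_eq_mk, ← neg_mem_iff, neg_sub] at hx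
    exact hx
  · obtain ⟨f, hf⟩ := he.diag.exists_coord hg
    choose c hc using fun q => hT.2 (grSymb _ i (x q) (hx q))
    have h0 : ∑ q, c q * BimoduleTensorAlgebra.ofVector k _ _ (GrPiece.mk _ 1 (a q) (ha q)) = 0 := by
      apply hT.1
      simp only [map_sum, map_mul, hc, grMap_ofVector_mk, grSymb_mul, map_zero]
      rw [← grSymb_sum Finset.univ fun q => GrPiece.mul_mem (hx q) (ha q), grSymb_eq_zero_iff]
      exact hsum
    have h2 := BimoduleTensorAlgebra.sum_mul_ofScalar_eq_zero _ _ _ h0 (f p)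
    rw [Finset.sum_eq_single p (fun q _ hq => by
      rw [hf, if_neg hq.symm, BimoduleTensorAlgebra.ofScalar_zero, mul_zero]) (by simp), hf,
      if_pos rfl] at h2
    have h4 := congrArg (grMap k e) h2
    rwa [map_mul, hc, grMap_ofScalar, map_zero, grSymb_mul_ofAlg, grSymb_eq_zero_iff] at h4

theorem hasGradedBasis_iff_grIsTensorAlgebra : HasGradedBasis e ↔ GrIsTensorAlgebra k e ∧
    Module.Projective (diagSubalgebra k e) (GrPiece (offDiagIdeal e) 1) :=
  ⟨fun h => ⟨he.grIsTensorAlgebra_of_hasGradedBasis h, he.projective_grPiece_of_hasGradedBasis h⟩,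
    fun h => he.hasGradedBasis_of_grIsTensorAlgebra h.1 h.2⟩

/-- If `gr A` is a tensor algebra, right bases of `J / J ^ 2` give right bases of `J`. -/
theorem hasGradedBasis_op (hT : GrIsTensorAlgebra k e) (h : HasRightBasis e) :
    HasGradedBasis (fun l => MulOpposite.op (e l)) := by
  classical
  rw [grIsTensorAlgebra_iff] at hT
  obtain ⟨n, t, b, hb⟩ := h
  have hb1 : ∀ q, b q ∈ offDiagIdeal e ^ 1 := fun q => mem_pow_one_iff.2 (hb.mem q)
  refine ⟨n, t, fun q => MulOpposite.op (b q), fun q => he.op_mem_offDiagIdeal_iff.2 (hb.mem q),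
    fun q => congrArg MulOpposite.op (hb.idem q), fun y hy => ?_, fun i x hx hsum p => ?_⟩
  · obtain ⟨x, hx⟩ := hb.span y.unop (he.op_mem_offDiagIdeal_iff.1 hy)
    refine ⟨fun q => MulOpposite.op (x q), ?_⟩
    rw [← he.op_mem_offDiagIdeal_pow_iff] at hx
    simpa [Finset.op_sum] using hx
  · obtain ⟨f, hf⟩ := he.diag.op.exists_coord (he.isProjBasis_of_isRightBasis hb)
    have hx' : ∀ q, (x q).unop ∈ offDiagIdeal e ^ i := fun q =>
      he.op_mem_offDiagIdeal_pow_iff.1 (hx q)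
    have hsum' : ∑ q, b q * (x q).unop ∈ offDiagIdeal e ^ (i + 2) :=
      he.op_mem_offDiagIdeal_pow_iff.1 (by simpa [Finset.op_sum] using hsum)
    choose c hc using fun q => hT.2 (grSymb _ i (x q).unop (hx' q))
    have h0 : ∑ q, BimoduleTensorAlgebra.ofVector k _ _ (GrPiece.mk _ 1 (b q) (hb1 q)) * c q = 0 := by
      apply hT.1
      simp only [map_sum, map_mul, hc, grMap_ofVector_mk, grSymb_mul, map_zero]
      rw [← grSymb_sum Finset.univ fun q => GrPiece.mul_mem (hb1 q) (hx' q), grSymb_eq_zero_iff]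
      rwa [show 1 + i + 1 = i + 2 by omega]
    let f' : GrPiece (offDiagIdeal e) 1 →ₗ[(diagSubalgebra k e)ᵐᵒᵖ] diagSubalgebra k e :=
      { toFun := fun x => (f p x).unop
        map_add' := fun x y => by rw [map_add, MulOpposite.unop_add]
        map_smul' := fun a x => by rw [map_smul]; rfl }
    -- The derivative from the left isolates e_(t p) c_p. Through it a basis in degree 1 controls
    -- the relations in all degrees.
    have h2 := BimoduleTensorAlgebra.sum_ofScalar_mul_eq_zero _ _ _ h0 f'
    have hf' : ∀ q, f' (GrPiece.mk _ 1 (b q) (hb1 q)) = (f p (GrPiece.mk _ 1 (b q) (hb1 q))).unop :=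
      fun q => rfl
    simp only [hf'] at h2
    rw [Finset.sum_eq_single p (fun q _ hq => by
      rw [hf, if_neg hq.symm, MulOpposite.unop_zero, BimoduleTensorAlgebra.ofScalar_zero, zero_mul])
      (by simp), hf, if_pos rfl] at h2
    have h4 := congrArg (grMap k e) h2
    rw [map_mul, hc, grMap_ofScalar, map_zero] at h4
    have h5 := (ofAlg_mul_grSymb (k := k) (e (t p)) (hx' p)).symm.trans h4
    rw [grSymb_eq_zero_iff, ← he.op_mem_offDiagIdeal_pow_iff] at h5
    exact h5

end

end SplitDirected

/-! ### Proper standard modules -/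

namespace SplitDirected

variable {k : Type u} [Field k] {B : Type v} [Ring B] [Algebra k B]
  {Λ : Type w} [Fintype Λ] {e : Λ → B}

section
variable (he : SplitDirected k e)
include he

theorem idem_mul_mul_idem_eq_zero {l w : Λ} (hlw : l ≠ w) (b : B) {x : B} (hx : e w * x * e l = x) :
    e l * (b * x) * e l = 0 := by
  have := he.loop_eq_zero (l := w) (m := l) hlw.symm b x
  rw [← hx]
  simpa only [mul_assoc, he.idem] using this

variable [Module.Finite k B]

theorem finite_projMod_quot {l : Λ} (K : Submodule B (ProjMod e l)) :
    Module.Finite k (ProjMod e l ⧸ K) := by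
  have := he.finite_projMod l
  exact Module.Finite.of_surjective (K.mkQ.restrictScalars k) K.mkQ_surjective

variable [LinearOrder Λ]

theorem diag_mem_jacobson_of_mem_span {l : Λ} {x : ProjMod e l}
    (hx : x ∈ Submodule.span B {x : ProjMod e l |
      (∃ w, l < w ∧ e w • x = x) ∨ ((x : B) ∈ Ring.jacobson B ∧ e l • x = x)}) :
    e l * (x : B) * e l ∈ Ring.jacobson B := by
  have hs : ∀ b : B, e l * (b * (x : B)) * e l ∈ Ring.jacobson B := by
    refine Submodule.span_induction ?_ ?_ ?_ ?_ hx
    · rintro x (⟨w, hw, hx⟩ | ⟨hx, -⟩) b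
      · rw [he.idem_mul_mul_idem_eq_zero (ne_of_lt hw)]
        · exact zero_mem _
        · rw [mul_assoc, he.mem_projMod_iff.1 x.2]
          exact congrArg Subtype.val hx
      · exact Ideal.mul_mem_right _ _ (Ideal.mul_mem_left _ _ (Ideal.mul_mem_left _ _ hx))
    · intro b; simp
    · intro x y _ _ h1 h2 b
      rw [Submodule.coe_add, mul_add, mul_add, add_mul]
      exact add_mem (h1 b) (h2 b)
    · intro a x _ h b
      have := h (b * a)
      rwa [mul_assoc b] at this
  have := hs 1
  rwa [one_mul] at this

/-- Loops at l through some w > l vanish, so the corner entries of the span stay in the radical, and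
e_l is not radical. -/
theorem gen_notMem_span (l : Λ) : gen e l ∉ Submodule.span B {x : ProjMod e l |
      (∃ w, l < w ∧ e w • x = x) ∨ ((x : B) ∈ Ring.jacobson B ∧ e l • x = x)} := by
  intro h
  have := he.diag_mem_jacobson_of_mem_span h
  refine he.idem_notMem_jacobson l ?_
  simpa [gen, he.idem] using this

theorem weight_quot_eq_one {l : Λ} {K : Submodule B (ProjMod e l)} (hK : gen e l ∉ K)
    (hj : ∀ x : ProjMod e l, (x : B) ∈ Ring.jacobson B → e l • x = x → x ∈ K) :
    weight k (e l) (ProjMod e l ⧸ K) = 1 := by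
  rw [weight, finrank_eq_one_iff']
  have hid := he.orth.idem l
  refine ⟨⟨Submodule.Quotient.mk (gen e l), ?_⟩, ?_, ?_⟩
  · rw [mem_smulRange_iff hid, ← Submodule.Quotient.mk_smul, he.idem_smul_gen]
  · intro h
    rw [Subtype.ext_iff] at h
    exact hK ((Submodule.Quotient.mk_eq_zero _).1 h)
  · rintro ⟨x, hx⟩
    obtain ⟨x, rfl⟩ := Submodule.Quotient.mk_surjective _ x
    rw [mem_smulRange_iff hid] at hx
    obtain ⟨c, hc⟩ := he.exists_scalar_sub_mem_jacobson l (x : B)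
    refine ⟨c, Subtype.ext ?_⟩
    change c • Submodule.Quotient.mk (gen e l) = Submodule.Quotient.mk x
    rw [← hx, ← Submodule.Quotient.mk_smul, ← Submodule.Quotient.mk_smul, eq_comm,
      Submodule.Quotient.eq]
    refine hj _ ?_ ?_
    · rwa [mul_assoc, he.mem_projMod_iff.1 x.2] at hc
    · rw [smul_sub, smul_smul, he.idem, smul_comm, he.idem_smul_gen]

theorem properStandardKer_eq (l : Λ) :
    properStandardKer e l = Submodule.span B {x : ProjMod e l |
      (∃ w, l < w ∧ e w • x = x) ∨ ((x : B) ∈ Ring.jacobson B ∧ e l • x = x)} := by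
  refine le_antisymm (sInf_le ⟨?_, fun m hm hm' => ?_⟩) (le_sInf fun K ⟨h1, h2⟩ => ?_)
  · have := he.finite_projMod_quot (Submodule.span B {x : ProjMod e l |
      (∃ w, l < w ∧ e w • x = x) ∨ ((x : B) ∈ Ring.jacobson B ∧ e l • x = x)})
    rw [he.hasCompMult_iff]
    exact he.weight_quot_eq_one (he.gen_notMem_span l) fun x h1 h2 =>
      Submodule.subset_span (Or.inr ⟨h1, h2⟩)
  · rw [he.hasCompMult_zero_iff]
    refine fun x => Submodule.subset_span (Or.inl ⟨m, ?_, ?_⟩)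
    · exact lt_of_le_of_ne (not_lt.1 hm') hm.symm
    · rw [smul_smul, he.idem]
  · have := he.finite_projMod_quot K
    rw [he.hasCompMult_iff, weight, finrank_eq_one_iff'] at h1
    obtain ⟨v, hv, hv'⟩ := h1
    rw [Submodule.span_le]
    rintro x (⟨w, hw, hx⟩ | ⟨hx, hx'⟩)
    · rw [SetLike.mem_coe, ← hx]
      exact he.hasCompMult_zero_iff.1 (h2 w (ne_of_gt hw) (not_lt.2 hw.le)) x
    -- Since e_l (P_l / K) is a line, a radical x outside K would span it, so e_l - s x ∈ K for some
    -- scalar s. This element is invertible in the corner, so K would contain e_l and hence x.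
    · by_contra hxK
      have hid := he.orth.idem l
      obtain ⟨c, hc⟩ := hv' ⟨Submodule.Quotient.mk x, by
        rw [mem_smulRange_iff hid, ← Submodule.Quotient.mk_smul, hx']⟩
      obtain ⟨d, hd⟩ := hv' ⟨Submodule.Quotient.mk (gen e l), by
        rw [mem_smulRange_iff hid, ← Submodule.Quotient.mk_smul, he.idem_smul_gen]⟩
      have hc0 : c ≠ 0 := by
        rintro rfl
        rw [zero_smul, Subtype.ext_iff] at hc
        exact hxK ((Submodule.Quotient.mk_eq_zero _).1 hc.symm)
      have h3 : gen e l - (d * c⁻¹) • x ∈ K := by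
        rw [← Submodule.Quotient.eq, Submodule.Quotient.mk_smul]
        have hc1 : c • (v : ProjMod e l ⧸ K) = Submodule.Quotient.mk x := congrArg Subtype.val hc
        have hd1 : d • (v : ProjMod e l ⧸ K) = Submodule.Quotient.mk (gen e l) :=
          congrArg Subtype.val hd
        rw [← hc1, ← hd1, smul_smul, inv_mul_cancel_right₀ hc0]
      have hxl : e l * (x : B) = x := congrArg Subtype.val hx'
      obtain ⟨u, hu, -⟩ := he.exists_corner_inv (l := l) (y := e l - (d * c⁻¹) • (x : B)) (by
        rw [mul_sub, sub_mul, mul_smul_comm, smul_mul_assoc, hxl, he.mem_projMod_iff.1 x.2,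
          he.idem, he.idem]) (fun h => by
        have := add_mem h (Submodule.smul_of_tower_mem (Ring.jacobson B) (d * c⁻¹) hx)
        rw [sub_add_cancel] at this
        exact he.idem_notMem_jacobson l this)
      have h4 : gen e l ∈ K := by
        have h5 := K.smul_mem u h3
        have h6 : u • (gen e l - (d * c⁻¹) • x) = gen e l := Subtype.ext hu
        rwa [h6] at h5
      refine hxK ?_
      rw [← he.smul_gen x]
      exact K.smul_mem _ h4

theorem smul_properStandardMod_eq_zero {l m : Λ} (h : l < m) (d : ProperStandardMod e l) :
    e m • d = 0 := by
  obtain ⟨x, rfl⟩ := Submodule.Quotient.mk_surjective _ d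
  rw [← Submodule.Quotient.mk_smul, Submodule.Quotient.mk_eq_zero, he.properStandardKer_eq]
  exact Submodule.subset_span (Or.inl ⟨m, h, by rw [smul_smul, he.idem]⟩)

theorem finite_properStandardMod (l : Λ) : Module.Finite k (ProperStandardMod e l) :=
  he.finite_projMod_quot _

theorem weight_properStandardMod_of_lt {l m : Λ} (h : l < m) :
    weight k (e m) (ProperStandardMod e l) = 0 := by
  have := he.finite_properStandardMod l
  exact weight_eq_zero_iff.2 (he.smul_properStandardMod_eq_zero h)

theorem weight_properStandardMod_self (l : Λ) : weight k (e l) (ProperStandardMod e l) = 1 := by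
  refine he.weight_quot_eq_one ?_ fun x h1 h2 => ?_
  · rw [he.properStandardKer_eq]
    exact he.gen_notMem_span l
  · rw [he.properStandardKer_eq]
    exact Submodule.subset_span (Or.inr ⟨h1, h2⟩)

/-! ### Weights of modules filtered by proper standard modules -/

/-- Each generator of the kernel is fixed by some e_w with w ≥ l, and such w belong to U. -/
theorem properStandardKer_le_idemTrace {U : Set Λ} (hU : IsUpperSet U) {l : Λ} (hl : l ∈ U) :
    properStandardKer e l ≤ idemTrace e U (properStandardKer e l) := by
  intro x hx
  have hsub : {x : ProjMod e l |
      (∃ w, l < w ∧ e w • x = x) ∨ ((x : B) ∈ Ring.jacobson B ∧ e l • x = x)} ⊆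
      idemTrace e U (properStandardKer e l) := by
    intro x hx
    have hx' : x ∈ properStandardKer e l := by
      rw [he.properStandardKer_eq]
      exact Submodule.subset_span hx
    rcases hx with ⟨w, hw, hx⟩ | ⟨-, hx⟩
    · rw [SetLike.mem_coe, ← hx]
      exact smul_mem_idemTrace (hU hw.le hl) hx'
    · rw [SetLike.mem_coe, ← hx]
      exact smul_mem_idemTrace hl hx'
  have hle := Submodule.span_le.2 hsub
  rw [← he.properStandardKer_eq] at hle
  exact hle hx

variable {M : Type*} [AddCommGroup M] [Module k M] [Module B M] [IsScalarTower k B M]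
  [Module.Finite k M]

/-- A factor `Δ̄_m` with `m ∈ U` contributes to the trace of `U`. -/
theorem nonempty_subQuot_idemTrace_equiv {N₁ N₂ : Submodule B M} {m : Λ}
    (φ : SubQuot N₁ N₂ ≃ₗ[B] ProperStandardMod e m) {U : Set Λ} (hU : IsUpperSet U) (hm : m ∈ U) :
    Nonempty (SubQuot (idemTrace e U N₁) (idemTrace e U N₂) ≃ₗ[B] ProperStandardMod e m) := by
  let f : N₂ →ₗ[B] ProperStandardMod e m := φ.toLinearMap.comp (Submodule.mkQ _)
  have hf : Function.Surjective f := φ.surjective.comp (Submodule.mkQ_surjective _)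
  have hker : ∀ x : N₂, f x = 0 ↔ (x : M) ∈ N₁ := by
    intro x
    simp only [f, LinearMap.comp_apply, LinearEquiv.coe_coe, LinearEquiv.map_eq_zero_iff,
      Submodule.mkQ_apply, Submodule.Quotient.mk_eq_zero]
    rfl
  obtain ⟨a, ha⟩ := hf (Submodule.Quotient.mk (gen e m))
  have hea : f (e m • a) = Submodule.Quotient.mk (gen e m) := by
    rw [map_smul, ha, ← Submodule.Quotient.mk_smul, he.idem_smul_gen]
  let f' : idemTrace e U N₂ →ₗ[B] ProperStandardMod e m :=
    f.comp (Submodule.inclusion (idemTrace_le N₂))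
  have key : ∀ y ∈ idemTrace e U N₂, ∃ b : B, y - b • e m • (a : M) ∈ idemTrace e U N₁ := by
    intro y hy
    refine Submodule.span_induction ?_ ?_ ?_ ?_ hy
    · rintro _ ⟨z, hz, y, hy, rfl⟩
      obtain ⟨b, hb⟩ := Submodule.Quotient.mk_surjective _ (f ⟨y, hy⟩)
      refine ⟨e z * (b : B), ?_⟩
      rw [mul_smul, ← smul_sub]
      refine smul_mem_idemTrace hz ?_
      exact (hker (⟨y, hy⟩ - (b : B) • (e m • a))).1 (by
        rw [map_sub, map_smul, hea, ← hb, ← Submodule.Quotient.mk_smul, he.smul_gen, sub_self])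
    · exact ⟨0, by simp⟩
    · rintro x y _ _ ⟨b, hb⟩ ⟨c, hc⟩
      refine ⟨b + c, ?_⟩
      have := add_mem hb hc
      rwa [add_smul, add_sub_add_comm]
    · rintro c x _ ⟨b, hb⟩
      refine ⟨c * b, ?_⟩
      rw [mul_smul, ← smul_sub]
      exact Submodule.smul_mem _ _ hb
  refine ⟨subQuotEquiv f' ?_ ?_⟩
  · intro d
    obtain ⟨d, rfl⟩ := Submodule.Quotient.mk_surjective _ d
    refine ⟨(d : B) • ⟨e m • (a : M), smul_mem_idemTrace hm a.2⟩, ?_⟩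
    rw [map_smul]
    change (d : B) • f (e m • a) = _
    rw [hea, ← Submodule.Quotient.mk_smul, he.smul_gen]
  · rintro ⟨y, hy⟩
    constructor
    · intro h
      have h1 : f ⟨y, idemTrace_le _ hy⟩ = 0 := h
      obtain ⟨b, hb⟩ := key y hy
      have h2 : f (b • e m • a) = 0 := by
        have h3 := (hker (⟨y, idemTrace_le _ hy⟩ - b • e m • a)).2 (idemTrace_le _ hb)
        rwa [map_sub, h1, zero_sub, neg_eq_zero] at h3
      rw [map_smul, hea, ← Submodule.Quotient.mk_smul, Submodule.Quotient.mk_eq_zero] at h2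
      -- Modulo the trace of N₁, a trace element that dies in Δ̄_m is the value of x ↦ x a at a
      -- point of the proper standard kernel. That kernel equals its own U-trace and is mapped into
      -- N₁, so the value lies in the trace of N₁.
      let g : ProjMod e m →ₗ[B] M := (LinearMap.toSpanSingleton B M (a : M)).comp
        (ProjMod e m).subtype
      have hg : ∀ x ∈ properStandardKer e m, g x ∈ N₁ := by
        intro x hx
        have h4 : f ((x : B) • (e m • a)) = 0 := by
          rw [map_smul, hea, ← Submodule.Quotient.mk_smul, he.smul_gen,
            Submodule.Quotient.mk_eq_zero]
          exact hx
        have h5 := (hker _).1 h4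
        change (x : B) • (e m • (a : M)) ∈ N₁ at h5
        rwa [smul_smul, he.mem_projMod_iff.1 x.2] at h5
      have h6 : idemTrace e U (properStandardKer e m) ≤ (idemTrace e U N₁).comap g :=
        idemTrace_le_iff.2 fun z hz n hn => by
          rw [Submodule.mem_comap, map_smul]
          exact smul_mem_idemTrace hz (hg n hn)
      have h7 := h6 (he.properStandardKer_le_idemTrace hU hm h2)
      have h8 : g (b • gen e m) = b • e m • (a : M) := by
        rw [map_smul]; rfl
      rw [Submodule.mem_comap, h8] at h7
      simpa using add_mem hb h7
    · intro h
      exact (hker _).2 (idemTrace_le _ h)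

/-- Here n x counts the factors Δ̄_x; one n must serve all U and w, because later several such
equations are compared. A factor Δ̄_m contributes to the trace if m ∈ U and to the quotient if m ∉
U. -/
theorem exists_weight_eq (h : HasFiltrationBy (A := B) M (ProperStandardMod e) Set.univ) :
    ∃ n : Λ → ℕ, ∀ (U : Finset Λ), IsUpperSet (U : Set Λ) → ∀ w, weight k (e w) M =
      weight k (e w) (idemTrace e U (⊤ : Submodule B M)) +
        ∑ x ∈ Uᶜ, n x * weight k (e w) (ProperStandardMod e x) := by
  have h1 := h.induction (fun N => ∃ n : Λ → ℕ, ∀ (U : Finset Λ), IsUpperSet (U : Set Λ) → ∀ w,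
    weight k (e w) N = weight k (e w) (idemTrace e U N) +
        ∑ x ∈ Uᶜ, n x * weight k (e w) (ProperStandardMod e x)) ?_ ?_
  · obtain ⟨n, hn⟩ := h1
    refine ⟨n, fun U hU w => ?_⟩
    rw [← hn U hU w]
    exact (weight_congr _ Submodule.topEquiv).symm
  · refine ⟨0, fun U hU w => ?_⟩
    have : idemTrace e U (⊥ : Submodule B M) = ⊥ := eq_bot_iff.2 (idemTrace_le _)
    rw [this]
    simp
  · rintro N₁ N₂ hle m - φ ⟨n, hn⟩
    refine ⟨n + Pi.single m 1, fun U hU w => ?_⟩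
    rw [weight_subQuot (he.orth.idem w) hle, weight_congr _ φ, hn U hU w]
    by_cases hm : m ∈ U
    · obtain ⟨ψ⟩ := he.nonempty_subQuot_idemTrace_equiv φ hU hm
      rw [weight_subQuot (he.orth.idem w) (idemTrace_mono hle), weight_congr _ ψ, add_right_comm]
      congr 1
      refine Finset.sum_congr rfl fun x hx => ?_
      have : x ≠ m := fun h => Finset.mem_compl.1 hx (h ▸ hm)
      simp [Pi.single_eq_of_ne this]
    · have heq : idemTrace e U N₂ = idemTrace e U N₁ := by
        refine le_antisymm (idemTrace_le_iff.2 fun z hz y hy => ?_) (idemTrace_mono hle)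
        have hzm : m < z := not_le.1 fun h => hm (hU h hz)
        have h1 : e z • y ∈ N₁ := by
          have h2 : φ (Submodule.Quotient.mk (e z • ⟨y, hy⟩)) = 0 := by
            rw [Submodule.Quotient.mk_smul, map_smul]
            exact he.smul_properStandardMod_eq_zero hzm _
          rw [LinearEquiv.map_eq_zero_iff, Submodule.Quotient.mk_eq_zero] at h2
          exact h2
        have := smul_mem_idemTrace (e := e) hz h1
        rwa [smul_smul, he.idem] at this
      rw [heq, add_assoc]
      congr 1
      simp only [Pi.add_apply, add_mul, Finset.sum_add_distrib]
      congr 1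
      rw [Finset.sum_eq_single m]
      · simp
      · intro x _ hx
        simp [Pi.single_eq_of_ne hx]
      · intro h
        exact absurd (Finset.mem_compl.2 hm) h

end

end SplitDirected

/-! ### Right bases from proper standard filtrations -/

namespace SplitDirected

variable {k : Type u} [Field k] {B : Type v} [Ring B] [Algebra k B]
  {Λ : Type w} [Fintype Λ] {e : Λ → B}

variable (k) in
/-- The corner `e_l A e_l`. -/
def corner (e : Λ → B) (l : Λ) : Submodule k B :=
  LinearMap.range ((LinearMap.mulLeft k (e l)).comp (LinearMap.mulRight k (e l)))

section
variable (he : SplitDirected k e)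
include he

theorem mem_corner_iff {l : Λ} {x : B} : x ∈ corner k e l ↔ e l * x * e l = x := by
  constructor
  · rintro ⟨y, rfl⟩
    simp only [LinearMap.comp_apply, LinearMap.mulLeft_apply, LinearMap.mulRight_apply, mul_assoc,
      he.idem, he.idem_assoc]
  · intro h
    exact ⟨x, by simpa [mul_assoc] using h⟩

theorem diag_eq_zero_of_mem_idemTrace {U : Set Λ} {l : Λ} (hl : l ∉ U) {x : B}
    (hx : x ∈ idemTrace e U (⊤ : Submodule B B)) : e l * x * e l = 0 := by
  have h : ∀ b : B, e l * (b * x) * e l = 0 := by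
    refine Submodule.span_induction ?_ ?_ ?_ ?_ hx
    · rintro _ ⟨z, hz, n, -, rfl⟩ b
      have := he.loop_eq_zero (l := z) (m := l) (fun h => hl (h ▸ hz)) b n
      simpa only [mul_assoc, smul_eq_mul] using this
    · intro b; simp
    · intro x y _ _ h1 h2 b
      rw [mul_add, mul_add, add_mul, h1, h2, add_zero]
    · intro a x _ h b
      rw [smul_eq_mul, ← mul_assoc b, h]
  simpa using h 1

/-- Elements of `e_z J ^ 2 e_m` factor through vertices other than `z` and `m`. -/
theorem mem_idemTrace_of_mem_sq {z m : Λ} {x : B} (hx : x ∈ offDiagIdeal e ^ 2) :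
    e z * x * e m ∈ idemTrace e ({z, m}ᶜ : Set Λ) (⊤ : Submodule B B) := by
  rw [Submodule.pow_succ, Submodule.pow_one] at hx
  refine Submodule.mul_induction_on hx (fun u hu v hv => ?_) fun u v hu hv => ?_
  · have h1 : e z * (u * v) * e m = ∑ w, e z * u * (e w * (v * e m)) := by
      rw [← Finset.mul_sum, he.sum_mul]
      simp only [mul_assoc]
    rw [h1]
    refine sum_mem fun w _ => ?_
    by_cases hwz : w = z
    · rw [hwz, ← mul_assoc, he.diag_eq_zero_of_mem hu, zero_mul]
      exact zero_mem _
    by_cases hwm : w = m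
    · rw [hwm, ← mul_assoc (e m), he.diag_eq_zero_of_mem hv, mul_zero]
      exact zero_mem _
    exact Submodule.smul_mem _ _ (idem_mul_mem_idemTrace (by simp [hwz, hwm]) _)
  · rw [mul_add, add_mul]
    exact add_mem hu hv

theorem mem_sq_of_mem_idemTrace {z m : Λ} {x : B}
    (hx : x ∈ idemTrace e ({z, m}ᶜ : Set Λ) (⊤ : Submodule B B)) :
    e z * x * e m ∈ offDiagIdeal e ^ 2 := by
  have h : ∀ b : B, e z * (b * x) * e m ∈ offDiagIdeal e ^ 2 := by
    refine Submodule.span_induction ?_ ?_ ?_ ?_ hx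
    · rintro _ ⟨w, hw, n, -, rfl⟩ b
      have hwz : w ≠ z := fun h => hw (by simp [h])
      have hwm : w ≠ m := fun h => hw (by simp [h])
      have := GrPiece.mul_mem (mem_pow_one_iff.2 (mem_offDiagIdeal (e := e) hwz b))
        (mem_pow_one_iff.2 (mem_offDiagIdeal (e := e) hwm.symm n))
      simpa only [mul_assoc, smul_eq_mul, he.idem_assoc] using this
    · intro b; simp
    · intro x y _ _ h1 h2 b
      rw [mul_add, mul_add, add_mul]
      exact add_mem (h1 b) (h2 b)
    · intro a x _ h b
      rw [smul_eq_mul, ← mul_assoc b]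
      exact h _
  simpa using h 1

variable [Module.Finite k B]

theorem finrank_corner_le {l : Λ} {U : Set Λ} (hl : l ∉ U) :
    Module.finrank k (corner k e l) ≤
      weight k (e l) (B ⧸ idemTrace e U (⊤ : Submodule B B)) := by
  let f : corner k e l →ₗ[k] smulRange k (e l) (B ⧸ idemTrace e U (⊤ : Submodule B B)) :=
    (((Submodule.mkQ _).restrictScalars k).comp (corner k e l).subtype).codRestrict _ fun x => by
      rw [mem_smulRange_iff (he.orth.idem l)]
      change e l • Submodule.Quotient.mk (x : B) = Submodule.Quotient.mk (x : B)
      rw [← Submodule.Quotient.mk_smul]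
      congr 1
      have := he.mem_corner_iff.1 x.2
      rw [smul_eq_mul, ← this]
      simp only [mul_assoc, he.idem_assoc]
  refine LinearMap.finrank_le_finrank_of_injective (f := f) ?_
  rw [injective_iff_map_eq_zero]
  intro x hx
  have h1 : (x : B) ∈ idemTrace e U (⊤ : Submodule B B) :=
    (Submodule.Quotient.mk_eq_zero _).1 (congrArg Subtype.val hx)
  refine Subtype.ext ?_
  rw [← he.mem_corner_iff.1 x.2, he.diag_eq_zero_of_mem_idemTrace hl h1]
  rfl

/-- Let t₀ be the trace of {z, m}ᶜ and n_m the number of factors Δ̄_m in A. As e_m Δ̄_z = 0, one has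
n_m = dim e_m (A / t₀), which is at least dim e_m A e_m. The layer between the two traces has
exactly n_m dim e_z Δ̄_m as the dimension of its e_z-part. -/
theorem finrank_mul_weight_le [LinearOrder Λ] {z m : Λ} (hzm : z ≠ m) (hz : ∀ w, w ≠ z → z < w)
    (hm : ∀ w, w ≠ z → w ≠ m → m < w)
    (h : HasFiltrationBy (A := B) B (ProperStandardMod e) Set.univ) :
    weight k (e z) (ProperStandardMod e m) * Module.finrank k (corner k e m) ≤
      weight k (e z) (SubQuot (idemTrace e ({z, m}ᶜ : Set Λ) (⊤ : Submodule B B))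
        (idemTrace e ({z}ᶜ : Set Λ) (⊤ : Submodule B B))) := by
  have hle : idemTrace e ({z, m}ᶜ : Set Λ) (⊤ : Submodule B B) ≤
      idemTrace e ({z}ᶜ : Set Λ) (⊤ : Submodule B B) :=
    idemTrace_le_iff.2 fun w hw n _ => smul_mem_idemTrace (by
      simp only [Set.mem_compl_iff, Set.mem_insert_iff, Set.mem_singleton_iff, not_or] at hw ⊢
      exact hw.1) Submodule.mem_top
  have hU0 : IsUpperSet (({z, m}ᶜ : Finset Λ) : Set Λ) := by
    intro a b hab ha
    simp only [Finset.coe_compl, Finset.coe_insert, Finset.coe_singleton, Set.mem_compl_iff,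
      Set.mem_insert_iff, Set.mem_singleton_iff, not_or] at ha ⊢
    have h1 := hm a ha.1 ha.2
    have h2 := hz a ha.1
    exact ⟨(h2.trans_le hab).ne', (h1.trans_le hab).ne'⟩
  have hU1 : IsUpperSet (({z}ᶜ : Finset Λ) : Set Λ) := by
    intro a b hab ha
    simp only [Finset.coe_compl, Finset.coe_singleton, Set.mem_compl_iff,
      Set.mem_singleton_iff] at ha ⊢
    exact ((hz a ha).trans_le hab).ne'
  obtain ⟨n, hn⟩ := he.exists_weight_eq (M := B) h
  have e1 := hn _ hU0 m
  have e2 := hn _ hU0 z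
  have e3 := hn _ hU1 z
  rw [compl_compl] at e1 e2 e3
  rw [Finset.sum_pair hzm] at e1 e2
  rw [Finset.sum_singleton] at e3
  rw [he.weight_properStandardMod_of_lt (hz m hzm.symm), he.weight_properStandardMod_self] at e1
  rw [he.weight_properStandardMod_self] at e2 e3
  have c0 : (({z, m}ᶜ : Finset Λ) : Set Λ) = {z, m}ᶜ := by rw [Finset.coe_compl, Finset.coe_pair]
  have c1 : (({z}ᶜ : Finset Λ) : Set Λ) = {z}ᶜ := by simp
  rw [c0] at e1 e2
  rw [c1] at e3
  have e4 := weight_add (k := k) (M := B) (he.orth.idem m)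
    (idemTrace e ({z, m}ᶜ : Set Λ) (⊤ : Submodule B B))
  have e5 := weight_subQuot (k := k) (he.orth.idem z) hle
  have e6 := he.finrank_corner_le (l := m) (U := ({z, m}ᶜ : Set Λ)) (by simp)
  have e7 : Module.finrank k (corner k e m) ≤ n m := by omega
  have e8 := Nat.mul_le_mul_right (weight k (e z) (ProperStandardMod e m)) e7
  rw [mul_comm]
  omega

/-- Generators of the kernel fixed by e_w with w > m go into the trace. Those in e_m rad P_m
contribute a radical corner factor on the right. -/
theorem idem_mul_mem_of_mem_properStandardKer [LinearOrder Λ] {z m : Λ} {U : Set Λ}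
    (hU : ∀ w, m < w → w ∈ U) {x : ProjMod e m} (hx : x ∈ properStandardKer e m) :
    e z * (x : B) ∈ (idemTrace e U (⊤ : Submodule B B)).restrictScalars k ⊔
      Submodule.span k {y | ∃ b, ∃ ν ∈ Ring.jacobson B, y = e z * b * e m * (e m * ν * e m)} := by
  suffices H : ∀ b : B, e z * (b * (x : B)) ∈
      (idemTrace e U (⊤ : Submodule B B)).restrictScalars k ⊔ Submodule.span k
        {y | ∃ b, ∃ ν ∈ Ring.jacobson B, y = e z * b * e m * (e m * ν * e m)} by
    simpa using H 1
  rw [he.properStandardKer_eq] at hx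
  refine Submodule.span_induction ?_ ?_ ?_ ?_ hx
  · rintro x (⟨w, hw, hx⟩ | ⟨hx, hx'⟩) b
    · refine Submodule.mem_sup_left ?_
      have hx1 : e w * (x : B) = x := congrArg Subtype.val hx
      rw [← hx1, ← mul_assoc]
      exact Submodule.smul_mem _ (e z * b) (idem_mul_mem_idemTrace (hU w hw) (x : B))
    · refine Submodule.mem_sup_right (Submodule.subset_span ⟨b, x, hx, ?_⟩)
      have hx1 : e m * (x : B) = x := congrArg Subtype.val hx'
      rw [hx1, he.mem_projMod_iff.1 x.2, mul_assoc, hx1, mul_assoc]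
  · intro b; simp
  · intro x y _ _ h1 h2 b
    rw [Submodule.coe_add, mul_add, mul_add]
    exact add_mem (h1 b) (h2 b)
  · intro a x _ h b
    have := h (b * a)
    rwa [mul_assoc b] at this

omit he [Module.Finite k B] in
variable (k) in
/-- The map `(x_q) ↦ ∑ b_q x_q` on tuples of elements of `e_m A e_m`. -/
def cornerSum (e : Λ → B) (m : Λ) {d : ℕ} (b : Fin d → B) : (Fin d → corner k e m) →ₗ[k] B :=
  ∑ q, (LinearMap.mulLeft k (b q)).comp ((corner k e m).subtype.comp (LinearMap.proj q))

omit he [Module.Finite k B] in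
theorem cornerSum_apply (m : Λ) {d : ℕ} (b : Fin d → B) (x : Fin d → corner k e m) :
    cornerSum k e m b x = ∑ q, b q * (x q : B) := by
  simp [cornerSum]

theorem mul_corner_mem {m : Λ} {d : ℕ} {b : Fin d → B} {U : Set Λ} {x ν : B}
    (hx : x ∈ LinearMap.range (cornerSum k e m b) ⊔
      (idemTrace e U (⊤ : Submodule B B)).restrictScalars k) (hν : ν ∈ corner k e m) :
    x * ν ∈ LinearMap.range (cornerSum k e m b) ⊔
      (idemTrace e U (⊤ : Submodule B B)).restrictScalars k := by
  obtain ⟨_, ⟨y, rfl⟩, t, ht, rfl⟩ := Submodule.mem_sup.1 hx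
  rw [add_mul]
  refine add_mem (Submodule.mem_sup_left ⟨fun q => ⟨y q * ν, ?_⟩, ?_⟩)
    (Submodule.mem_sup_right (mul_mem_idemTrace ht _))
  · rw [he.mem_corner_iff] at hν ⊢
    have h1 := he.mem_corner_iff.1 (y q).2
    have h2 : e m * (y q : B) = y q := by
      rw [← h1]; simp only [mul_assoc, he.idem_assoc]
    have h3 : ν * e m = ν := by
      rw [← hν]; simp only [mul_assoc, he.idem]
    rw [← mul_assoc, h2, mul_assoc, h3]
  · simp only [cornerSum_apply, Finset.sum_mul, mul_assoc]

/-- Representatives of a basis of `e_z Δ̄_m` generate `e_z A e_m` modulo a trace. -/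
theorem exists_corner_generators [LinearOrder Λ] (z m : Λ) {U : Set Λ} (hU : ∀ w, m < w → w ∈ U) :
    ∃ b : Fin (weight k (e z) (ProperStandardMod e m)) → B, (∀ q, e z * b q * e m = b q) ∧
      ∀ y, e z * y * e m ∈ LinearMap.range (cornerSum k e m b) ⊔
        (idemTrace e U (⊤ : Submodule B B)).restrictScalars k := by
  have := he.finite_properStandardMod m
  let β : Module.Basis (Fin (weight k (e z) (ProperStandardMod e m))) k
    (smulRange k (e z) (ProperStandardMod e m)) := Module.finBasis k _
  have hex : ∀ q, ∃ x : ProjMod e m, e z • x = x ∧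
      Submodule.Quotient.mk x = (β q : ProperStandardMod e m) := by
    intro q
    obtain ⟨x, hx⟩ := Submodule.Quotient.mk_surjective _ (β q : ProperStandardMod e m)
    refine ⟨e z • x, by rw [smul_smul, he.idem], ?_⟩
    rw [Submodule.Quotient.mk_smul, hx]
    exact (mem_smulRange_iff (he.orth.idem z)).1 (β q).2
  choose x hx hxβ using hex
  have hxz : ∀ q, e z * (x q : B) = x q := fun q => congrArg Subtype.val (hx q)
  refine ⟨fun q => x q, fun q => ?_, ?_⟩
  · rw [mul_assoc, he.mem_projMod_iff.1 (x q).2]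
    exact hxz q
  set T := LinearMap.range (cornerSum k e m fun q => (x q : B)) ⊔
        (idemTrace e U (⊤ : Submodule B B)).restrictScalars k with hT
  have hmem : ∀ y, e z * y * e m ∈ T ⊔ Submodule.span k
      {y | ∃ b, ∃ ν ∈ Ring.jacobson B, y = e z * b * e m * (e m * ν * e m)} := by
    intro y
    let y' : ProjMod e m := ⟨e z * y * e m, he.mul_idem_mem _ _⟩
    have hy' : e z • y' = y' := Subtype.ext (by
      change e z * (e z * y * e m) = e z * y * e m
      simp only [mul_assoc, he.idem_assoc])
    let v : smulRange k (e z) (ProperStandardMod e m) := ⟨Submodule.Quotient.mk y', by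
      rw [mem_smulRange_iff (he.orth.idem z), ← Submodule.Quotient.mk_smul, hy']⟩
    have h1 : y' - ∑ q, β.repr v q • x q ∈ properStandardKer e m := by
      rw [← Submodule.Quotient.eq]
      have h2 := congrArg Subtype.val (β.sum_repr v)
      rw [Submodule.coe_sum] at h2
      refine h2.symm.trans ?_
      change _ = (properStandardKer e m).mkQ _
      rw [map_sum]
      refine Finset.sum_congr rfl fun q _ => ?_
      change β.repr v q • (β q : ProperStandardMod e m) =
        Submodule.Quotient.mk (β.repr v q • x q)
      rw [Submodule.Quotient.mk_smul, hxβ]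
    have h3 := he.idem_mul_mem_of_mem_properStandardKer (z := z) hU h1
    have h4 : e z * ((y' - ∑ q, β.repr v q • x q : ProjMod e m) : B) =
        e z * y * e m - ∑ q, β.repr v q • (x q : B) := by
      rw [Submodule.coe_sub, mul_sub, Submodule.coe_sum, Finset.mul_sum]
      congr 1
      · exact congrArg Subtype.val hy'
      · refine Finset.sum_congr rfl fun q _ => ?_
        change e z * (β.repr v q • (x q : B)) = _
        rw [mul_smul_comm, hxz]
    rw [h4] at h3
    have h5 : ∑ q, β.repr v q • (x q : B) ∈ T := by
      refine Submodule.mem_sup_left ⟨fun q => ⟨β.repr v q • e m, ?_⟩, ?_⟩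
      · rw [he.mem_corner_iff, mul_smul_comm, smul_mul_assoc, he.idem, he.idem]
      · rw [cornerSum_apply]
        refine Finset.sum_congr rfl fun q _ => ?_
        rw [mul_smul_comm, he.mem_projMod_iff.1 (x q).2]
    have h6 := add_mem ((sup_le_sup_right le_sup_right _ : _ ≤ T ⊔ _) h3)
      (Submodule.mem_sup_left h5)
    rwa [sub_add_cancel] at h6
  -- Nakayama's lemma over e_m A e_m: an element lies in T up to terms with a radical right factor,
  -- and expanding these repeatedly raises the power N - i of the radical until it is zero.
  obtain ⟨N, hN⟩ := isNilpotent_jacobson (B := B) k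
  have key : ∀ i ≤ N, ∀ ν ∈ Ring.jacobson B ^ (N - i), ∀ y,
      e z * y * e m * (e m * ν * e m) ∈ T := by
    intro i
    induction i with
    | zero =>
      intro _ ν hν y
      rw [Nat.sub_zero, hN] at hν
      have : ν = 0 := by simpa using hν
      simp [this]
    | succ i ih =>
      intro hi ν hν y
      have hνc : e m * ν * e m ∈ corner k e m := by
        rw [he.mem_corner_iff]; simp only [mul_assoc, he.idem, he.idem_assoc]
      obtain ⟨τ, hτ, h, hh, hsum⟩ := Submodule.mem_sup.1 (hmem y)
      rw [← hsum, add_mul]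
      refine add_mem (he.mul_corner_mem hτ hνc) ?_
      refine Submodule.span_induction ?_ ?_ ?_ ?_ hh
      · rintro _ ⟨b, μ, hμ, rfl⟩
        have h1 : μ * (e m * ν) ∈ Ring.jacobson B ^ (N - i) := by
          have h2 := GrPiece.mul_mem (I := Ring.jacobson B) (i := 1) (j := N - (i + 1))
            (mem_pow_one_iff.2 hμ) (Ideal.mul_mem_left _ (e m) hν)
          rwa [show 1 + (N - (i + 1)) = N - i by omega] at h2
        have := ih (by omega) _ h1 b
        simpa only [mul_assoc, he.idem_assoc] using this
      · rw [zero_mul]; exact zero_mem _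
      · intro u v _ _ hu hv
        rw [add_mul]; exact add_mem hu hv
      · intro c u _ hu
        rw [smul_mul_assoc]; exact Submodule.smul_mem _ _ hu
  intro y
  have := key N le_rfl 1 (by rw [Nat.sub_self]; exact GrPiece.mem_pow_zero _) y
  simpa only [mul_one, mul_assoc, he.idem] using this

/-- With t₁ and t₀ the traces of {z}ᶜ and {z, m}ᶜ and d = dim e_z Δ̄_m, lifts of a basis of e_z Δ̄_m
give a surjection from (e_m A e_m)^d onto e_z (t₁ / t₀). `finrank_mul_weight_le` makes it bijective,
and e_z t₀ e_m = e_z J^2 e_m translates this into a statement modulo J^2. -/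
theorem exists_corner_basis
    (h : ∀ _ : LinearOrder Λ, HasFiltrationBy (A := B) B (ProperStandardMod e) Set.univ)
    {z m : Λ} (hzm : z ≠ m) :
    ∃ (d : ℕ) (b : Fin d → B), (∀ q, e z * b q * e m = b q) ∧
      (∀ y, ∃ x : Fin d → B, e z * y * e m - ∑ q, b q * x q ∈ offDiagIdeal e ^ 2) ∧
      ∀ x : Fin d → B, (∀ q, e m * x q * e m = x q) → ∑ q, b q * x q ∈ offDiagIdeal e ^ 2 →
        ∀ q, x q = 0 := by
  classical
  obtain ⟨s, hs, -⟩ := exists_linearOrder (fun w => if w = z then 0 else if w = m then 1 else 2)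
    (fun _ : Λ => 0)
  have hz : ∀ w, w ≠ z → z < w := fun w hw => hs z w (by
    by_cases h : w = m <;> simp [hw, h, hzm.symm])
  have hm : ∀ w, w ≠ z → w ≠ m → m < w := fun w hw hw' => hs m w (by
    simp [hw, hw', hzm.symm])
  have hU : ∀ w, m < w → w ∈ ({z, m}ᶜ : Set Λ) := by
    intro w hw
    simp only [Set.mem_compl_iff, Set.mem_insert_iff, Set.mem_singleton_iff, not_or]
    exact ⟨((hz m hzm.symm).trans hw).ne', hw.ne'⟩
  obtain ⟨b, hb, hspan⟩ := he.exists_corner_generators z m hU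
  have hdim := he.finrank_mul_weight_le hzm hz hm (h s)
  have hzb : ∀ q, e z * b q = b q := fun q => by
    rw [← hb q]; simp only [mul_assoc, he.idem_assoc]
  have hsumz : ∀ x : Fin _ → corner k e m,
      e z * cornerSum k e m b x * e m = cornerSum k e m b x := by
    intro x
    simp only [cornerSum_apply, Finset.mul_sum, Finset.sum_mul]
    refine Finset.sum_congr rfl fun q _ => ?_
    rw [← mul_assoc, hzb, mul_assoc]
    congr 1
    have := he.mem_corner_iff.1 (x q).2
    rw [← this]; simp only [mul_assoc, he.idem]
  refine ⟨_, b, hb, fun y => ?_, fun x hx hsum => ?_⟩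
  · obtain ⟨_, ⟨x, rfl⟩, t, ht, hxt⟩ := Submodule.mem_sup.1 (hspan y)
    refine ⟨fun q => x q, ?_⟩
    have h1 := he.mem_sq_of_mem_idemTrace (z := z) (m := m) ht
    have h2 : t = e z * y * e m - cornerSum k e m b x := by rw [← hxt]; abel
    have h3 : e z * t * e m = t := by
      rw [h2, mul_sub, sub_mul, hsumz]
      simp only [mul_assoc, he.idem, he.idem_assoc]
    rwa [h3, h2, cornerSum_apply] at h1
  · set t₀ := idemTrace e ({z, m}ᶜ : Set Λ) (⊤ : Submodule B B) with ht₀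
    set t₁ := idemTrace e ({z}ᶜ : Set Λ) (⊤ : Submodule B B) with ht₁
    have hmem1 : ∀ x : Fin _ → corner k e m, cornerSum k e m b x ∈ t₁ := by
      intro x
      rw [cornerSum_apply]
      refine sum_mem fun q _ => mul_mem_idemTrace ?_ _
      rw [← hb q]
      have h1 : e m ∈ t₁ := by
        have := idem_mul_mem_idemTrace (e := e) (U := ({z}ᶜ : Set Λ)) (z := m)
          (by simpa using hzm.symm) (1 : B)
        rwa [mul_one] at this
      exact Submodule.smul_mem _ (e z * b q) h1
    let Ψ : (Fin _ → corner k e m) →ₗ[k] smulRange k (e z) (SubQuot t₀ t₁) :=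
      ((Submodule.mkQ (t₀.submoduleOf t₁)).restrictScalars k ∘ₗ
        ((cornerSum k e m b).codRestrict (t₁.restrictScalars k) hmem1)).codRestrict _ (by
        intro x
        rw [mem_smulRange_iff (he.orth.idem z)]
        change e z • Submodule.Quotient.mk (⟨cornerSum k e m b x, hmem1 x⟩ : t₁) =
          Submodule.Quotient.mk (⟨cornerSum k e m b x, hmem1 x⟩ : t₁)
        rw [← Submodule.Quotient.mk_smul]
        congr 1
        refine Subtype.ext ?_
        change e z * cornerSum k e m b x = cornerSum k e m b x
        rw [← hsumz x]; simp only [mul_assoc, he.idem_assoc])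
    have hΨ : ∀ x, (Ψ x : SubQuot t₀ t₁) =
        Submodule.Quotient.mk (⟨cornerSum k e m b x, hmem1 x⟩ : t₁) := fun x => rfl
    have hT : ∀ y ∈ t₁, ∀ c : B, e z * (c * y) ∈ LinearMap.range (cornerSum k e m b) ⊔
        t₀.restrictScalars k := by
      intro y hy
      refine Submodule.span_induction ?_ ?_ ?_ ?_ hy
      · rintro _ ⟨w, hw, n, -, rfl⟩ c
        have hwz : w ≠ z := hw
        by_cases hwm : w = m
        · rw [← he.mul_sum (e z * (c * (e w • n)))]
          refine sum_mem fun y _ => ?_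
          -- Split by columns y: y = z gives a loop at z, which is zero, y = m is covered by the
          -- generators, and any other column lies in t₀.
          by_cases hyz : y = z
          · have := he.loop_eq_zero (l := w) (m := z) hwz c n
            rw [hyz]
            simp only [smul_eq_mul, mul_assoc] at this ⊢
            rw [this]
            exact zero_mem _
          by_cases hym : y = m
          · rw [hym]; exact hspan _
          refine Submodule.mem_sup_right ?_
          have := idem_mul_mem_idemTrace (e := e) (U := ({z, m}ᶜ : Set Λ)) (z := y)
            (by simp [hyz, hym]) (1 : B)
          rw [mul_one] at this
          exact Submodule.smul_mem _ _ this
        · refine Submodule.mem_sup_right ?_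
          rw [← mul_assoc]
          exact Submodule.smul_mem _ (e z * c) (idem_mul_mem_idemTrace (e := e)
            (U := ({z, m}ᶜ : Set Λ)) (z := w) (by simp [hwz, hwm]) n)
      · intro c; simp
      · intro u v _ _ hu hv c
        rw [mul_add, mul_add]; exact add_mem (hu c) (hv c)
      · intro a u _ hu c
        rw [smul_eq_mul, ← mul_assoc c]; exact hu _
    have hsurj : Function.Surjective Ψ := by
      rintro ⟨v, hv⟩
      obtain ⟨⟨y, hy⟩, rfl⟩ := Submodule.Quotient.mk_surjective _ v
      obtain ⟨_, ⟨x, rfl⟩, t, ht, hxt⟩ := Submodule.mem_sup.1 (hT y hy 1)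
      refine ⟨x, Subtype.ext ?_⟩
      rw [hΨ]
      rw [mem_smulRange_iff (he.orth.idem z)] at hv
      change _ = Submodule.Quotient.mk (⟨y, hy⟩ : t₁)
      rw [← hv, ← Submodule.Quotient.mk_smul, eq_comm, Submodule.Quotient.eq]
      change e z * y - cornerSum k e m b x ∈ t₀
      rw [one_mul] at hxt
      rw [← hxt, add_sub_cancel_left]
      exact ht
    have hfin : Module.finrank k (Fin (weight k (e z) (ProperStandardMod e m)) → corner k e m) =
        Module.finrank k (smulRange k (e z) (SubQuot t₀ t₁)) := by
      refine le_antisymm ?_ (LinearMap.finrank_le_finrank_of_surjective hsurj)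
      rw [Module.finrank_pi_fintype, Finset.sum_const, Finset.card_univ, Fintype.card_fin,
        smul_eq_mul]
      exact hdim
    have hinj := (LinearMap.injective_iff_surjective_of_finrank_eq_finrank hfin).2 hsurj
    have hzero : (fun q => (⟨x q, he.mem_corner_iff.2 (hx q)⟩ : corner k e m)) = 0 := by
      apply hinj
      rw [map_zero]
      refine Subtype.ext ?_
      rw [hΨ]
      change Submodule.Quotient.mk _ = 0
      rw [Submodule.Quotient.mk_eq_zero]
      change cornerSum k e m b _ ∈ t₀
      rw [← hsumz]
      refine he.mem_idemTrace_of_mem_sq ?_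
      rw [cornerSum_apply]
      exact hsum
    intro q
    exact congrArg Subtype.val (congrFun hzero q)

/-- The pieces e_z (J / J^2) e_m are independent of each other, so each may use its own linear
order. The diagonal pieces vanish. -/
theorem hasRightBasis_of_forall_hasFiltrationBy
    (h : ∀ _ : LinearOrder Λ, HasFiltrationBy (A := B) B (ProperStandardMod e) Set.univ) :
    HasRightBasis e := by
  classical
  have hex : ∀ p : Λ × Λ, ∃ (d : ℕ) (b : Fin d → B), (∀ q, e p.1 * b q * e p.2 = b q) ∧
      (∀ q, b q ∈ offDiagIdeal e) ∧
      (∀ y ∈ offDiagIdeal e, ∃ x : Fin d → B,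
        e p.1 * y * e p.2 - ∑ q, b q * x q ∈ offDiagIdeal e ^ 2) ∧
      ∀ x : Fin d → B, (∀ q, e p.2 * x q * e p.2 = x q) → ∑ q, b q * x q ∈ offDiagIdeal e ^ 2 →
        ∀ q, x q = 0 := by
    rintro ⟨z, m⟩
    by_cases hzm : z = m
    · subst hzm
      refine ⟨0, Fin.elim0, fun q => q.elim0, fun q => q.elim0, fun y hy => ⟨0, ?_⟩,
        fun _ _ _ q => q.elim0⟩
      rw [he.diag_eq_zero_of_mem hy]
      simp
    · obtain ⟨d, b, h1, h2, h3⟩ := he.exists_corner_basis h hzm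
      refine ⟨d, b, h1, fun q => ?_, fun y _ => h2 y, h3⟩
      rw [← h1 q]
      exact mem_offDiagIdeal (Ne.symm hzm) _
  choose d b hb hbJ hspan hind using hex
  let φ := Fintype.equivFin (Σ p : Λ × Λ, Fin (d p))
  refine ⟨_, fun i => (φ.symm i).1.2, fun i => b (φ.symm i).1 (φ.symm i).2, fun i => hbJ _ _,
    fun i => ?_, fun y hy => ?_, fun x hx i => ?_⟩
  · have := hb (φ.symm i).1 (φ.symm i).2
    rw [← this, mul_assoc, he.idem]
  · choose x hx using fun p => hspan p y hy
    refine ⟨fun i => x (φ.symm i).1 (φ.symm i).2, ?_⟩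
    rw [φ.symm.sum_comp (fun s : Σ p : Λ × Λ, Fin (d p) => b s.1 s.2 * x s.1 s.2),
      Fintype.sum_sigma]
    have h1 : y = ∑ p : Λ × Λ, e p.1 * y * e p.2 := by
      rw [Fintype.sum_prod_type]
      simp only [he.mul_sum, he.sum_mul]
    conv in y - _ => rw [h1]
    rw [← Finset.sum_sub_distrib]
    exact sum_mem fun p _ => hx p
  · obtain ⟨s, rfl⟩ := φ.surjective i
    rw [φ.symm_apply_apply]
    obtain ⟨⟨z, m⟩, q⟩ := s
    let x' : ∀ p : Λ × Λ, Fin (d p) → B := fun p q => x (φ ⟨p, q⟩)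
    have hx1 : ∑ p : Λ × Λ, ∑ q, b p q * x' p q ∈ offDiagIdeal e ^ 2 := by
      rw [← Fintype.sum_sigma (fun s : Σ p : Λ × Λ, Fin (d p) => b s.1 s.2 * x' s.1 s.2),
        ← φ.symm.sum_comp]
      simpa [x'] using hx
    have hx2 : ∑ q, b (z, m) q * (e m * x' (z, m) q * e m) ∈ offDiagIdeal e ^ 2 := by
      have h1 := Ideal.mul_mem_right (e m) _ (Ideal.mul_mem_left _ (e z) hx1)
      have h2 : e z * (∑ p : Λ × Λ, ∑ q, b p q * x' p q) * e m =
          ∑ q, b (z, m) q * (e m * x' (z, m) q * e m) +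
          ∑ p ∈ Finset.univ.erase (z, m), e z * (∑ q, b p q * x' p q) * e m := by
        rw [Finset.mul_sum, Finset.sum_mul, ← Finset.add_sum_erase _ _ (Finset.mem_univ (z, m))]
        congr 1
        rw [Finset.mul_sum, Finset.sum_mul]
        refine Finset.sum_congr rfl fun q _ => ?_
        rw [← hb (z, m) q]
        simp only [mul_assoc, he.idem_assoc]
      rw [h2] at h1
      refine (Submodule.add_mem_iff_left _ ?_).1 h1
      refine sum_mem fun p hp => ?_
      rw [Finset.mul_sum, Finset.sum_mul]
      refine sum_mem fun q _ => ?_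
      rw [← hb p q]
      -- In the same row but another column the coefficient contributes a second factor from J, so
      -- the term is in J^2. In another row the term is zero.
      by_cases hpz : p.1 = z
      · have hpm : p.2 ≠ m := fun h => (Finset.mem_erase.1 hp).1 (Prod.ext hpz h)
        have h3 := GrPiece.mul_mem (mem_pow_one_iff.2 (hbJ p q))
          (mem_pow_one_iff.2 (mem_offDiagIdeal (e := e) hpm.symm (x' p q)))
        have h4 := Ideal.mul_mem_left _ (e z) h3
        rw [← hb p q] at h4
        simpa only [mul_assoc, he.idem_assoc] using h4
      · have h5 : e z * (e p.1 * b p q * e p.2 * x' p q) * e m = 0 := by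
          simp only [← mul_assoc, he.mul_of_ne (Ne.symm hpz), zero_mul]
        rw [h5]
        exact zero_mem _
    have hx3 := hind (z, m) _ (fun q => by simp only [mul_assoc, he.idem, he.idem_assoc]) hx2 q
    change e m * x' (z, m) q ∈ offDiagIdeal e
    rw [he.mem_offDiagIdeal_iff_diag]
    intro l
    by_cases hl : l = m
    · rw [hl, he.idem_assoc]; exact hx3
    · rw [← mul_assoc, he.mul_of_ne hl, zero_mul, zero_mul]

end

end SplitDirected

/-! ### Proper standard filtrations of standard modules -/

namespace SplitDirected

variable {k : Type u} [Field k] {B : Type v} [Ring B] [Algebra k B]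
  {Λ : Type w} [Fintype Λ] {e : Λ → B}

section
variable (he : SplitDirected k e)
include he

omit [Fintype Λ] he [Algebra k B] in
theorem op_mem_idemTrace_iff {U : Set Λ} {x : B} :
    MulOpposite.op x ∈ idemTrace (fun l => MulOpposite.op (e l)) U (⊤ : Submodule Bᵐᵒᵖ Bᵐᵒᵖ) ↔
      x ∈ idemTrace e U (⊤ : Submodule B B) := by
  constructor
  · intro h
    suffices H : ∀ y ∈ idemTrace (fun l => MulOpposite.op (e l)) U (⊤ : Submodule Bᵐᵒᵖ Bᵐᵒᵖ),
        y.unop ∈ idemTrace e U (⊤ : Submodule B B) from H _ h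
    intro y hy
    refine Submodule.span_induction ?_ ?_ ?_ ?_ hy
    · rintro _ ⟨z, hz, n, -, rfl⟩
      have := idem_mul_mem_idemTrace (e := e) hz (1 : B)
      rw [mul_one] at this
      exact Submodule.smul_mem _ n.unop this
    · exact zero_mem _
    · intro x y _ _ hx hy
      exact add_mem hx hy
    · intro b x _ hx
      exact mul_mem_idemTrace hx b.unop
  · intro h
    refine Submodule.span_induction ?_ ?_ ?_ ?_ h
    · rintro _ ⟨z, hz, n, -, rfl⟩
      have := idem_mul_mem_idemTrace (e := fun l => MulOpposite.op (e l)) hz (1 : Bᵐᵒᵖ)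
      rw [mul_one] at this
      exact Submodule.smul_mem _ (MulOpposite.op n) this
    · exact zero_mem _
    · intro x y _ _ hx hy
      exact add_mem hx hy
    · intro b x _ hx
      exact mul_mem_idemTrace hx (MulOpposite.op b)

variable [Module.Finite k B]

/-- A basis of `J` as a right module gives a basis of `e_z A e_l`, modulo a trace, as a right
module over the corner ring `e_l A e_l`. -/
theorem exists_corner_basis_of_op
    (h : Module.Projective Bᵐᵒᵖ (offDiagIdeal fun l => MulOpposite.op (e l)))
    {l : Λ} {U : Set Λ} (hl : l ∉ U) (z : Λ) :
    ∃ (ι : Type) (_ : Fintype ι) (u : ι → B), (∀ p, e z * u p = u p) ∧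
      (∀ y, ∃ r : ι → B, (∀ p, r p ∈ corner k e l) ∧
        e z * y * e l - ∑ p, u p * r p ∈ idemTrace e U (⊤ : Submodule B B)) ∧
      ∀ r : ι → B, (∀ p, r p ∈ corner k e l) →
        ∑ p, u p * r p ∈ idemTrace e U (⊤ : Submodule B B) → ∀ p, r p = 0 := by
  have : Module.Finite k Bᵐᵒᵖ := finite_mulOpposite
  obtain ⟨ht, hht⟩ := he.op.exists_height
  have hwf : WellFounded fun a b => ht b < ht a :=
    @Finite.wellFounded_of_trans_of_irrefl Λ _ (fun a b => ht b < ht a)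
      ⟨fun a b c h1 h2 => h2.trans h1⟩ ⟨fun a => lt_irrefl _⟩
  induction z using hwf.induction with
  | _ z ih =>
    by_cases hzU : z ∈ U
    · refine ⟨Empty, inferInstance, Empty.elim, fun p => p.elim, fun y => ⟨Empty.elim,
        fun p => p.elim, ?_⟩, fun _ _ _ p => p.elim⟩
      rw [Finset.univ_eq_empty, Finset.sum_empty, sub_zero, mul_assoc]
      exact idem_mul_mem_idemTrace hzU _
    by_cases hzl : z = l
    · subst hzl
      have hcor : ∀ r ∈ corner k e z, e z * r = r := fun r hr => by
        rw [← he.mem_corner_iff.1 hr]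
        simp only [mul_assoc, he.idem_assoc]
      refine ⟨Unit, inferInstance, fun _ => e z, fun _ => he.idem z,
        fun y => ⟨fun _ => e z * y * e z, fun _ => ?_, ?_⟩, fun r hr hsum p => ?_⟩
      · rw [he.mem_corner_iff]; simp only [mul_assoc, he.idem, he.idem_assoc]
      · simp only [mul_assoc, he.idem_assoc, Finset.univ_unique, Finset.sum_const,
          Finset.card_singleton, one_smul, sub_self]
        exact zero_mem _
      · rw [Fintype.sum_unique, hcor _ (hr _)] at hsum
        rw [← he.mem_corner_iff.1 (hr p)]
        exact he.diag_eq_zero_of_mem_idemTrace hl hsum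
    -- As z ≠ l, e_z A e_l lies in e_z J = ⨁ γ_q A with γ_q A ≅ e_(t q) A. So the products of γ_q
    -- with the elements found for t q form a basis for z.
    · obtain ⟨n, t, g, hg⟩ := he.op.exists_isProjBasis_radAt h z
      choose ι hι u hu hspan hind using fun q =>
        ih (t q) (he.op.height_lt_of_isProjBasis hht hg q)
      let γ : Fin n → B := fun q => (g q : Bᵐᵒᵖ).unop
      have hγz : ∀ q, e z * γ q = γ q := fun q =>
        congrArg MulOpposite.unop (he.op.mem_projMod_iff.1 (g q).2.2)
      have hγt : ∀ q, γ q * e (t q) = γ q := fun q =>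
        congrArg (fun x => MulOpposite.unop (Subtype.val x)) (hg.idem q)
      refine ⟨Σ q, ι q, inferInstance, fun s => γ s.1 * u s.1 s.2, fun s => ?_, fun y => ?_,
        fun r hr hsum => ?_⟩
      · rw [← mul_assoc, hγz]
      · have hy : MulOpposite.op (e z * y * e l) ∈ radAt (fun l => MulOpposite.op (e l)) z :=
          ⟨he.op_mem_offDiagIdeal_iff.2 (mem_offDiagIdeal (Ne.symm hzl) y),
            he.op.mem_projMod_iff.2 (by
              rw [← MulOpposite.op_mul]
              simp only [mul_assoc, he.idem_assoc])⟩
        obtain ⟨x, hx⟩ := hg.span ⟨_, hy⟩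
        have hx' : ∑ q, γ q * (x q).unop = e z * y * e l := by
          have := congrArg (fun x => MulOpposite.unop (Subtype.val x)) hx
          simpa [Finset.unop_sum] using this
        choose r hr hrx using fun q => hspan q (x q).unop
        refine ⟨fun s => r s.1 s.2, fun s => hr _ _, ?_⟩
        have h1 := sum_mem (t := Finset.univ) fun q _ =>
          (idemTrace e U (⊤ : Submodule B B)).smul_mem (γ q) (hrx q)
        have h2 : ∑ q, γ q • (e (t q) * (x q).unop * e l - ∑ p, u q p * r q p) =
            e z * y * e l - ∑ s : Σ q, ι q, γ s.1 * u s.1 s.2 * r s.1 s.2 := by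
          simp only [smul_eq_mul, mul_sub, Finset.sum_sub_distrib, Fintype.sum_sigma,
            Finset.mul_sum, mul_assoc]
          congr 1
          simp only [← mul_assoc, hγt, ← Finset.sum_mul, hx']
          simp only [mul_assoc, he.idem]
        rwa [h2] at h1
      · set X : Fin n → B := fun q => ∑ p, u q p * r ⟨q, p⟩ with hX
        have hsum' : ∑ s : Σ q, ι q, γ s.1 * u s.1 s.2 * r s = ∑ q, γ q * X q := by
          simp only [Fintype.sum_sigma, hX, Finset.mul_sum, mul_assoc]
        rw [hsum'] at hsum
        -- As z ∉ U, the sum also has coefficients from the trace, and uniqueness of coefficients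
        -- puts every X q into the trace.
        obtain ⟨x, hx, hxs⟩ := he.op.exists_sum_eq_of_mem_idemTrace hzU hg
          (op_mem_idemTrace_iff.2 hsum)
        have hxs' : ∑ q, γ q * (x q).unop = ∑ q, γ q * X q := by
          have := congrArg MulOpposite.unop hxs
          rw [← MulOpposite.op_mul, MulOpposite.unop_op, Finset.mul_sum] at this
          simp only [← mul_assoc, hγz] at this
          rw [← this, Finset.unop_sum]
          rfl
        have h0 : ∑ q, (MulOpposite.op (X q) - x q) • g q = 0 := by
          refine Subtype.ext (MulOpposite.unop_injective ?_)
          rw [Submodule.coe_sum, Finset.unop_sum]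
          change ∑ q, γ q * (X q - (x q).unop) = 0
          simp only [mul_sub, Finset.sum_sub_distrib, hxs', sub_self]
        rintro ⟨q, p⟩
        refine hind q (fun p => r ⟨q, p⟩) (fun p => hr _) ?_ p
        have h1 : e (t q) * (X q - (x q).unop) = 0 :=
          congrArg MulOpposite.unop (hg.indep _ h0 q)
        have h2 : e (t q) * X q = X q := by
          simp only [hX, Finset.mul_sum, ← mul_assoc, hu]
        rw [mul_sub, h2, sub_eq_zero] at h1
        change X q ∈ _
        rw [h1]
        exact Submodule.smul_mem _ _ (op_mem_idemTrace_iff.1 (hx q))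

/-- The union over all z makes P_l modulo the trace a free right module over e_l A e_l. Coefficients
are taken in P_l so that they can be compared with its submodules. -/
theorem exists_projMod_corner_basis
    (h : Module.Projective Bᵐᵒᵖ (offDiagIdeal fun l => MulOpposite.op (e l)))
    {l : Λ} {U : Set Λ} (hl : l ∉ U) :
    ∃ (ι : Type w) (_ : Fintype ι) (u : ι → B),
      (∀ x : ProjMod e l, ∃ r : ι → ProjMod e l, (∀ p, e l • r p = r p) ∧
        (x : B) - ∑ p, u p * (r p : B) ∈ idemTrace e U (⊤ : Submodule B B)) ∧
      ∀ r : ι → ProjMod e l, (∀ p, e l • r p = r p) →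
        ∑ p, u p * (r p : B) ∈ idemTrace e U (⊤ : Submodule B B) → ∀ p, r p = 0 := by
  classical
  choose ι hι u hu hspan hind using he.exists_corner_basis_of_op h hl
  refine ⟨Σ z, ι z, inferInstance, fun s => u s.1 s.2, fun x => ?_, fun r hr hsum => ?_⟩
  · choose r hr hx using fun z => hspan z (x : B)
    have hrP : ∀ z p, r z p * e l = r z p := fun z p => by
      rw [← he.mem_corner_iff.1 (hr z p), mul_assoc, he.idem]
    refine ⟨fun s => ⟨r s.1 s.2, he.mem_projMod_iff.2 (hrP _ _)⟩, fun s => Subtype.ext ?_, ?_⟩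
    · change e l * r s.1 s.2 = r s.1 s.2
      rw [← he.mem_corner_iff.1 (hr s.1 s.2)]
      simp only [mul_assoc, he.idem_assoc]
    · have h1 := sum_mem (t := Finset.univ) fun z _ => hx z
      rw [Finset.sum_sub_distrib, ← Finset.sum_mul, he.sum_mul, he.mem_projMod_iff.1 x.2] at h1
      rwa [Fintype.sum_sigma]
  · rintro ⟨z, p⟩
    have hrc : ∀ s, (r s : B) ∈ corner k e l := fun s => by
      rw [he.mem_corner_iff, mul_assoc, he.mem_projMod_iff.1 (r s).2]
      exact congrArg Subtype.val (hr s)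
    refine Subtype.ext (hind z (fun p => r ⟨z, p⟩) (fun p => hrc _) ?_ p)
    have h1 := Submodule.smul_mem _ (e z) hsum
    rw [Fintype.sum_sigma, smul_eq_mul, Finset.mul_sum, Finset.sum_eq_single z] at h1
    · simpa only [Finset.mul_sum, ← mul_assoc, hu] using h1
    · intro w _ hw
      rw [Finset.mul_sum]
      refine Finset.sum_eq_zero fun p _ => ?_
      change e z * (u w p * _) = 0
      rw [← hu w p, ← mul_assoc, ← mul_assoc, he.mul_of_ne (Ne.symm hw), zero_mul, zero_mul]
    · simp

/-- A proper submodule of `P_l` has an element of the corner ring `e_l A e_l` outside it that the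
radical of the corner ring maps into it. -/
theorem exists_socle_element {l : Λ} {F : Submodule B (ProjMod e l)} (hF : gen e l ∉ F) :
    ∃ c : ProjMod e l, e l • c = c ∧ c ∉ F ∧
      ∀ x : ProjMod e l, (x : B) ∈ Ring.jacobson B → e l • x = x → (x : B) • c ∈ F := by
  classical
  obtain ⟨N, hN⟩ := isNilpotent_jacobson (B := B) k
  have hex : ∃ i : ℕ, ∀ c : ProjMod e l, e l • c = c → (c : B) ∈ Ring.jacobson B ^ i → c ∈ F := by
    refine ⟨N, fun c _ hc => ?_⟩
    rw [hN] at hc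
    have : c = 0 := Subtype.ext (by simpa using hc)
    rw [this]
    exact zero_mem _
  -- For the least power of the radical whose corner elements all lie in F, the preceding power
  -- contains a suitable c. The power 0 is excluded because e_l ∉ F.
  have hspec := Nat.find_spec hex
  have hmin := fun m => Nat.find_min hex (m := m)
  generalize Nat.find hex = i at hspec hmin
  cases i with
  | zero => exact absurd (hspec _ (he.idem_smul_gen l) (GrPiece.mem_pow_zero _)) hF
  | succ i =>
    have := hmin i (Nat.lt_succ_self i)
    push Not at this
    obtain ⟨c, hc1, hc2, hc3⟩ := this
    refine ⟨c, hc1, hc3, fun x hx hx' => hspec _ ?_ ?_⟩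
    · rw [smul_smul]
      congr 1
      exact congrArg Subtype.val hx'
    · have := GrPiece.mul_mem (I := Ring.jacobson B) (mem_pow_one_iff.2 hx) hc2
      rwa [add_comm] at this

set_option maxHeartbeats 400000 in
/-- If `P_l / K_l` is free over the corner ring `e_l A e_l`, it is filtered by copies of `Δ̄_l`. -/
theorem hasFiltrationBy_quot [LinearOrder Λ] {l : Λ} {ι : Type*} [Fintype ι] {u : ι → B}
    (hspan : ∀ x : ProjMod e l, ∃ r : ι → ProjMod e l, (∀ p, e l • r p = r p) ∧
      (x : B) - ∑ p, u p * (r p : B) ∈ idemTrace e {w | l < w} (⊤ : Submodule B B))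
    (hind : ∀ r : ι → ProjMod e l, (∀ p, e l • r p = r p) →
      ∑ p, u p * (r p : B) ∈ idemTrace e {w | l < w} (⊤ : Submodule B B) → ∀ p, r p = 0)
    (F : Submodule B (ProjMod e l)) (hF : standardKer e l ≤ F)
    (hF' : ∀ x ∈ F, ∃ r : ι → ProjMod e l, (∀ p, e l • r p = r p ∧ r p ∈ F) ∧
      (x : B) - ∑ p, u p * (r p : B) ∈ idemTrace e {w | l < w} (⊤ : Submodule B B)) :
    HasFiltrationBy (A := B) (ProjMod e l ⧸ F) (ProperStandardMod e) Set.univ := by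
  have := he.finite_projMod l
  have : IsNoetherian B (ProjMod e l) := isNoetherian_of_tower k inferInstance
  -- By `hF'`, F is determined by the left ideal I = F ∩ e_l A e_l of the corner ring: modulo the
  -- trace, F is ∑ u_p I. Enlarging I by one element c that is socle modulo I adds one copy of Δ̄_l.
  induction F using IsNoetherian.induction with
  | _ F ih =>
    by_cases hg : gen e l ∈ F
    · have : F = ⊤ := eq_top_iff.2 fun x _ => by
        rw [← he.smul_gen x]
        exact F.smul_mem _ hg
      subst this
      exact HasFiltrationBy.of_subsingleton
    obtain ⟨c, hc1, hcF, hc2⟩ := he.exists_socle_element hg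
    have hc1' : e l * (c : B) = c := congrArg Subtype.val hc1
    let h₀ : ProjMod e l →ₗ[B] ProjMod e l ⧸ F :=
      F.mkQ.comp ((LinearMap.toSpanSingleton B (ProjMod e l) c).comp (ProjMod e l).subtype)
    have hh₀ : ∀ x, h₀ x = Submodule.Quotient.mk ((x : B) • c) := fun x => rfl
    have hle : properStandardKer e l ≤ LinearMap.ker h₀ := by
      rw [he.properStandardKer_eq, Submodule.span_le]
      intro x hx
      rw [SetLike.mem_coe, LinearMap.mem_ker, hh₀, Submodule.Quotient.mk_eq_zero]
      rcases hx with ⟨w, hw, hx⟩ | ⟨hx, hx'⟩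
      · refine hF ?_
        rw [he.standardKer_eq]
        have hx1 : e w * (x : B) = x := congrArg Subtype.val hx
        change (x : B) * (c : B) ∈ idemTrace e {w | l < w} (⊤ : Submodule B B)
        rw [← hx1, mul_assoc]
        exact idem_mul_mem_idemTrace (U := {w | l < w}) hw _
      · exact hc2 x hx hx'
    -- If x c ∈ F and x is ∑ u_p r_p modulo the trace, freeness gives r_p c ∈ F. An r_p outside the
    -- radical would be invertible in the corner and force c ∈ F.
    have hker : LinearMap.ker h₀ ≤ properStandardKer e l := by
      intro x hx
      rw [LinearMap.mem_ker, hh₀, Submodule.Quotient.mk_eq_zero] at hx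
      obtain ⟨r, hr, hxr⟩ := hspan x
      obtain ⟨s, hs, hxs⟩ := hF' _ hx
      have h1 := mul_mem_idemTrace hxr (c : B)
      have h2 : ∑ p, u p * (((r p : B) • c - s p : ProjMod e l) : B) ∈
          idemTrace e {w | l < w} (⊤ : Submodule B B) := by
        have h3 := sub_mem hxs h1
        have h4 : ((x : B) • c : ProjMod e l) - ∑ p, u p * (s p : B) -
            ((x : B) - ∑ p, u p * (r p : B)) * (c : B) =
            ∑ p, u p * (((r p : B) • c - s p : ProjMod e l) : B) := by
          have h5 : ∀ p, (((r p : B) • c - s p : ProjMod e l) : B) = (r p : B) * c - s p :=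
            fun p => rfl
          have h6 : (((x : B) • c : ProjMod e l) : B) = (x : B) * c := rfl
          simp only [h5, h6, sub_mul, mul_sub, Finset.sum_mul, Finset.sum_sub_distrib, mul_assoc]
          abel
        rwa [h4] at h3
      have h5 := hind _ (fun p => by
        rw [smul_sub, (hs p).1, smul_smul]
        congr 2
        exact congrArg Subtype.val (hr p)) h2
      have h6 : ∀ p, (r p : B) ∈ Ring.jacobson B := by
        intro p
        by_contra hp
        obtain ⟨v, hv, -⟩ := he.exists_corner_inv (l := l) (y := (r p : B)) (by
          rw [mul_assoc, he.mem_projMod_iff.1 (r p).2]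
          exact congrArg Subtype.val (hr p)) hp
        refine hcF ?_
        have h7 : (r p : B) • c ∈ F := by
          rw [sub_eq_zero.1 (h5 p)]
          exact (hs p).2
        have h8 := F.smul_mem v h7
        rwa [smul_smul, hv, hc1] at h8
      rw [he.properStandardKer_eq]
      have h9 : x = (⟨(x : B) - ∑ p, u p * (r p : B), (ProjMod e l).sub_mem x.2
          (sum_mem fun p _ => (ProjMod e l).smul_mem _ (r p).2)⟩ : ProjMod e l) +
          ∑ p, u p • r p := by
        refine Subtype.ext ?_
        rw [Submodule.coe_add, Submodule.coe_sum]
        exact (sub_add_cancel _ _).symm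
      rw [h9]
      refine add_mem ?_ (sum_mem fun p _ => Submodule.smul_mem _ _
        (Submodule.subset_span (Or.inr ⟨h6 p, hr p⟩)))
      have h10 : (idemTrace e {w | l < w} (⊤ : Submodule B B)).submoduleOf (ProjMod e l) ≤
          Submodule.span B {x : ProjMod e l |
            (∃ w, l < w ∧ e w • x = x) ∨ ((x : B) ∈ Ring.jacobson B ∧ e l • x = x)} :=
        he.idemTrace_submoduleOf_le_iff.2 fun m hm x =>
          Submodule.subset_span (Or.inl ⟨m, hm, by rw [smul_smul, he.idem]⟩)
      exact h10 hxr
    have hlt : F < F ⊔ Submodule.span B {c} := lt_of_le_of_ne le_sup_left fun h => hcF (by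
      rw [h]
      exact Submodule.mem_sup_right (Submodule.mem_span_singleton_self c))
    have hnext := ih (F ⊔ Submodule.span B {c}) hlt (hF.trans hlt.le) (by
      intro x hx
      obtain ⟨f, hf, y, hy, rfl⟩ := Submodule.mem_sup.1 hx
      obtain ⟨b, rfl⟩ := Submodule.mem_span_singleton.1 hy
      obtain ⟨r, hr, hfr⟩ := hF' f hf
      obtain ⟨s, hs, hbs⟩ := hspan ⟨b * e l, he.mul_idem_mem _ _⟩
      refine ⟨fun p => r p + (s p : B) • c, fun p => ⟨?_, ?_⟩, ?_⟩
      · rw [smul_add, (hr p).1, smul_smul]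
        congr 2
        exact congrArg Subtype.val (hs p)
      · exact add_mem (Submodule.mem_sup_left (hr p).2) (Submodule.mem_sup_right
          (Submodule.smul_mem _ _ (Submodule.mem_span_singleton_self c)))
      · have h1 := add_mem hfr (mul_mem_idemTrace hbs (c : B))
        have h2 : ∀ p, ((r p + (s p : B) • c : ProjMod e l) : B) = r p + s p * (c : B) :=
          fun p => rfl
        have h3 : ((f + b • c : ProjMod e l) : B) = f + b * (c : B) := rfl
        rw [sub_mul, mul_assoc, hc1', Finset.sum_mul] at h1
        simp only [h2, h3, mul_add, Finset.sum_add_distrib, add_sub_add_comm]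
        simpa only [mul_assoc] using h1)
    refine HasFiltrationBy.of_exact (M' := ProperStandardMod e l)
      (HasFiltrationBy.of_equiv (Set.mem_univ l) (LinearEquiv.refl _ _)) hnext
      (f := (properStandardKer e l).liftQ h₀ hle) (g := Submodule.factor hlt.le) ?_ ?_ ?_
    · rw [← LinearMap.ker_eq_bot]
      exact Submodule.ker_liftQ_eq_bot _ _ _ hker
    · exact Submodule.factor_surjective hlt.le
    · rw [Submodule.range_liftQ]
      ext y
      obtain ⟨y, rfl⟩ := Submodule.Quotient.mk_surjective _ y
      rw [LinearMap.mem_ker]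
      change _ ↔ Submodule.Quotient.mk y = 0
      rw [Submodule.Quotient.mk_eq_zero]
      constructor
      · rintro ⟨x, hx⟩
        rw [hh₀, Submodule.Quotient.eq] at hx
        have h1 : (x : B) • c ∈ F ⊔ Submodule.span B {c} := Submodule.mem_sup_right
          (Submodule.smul_mem _ _ (Submodule.mem_span_singleton_self c))
        have h2 := sub_mem h1 (hlt.le hx)
        rwa [sub_sub_cancel] at h2
      · intro hy
        obtain ⟨f, hf, d, hd, rfl⟩ := Submodule.mem_sup.1 hy
        obtain ⟨b, rfl⟩ := Submodule.mem_span_singleton.1 hd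
        refine ⟨⟨b * e l, he.mul_idem_mem _ _⟩, ?_⟩
        rw [hh₀, Submodule.Quotient.eq]
        change (b * e l) • c - (f + b • c) ∈ F
        rw [mul_smul, hc1, sub_add_cancel_right]
        exact neg_mem hf

/-- The left basis gives the standard filtration and makes gr A a tensor algebra. Therefore the
right basis of J / J^2 makes J right projective and every Δ_l free over its corner ring, and the
standard factors can be refined. -/
theorem isProperlyStratified [LinearOrder Λ] (h : HasGradedBasis e) (hr : HasRightBasis e) :
    IsProperlyStratified e := by
  have hJ := he.projective_of_hasGradedBasis h
  have hstd := he.hasFiltrationBy_standardMod hJ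
  refine ⟨hstd, hstd.refine_by fun l _ => ?_⟩
  have : Module.Finite k Bᵐᵒᵖ := finite_mulOpposite
  have hop := he.op.projective_of_hasGradedBasis
    (he.hasGradedBasis_op (he.grIsTensorAlgebra_of_hasGradedBasis h) hr)
  obtain ⟨ι, hι, u, hspan, hind⟩ := he.exists_projMod_corner_basis hop (l := l)
    (U := {w | l < w}) (lt_irrefl l)
  -- The refinement starts from the standard kernel, which is the trace itself, so all coefficients
  -- are 0.
  refine he.hasFiltrationBy_quot hspan hind _ le_rfl fun x hx => ⟨0, fun p => ⟨?_, ?_⟩, ?_⟩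
  · exact smul_zero _
  · exact zero_mem _
  · rw [he.standardKer_eq] at hx
    have hx' : (x : B) ∈ idemTrace e {w | l < w} (⊤ : Submodule B B) := hx
    simpa using hx'

theorem forall_isProperlyStratified_iff :
    (∀ _ : LinearOrder Λ, IsProperlyStratified e) ↔ HasGradedBasis e ∧ HasRightBasis e :=
  ⟨fun h => ⟨he.hasGradedBasis_of_projective
      (he.projective_of_forall_hasFiltrationBy fun s => (h s).1),
    he.hasRightBasis_of_forall_hasFiltrationBy fun s => (h s).2⟩,
    fun h _ => he.isProperlyStratified h.1 h.2⟩

end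

end SplitDirected

/-! ### Primitive idempotents -/

section Primitive

open Polynomial

variable {k : Type u} [Field k] {B : Type v} [Ring B] [Algebra k B] [Module.Finite k B]

/-- An element of a finite-dimensional algebra is inverted or annihilated, up to a power, by an
idempotent that is a polynomial in it. -/
theorem exists_fitting_polynomial (x : B) : ∃ (n : ℕ) (a : k[X]),
    IsIdempotentElem (aeval x a * x ^ (n + 1)) ∧ (aeval x a * x ^ (n + 1) = 0 → x ^ (n + 1) = 0) := by
  have hint : IsIntegral k x := Algebra.IsIntegral.isIntegral x
  -- The extra factor X makes the exponent n + 1 positive, so that the idempotent is divisible by x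
  -- and lies in the same corner as x.
  have hp : X * minpoly k x ≠ 0 := mul_ne_zero X_ne_zero (minpoly.ne_zero hint)
  obtain ⟨q, hq, hnd⟩ := exists_eq_pow_rootMultiplicity_mul_and_not_dvd (X * minpoly k x) hp 0
  rw [C_0, sub_zero] at hq hnd
  have hpos : 0 < rootMultiplicity 0 (X * minpoly k x) :=
    (rootMultiplicity_pos hp).2 (by simp [IsRoot])
  obtain ⟨n, hn⟩ : ∃ n, rootMultiplicity 0 (X * minpoly k x) = n + 1 :=
    ⟨_, (Nat.succ_pred_eq_of_pos hpos).symm⟩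
  rw [hn] at hq
  have hcop : IsCoprime (X ^ (n + 1)) q :=
    IsCoprime.pow_left ((irreducible_X.coprime_iff_not_dvd).2 hnd)
  obtain ⟨a, b, hab⟩ := hcop
  have hzero : aeval x (X ^ (n + 1) * q) = 0 := by
    rw [← hq, map_mul, minpoly.aeval, mul_zero]
  have hf : aeval x a * x ^ (n + 1) = aeval x (a * X ^ (n + 1)) := by simp
  refine ⟨n, a, ?_, fun h => ?_⟩
  · rw [hf, IsIdempotentElem, ← map_mul, ← sub_eq_zero, ← map_sub]
    have : a * X ^ (n + 1) * (a * X ^ (n + 1)) - a * X ^ (n + 1) =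
        -(a * b) * (X ^ (n + 1) * q) := by
      have h1 : a * X ^ (n + 1) = 1 - b * q := by rw [← hab]; ring
      calc _ = a * X ^ (n + 1) * (a * X ^ (n + 1) - 1) := by ring
        _ = a * X ^ (n + 1) * (1 - b * q - 1) := by rw [h1]
        _ = _ := by ring
    rw [this, map_mul, hzero, mul_zero]
  · have h1 : x ^ (n + 1) = aeval x ((X : k[X]) ^ (n + 1)) := by simp
    rw [hf] at h
    have h2 : (X : k[X]) ^ (n + 1) = X ^ (n + 1) * (a * X ^ (n + 1)) + b * (X ^ (n + 1) * q) := by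
      calc (X : k[X]) ^ (n + 1) = X ^ (n + 1) * (a * X ^ (n + 1) + b * q) := by rw [hab, mul_one]
        _ = _ := by ring
    rw [h1, h2, map_add, map_mul, map_mul _ b, h, hzero, mul_zero, mul_zero, add_zero]

/-- The Fitting idempotent of x lies in the corner e B e, so primitivity leaves only 0, where x is
nilpotent, and e, where x has a left inverse. -/
theorem IsPrimitiveIdem.isNilpotent_or_exists_left_inv (k : Type u) [Field k] {B : Type v} [Ring B]
    [Algebra k B] [Module.Finite k B] {e x : B} (he : IsPrimitiveIdem e) (hl : e * x = x)
    (hr : x * e = x) : IsNilpotent x ∨ ∃ u, u * x = e := by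
  obtain ⟨n, a, hid, hz⟩ := exists_fitting_polynomial (k := k) x
  set f := aeval x a * x ^ (n + 1) with hf
  have hfe : f * e = f := by rw [hf, pow_succ, ← mul_assoc, mul_assoc _ x, hr]
  have hef : e * f = f := by
    have hcomm : Commute (aeval x a) (x ^ (n + 1)) := by
      have h1 : x ^ (n + 1) = aeval x ((X : k[X]) ^ (n + 1)) := by simp
      rw [h1, Commute, SemiconjBy, ← map_mul, ← map_mul, mul_comm]
    rw [hf, hcomm.eq, pow_succ', ← mul_assoc, ← mul_assoc, hl]
  have hee : e * e = e := he.1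
  have hff : f * f = f := hid
  rcases he.2.2 f (e - f) hid (by
    rw [IsIdempotentElem, mul_sub, sub_mul, sub_mul, hee, hfe, hef, hff, sub_self, sub_zero])
    (by rw [mul_sub, hfe, hff, sub_self]) (by rw [sub_mul, hef, hff, sub_self])
    (add_sub_cancel f e).symm with h | h
  · exact Or.inl ⟨n + 1, hz h⟩
  · refine Or.inr ⟨aeval x a * x ^ n, ?_⟩
    rw [sub_eq_zero] at h
    rw [h, hf, pow_succ, mul_assoc]

/-- Over an algebraically closed field, left multiplication by e b e on e B has an eigenvalue c. An
eigenvector rules out a left inverse of e b e - c e, which is therefore nilpotent. -/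
theorem IsPrimitiveIdem.exists_isNilpotent_sub [IsAlgClosed k] {e : B} (he : IsPrimitiveIdem e)
    (b : B) : ∃ c : k, IsNilpotent (e * b * e - c • e) := by
  have hee : e * e = e := he.1
  let W : Submodule k B := LinearMap.range (LinearMap.mulLeft k e)
  have hW : ∀ v ∈ W, e * v = v := by
    rintro _ ⟨v, rfl⟩
    rw [LinearMap.mulLeft_apply, ← mul_assoc, hee]
  have : Nontrivial W := ⟨⟨⟨e, e, hee⟩, 0, fun h => he.2.1 (congrArg Subtype.val h)⟩⟩
  let φ : Module.End k W := (LinearMap.mulLeft k (e * b * e)).restrict (p := W) (q := W) fun v _ =>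
    ⟨b * e * v, by simp only [LinearMap.mulLeft_apply, mul_assoc]⟩
  obtain ⟨c, hc⟩ := Module.End.exists_eigenvalue φ
  obtain ⟨v, hv⟩ := hc.exists_hasEigenvector
  refine ⟨c, ?_⟩
  rcases he.isNilpotent_or_exists_left_inv k (x := e * b * e - c • e) (by
    rw [mul_sub, mul_smul_comm, hee]; simp only [← mul_assoc, hee]) (by
    rw [sub_mul, smul_mul_assoc, hee]; simp only [mul_assoc, hee]) with h | ⟨u, hu⟩
  · exact h
  · exfalso
    refine hv.2 (Subtype.ext ?_)
    have h1 : e * b * e * (v : B) = c • (v : B) := congrArg Subtype.val hv.apply_eq_smul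
    have h2 : (e * b * e - c • e) * (v : B) = 0 := by
      rw [sub_mul, h1, smul_mul_assoc, hW v v.2, sub_self]
    rw [← hW v v.2, ← hu, mul_assoc, h2, mul_zero]
    rfl

end Primitive

/-- A complete family of orthogonal primitive idempotents with directed category is split. -/
theorem SplitDirected.of_isPrimitiveIdem {k : Type u} [Field k] [IsAlgClosed k] {A : Type v} [Ring A]
    [Algebra k A] [Module.Finite k A] {Λ : Type w} [Fintype Λ] {e : Λ → A}
    (he : CompleteOrthogonalIdempotents e) (hprim : ∀ l, IsPrimitiveIdem (e l))
    (hdir : IsDirectedCat e) : SplitDirected k e where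
  orth := he
  ne_zero l := (hprim l).2.1
  split l b := (hprim l).exists_isNilpotent_sub b
  dir := hdir

theorem theorem0p2 {k : Type u} [Field k] [IsAlgClosed k] {A : Type v} [Ring A] [Algebra k A]
    [Module.Finite k A] {Λ : Type w} [Fintype Λ] (e : Λ → A)
    (he : CompleteOrthogonalIdempotents e) (hprim : ∀ l, IsPrimitiveIdem (e l))
    (hbasic : IsBasicFor e) (hdir : IsDirectedCat e) :
    [∀ _ : LinearOrder Λ, IsStandardlyStratified e,
      ∀ _ : LinearOrder Λ, IsStandardlyStratified (grIdem k e),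
      GrIsTensorAlgebra k e ∧
        Module.Projective ↥(diagSubalgebra k e) (GrPiece (offDiagIdeal e) 1)].TFAE ∧
    [∀ _ : LinearOrder Λ, IsProperlyStratified e,
      ∀ _ : LinearOrder Λ, IsProperlyStratified (grIdem k e),
      GrIsTensorAlgebra k e ∧
        Module.Projective ↥(diagSubalgebra k e) (GrPiece (offDiagIdeal e) 1) ∧
        Module.Projective (↥(diagSubalgebra k e))ᵐᵒᵖ (GrPiece (offDiagIdeal e) 1)].TFAE := by
  have hs : SplitDirected k e := .of_isPrimitiveIdem he hprim hdir
  have hgr := hs.assocGr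
  have hfin : Module.Finite k (AssocGr (offDiagIdeal e)) :=
    finite_assocGr hs.isNilpotent_offDiagIdeal
  constructor
  -- All three statements are compared with one condition on bases of A, not with each other.
  · refine List.tfae_of_forall (HasGradedBasis e) _ ?_
    simp only [List.mem_cons, List.not_mem_nil, or_false, forall_eq_or_imp, forall_eq]
    refine ⟨?_, ?_, ?_⟩
    · rw [hs.forall_isStandardlyStratified_iff, hs.projective_iff_hasGradedBasis]
    · rw [hgr.forall_isStandardlyStratified_iff, hgr.projective_iff_hasGradedBasis,
        hs.hasGradedBasis_assocGr_iff]
    · exact hs.hasGradedBasis_iff_grIsTensorAlgebra.symm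
  · refine List.tfae_of_forall (HasGradedBasis e ∧ HasRightBasis e) _ ?_
    simp only [List.mem_cons, List.not_mem_nil, or_false, forall_eq_or_imp, forall_eq]
    refine ⟨?_, ?_, ?_⟩
    · exact hs.forall_isProperlyStratified_iff
    · rw [hgr.forall_isProperlyStratified_iff, hs.hasGradedBasis_assocGr_iff,
        hs.hasRightBasis_assocGr_iff]
    · rw [hs.hasGradedBasis_iff_grIsTensorAlgebra, hs.hasRightBasis_iff_projective, and_assoc]
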